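/- Let $X$ be an $n$-dimensional rigidified complex manifold: a second countable Hausdorff space with an atlas of charts to open subsets of $\mathbb{C}^n$ whose changes of coordinates have, locally, the form $(z_1,\dots,z_n)\mapsto(\phi^1(z_1),\dots,\phi^n(z_n))$ with $\phi^j$ holomorphic functions of one variable. Let $\mathrm{d}s^2$ be a distinctive Kähler metric on $X$: a smooth hermitian metric such that near every point $x\in X$ there are coordinates $(z_1,\dots,z_n)$ of the rigidified structure and a unitary coframe $\varphi_j=f_j(z_j)\,\mathrm{d}z_j$ ($j=1,\dots,n$), with each $f_j$ a smooth function of $z_j$ alone and $\frac{\partial f_j}{\partial\bar z_j}(x)=0$. For $\alpha,\beta\in\{0,1\}^n$, a smooth complex-valued differential form is of refined type $(\alpha,\beta)$ if in coordinates of the rigidified structure it is a function times $\bigwedge_{\alpha_j=1}\mathrm{d}z_j\wedge\bigwedge_{\beta_j=1}\mathrm{d}\bar z_j$; every smooth form is the sum of its components of the various refined types. Let $\xi_j$ be the operator which on forms of type $(\alpha,\beta)$ is zero if $\alpha_j=1$, and is $\mathrm{d}$ followed by the projection to the component of type $(\alpha+1_j,\beta)$ if $\alpha_j=0$. Let $\langle\psi,\eta\rangle=\int_X(\psi(x),\eta(x))\,\frac{\omega^n}{n!}$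 be the product of forms induced by the metric, where $\omega=\frac i2\sum_j\varphi_j\wedge\bar\varphi_j$. For $P=\mathrm{d}$ or $P=\xi_j$ let $P^\star$ be the adjoint, that is the operator on smooth forms, lowering the degree by one, such that $\langle P^\star\psi,\eta\rangle=\langle\psi,P\eta\rangle$ for all smooth $\psi$ and all compactly supported smooth $\eta$ (if $X$ is compact, for all smooth $\eta$), and let $\Delta_P=PP^\star+P^\star P$. Then these adjoints exist and are unique, and on smooth forms of every degree \[ \Delta_{\mathrm{d}}=2\sum_{j=1}^n\Delta_{\xi_j}. \] In particular, if $\psi$ is of refined type $(\alpha,\beta)$, so is $\Delta_{\mathrm{d}}\psi$. -/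

import Mathlib

open scoped Manifold ContDiff Topology
open Set

/-- The model space `ℂⁿ`. -/
abbrev Cn (n : ℕ) : Type := Fin n → ℂ

/-- `f` is rigid on `U`: there are holomorphic functions `φ_j` of one variable with
`f (z_1, …, z_n) = (φ_1 z_1, …, φ_n z_n)` on `U`. -/
def IsRigid {n : ℕ} (f : Cn n → Cn n) (U : Set (Cn n)) : Prop :=
  ∃ φ : Fin n → ℂ → ℂ, (∀ j, DifferentiableOn ℂ (φ j) ((fun z : Cn n => z j) '' U)) ∧
    ∀ z ∈ U, f z = fun j => φ j (z j)

/-- `f` is rigid near every point of `s`. -/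
def IsLocallyRigid {n : ℕ} (f : Cn n → Cn n) (s : Set (Cn n)) : Prop :=
  ∀ x ∈ s, ∃ u, IsOpen u ∧ x ∈ u ∧ IsRigid f (s ∩ u)

theorem IsRigid.mono {n : ℕ} {f : Cn n → Cn n} {U V : Set (Cn n)} (h : IsRigid f U)
    (hVU : V ⊆ U) : IsRigid f V := by
  obtain ⟨φ, h1, h2⟩ := h
  exact ⟨φ, fun j => (h1 j).mono (image_mono hVU), fun z hz => h2 z (hVU hz)⟩

theorem IsRigid.continuousOn {n : ℕ} {f : Cn n → Cn n} {U : Set (Cn n)} (h : IsRigid f U) :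
    ContinuousOn f U := by
  obtain ⟨φ, h1, h2⟩ := h
  refine ContinuousOn.congr ?_ h2
  refine continuousOn_pi.2 fun j => ?_
  exact (h1 j).continuousOn.comp (continuous_apply j).continuousOn (mapsTo_image _ _)

theorem IsRigid.comp {n : ℕ} {f g : Cn n → Cn n} {U V : Set (Cn n)} (hg : IsRigid g V)
    (hf : IsRigid f U) (hUV : MapsTo f U V) : IsRigid (g ∘ f) U := by
  obtain ⟨φ, h1, h2⟩ := hf
  obtain ⟨ψ, k1, k2⟩ := hg
  refine ⟨fun j => ψ j ∘ φ j, fun j => (k1 j).comp (h1 j) ?_, fun z hz => ?_⟩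
  · rintro _ ⟨z, hz, rfl⟩
    exact ⟨f z, hUV hz, by simp [h2 z hz]⟩
  · rw [Function.comp_apply, k2 _ (hUV hz), h2 z hz]; rfl

theorem IsRigid.contDiffOn {n : ℕ} {f : Cn n → Cn n} {U : Set (Cn n)} (hU : IsOpen U)
    (h : IsRigid f U) : ContDiffOn ℝ ∞ f U := by
  obtain ⟨φ, h1, h2⟩ := h
  refine ContDiffOn.congr ?_ h2
  refine contDiffOn_pi.2 fun j => ?_
  have hop : IsOpen ((fun z : Cn n => z j) '' U) := isOpenMap_eval j _ hU
  have := ((h1 j).contDiffOn (n := ∞) hop).restrict_scalars ℝ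
  exact this.comp (contDiff_apply ℝ ℂ j).contDiffOn (mapsTo_image _ _)

theorem IsRigid.fderiv_eq {n : ℕ} {f : Cn n → Cn n} {U : Set (Cn n)} (hU : IsOpen U)
    (h : IsRigid f U) {x : Cn n} (hx : x ∈ U) :
    ∃ c : Fin n → ℂ, ∀ v : Cn n, fderiv ℝ f x v = fun j => c j * v j := by
  obtain ⟨φ, h1, h2⟩ := h
  refine ⟨fun j => deriv (φ j) (x j), fun v => ?_⟩
  have key : HasFDerivAt f (ContinuousLinearMap.pi fun j =>
      ((deriv (φ j) (x j)) • (ContinuousLinearMap.proj j : Cn n →L[ℝ] ℂ))) x := by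
    have he : f =ᶠ[𝓝 x] fun z j => φ j (z j) :=
      Filter.eventually_of_mem (hU.mem_nhds hx) h2
    refine HasFDerivAt.congr_of_eventuallyEq ?_ he
    refine hasFDerivAt_pi.2 fun j => ?_
    have hop : IsOpen ((fun z : Cn n => z j) '' U) := isOpenMap_eval j _ hU
    have hd : HasDerivAt (φ j) (deriv (φ j) (x j)) (x j) :=
      ((h1 j).differentiableAt (hop.mem_nhds ⟨x, hx, rfl⟩)).hasDerivAt
    have hR := hd.hasFDerivAt.restrictScalars ℝ
    have := hR.comp x ((ContinuousLinearMap.proj j : Cn n →L[ℝ] ℂ).hasFDerivAt (x := x))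
    refine this.congr_fderiv ?_
    ext v
    simp [mul_comm]
  rw [key.fderiv]
  ext j
  simp

/-- The local condition defining rigid changes of coordinates. -/
noncomputable def rigidPregroupoid (n : ℕ) : Pregroupoid (Cn n) where
  property := IsLocallyRigid
  comp := by
    intro f g u v hf hg hu hv _ x hx
    obtain ⟨a, ha, hxa, hfa⟩ := hf x hx.1
    obtain ⟨b, hb, hxb, hgb⟩ := hg (f x) hx.2
    have ho : IsOpen ((u ∩ a) ∩ f ⁻¹' (v ∩ b)) :=
      hfa.continuousOn.isOpen_inter_preimage (hu.inter ha) (hv.inter hb)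
    refine ⟨_, ho, ⟨⟨hx.1, hxa⟩, hx.2, hxb⟩, ?_⟩
    exact hgb.comp (hfa.mono fun z hz => hz.2.1) fun z hz => hz.2.2
  id_mem := fun x _ => ⟨univ, isOpen_univ, mem_univ x, fun _ w => w,
    fun _ => differentiableOn_id, fun _ _ => rfl⟩
  locality := by
    intro f u _ h x hx
    obtain ⟨v, hv, hxv, h'⟩ := h x hx
    obtain ⟨w, hw, hxw, h''⟩ := h' x ⟨hx, hxv⟩
    exact ⟨v ∩ w, hv.inter hw, ⟨hxv, hxw⟩, by rwa [← inter_assoc]⟩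
  congr := by
    intro f g u _ hfg h x hx
    obtain ⟨v, hv, hxv, φ, h1, h2⟩ := h x hx
    exact ⟨v, hv, hxv, φ, h1, fun z hz => (hfg z hz.1).trans (h2 z hz)⟩

/-- The structure groupoid of the homeomorphisms between open subsets of `ℂⁿ` that are locally rigid,
as well as their inverses. A rigidified complex manifold of dimension `n` is a Hausdorff second countable
space `X` with a charted space structure over `ℂⁿ` such that `HasGroupoid X (rigidGroupoid n)`. -/
noncomputable def rigidGroupoid (n : ℕ) : StructureGroupoid (Cn n) := (rigidPregroupoid n).groupoid

theorem IsLocallyRigid.contDiffOn {n : ℕ} {f : Cn n → Cn n} {s : Set (Cn n)} (hs : IsOpen s)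
    (h : IsLocallyRigid f s) : ContDiffOn ℝ ∞ f s := by
  intro x hx
  obtain ⟨u, hu, hxu, h'⟩ := h x hx
  exact ((h'.contDiffOn (hs.inter hu)).contDiffAt
    ((hs.inter hu).mem_nhds ⟨hx, hxu⟩)).contDiffWithinAt

theorem rigidGroupoid_le (n : ℕ) : rigidGroupoid n ≤ contDiffGroupoid ∞ 𝓘(ℝ, Cn n) := by
  intro e he
  refine mem_groupoid_of_pregroupoid.2 ?_
  have he' : IsLocallyRigid e e.source ∧ IsLocallyRigid e.symm e.target := he
  constructor
  · simpa [contDiffPregroupoid] using! he'.1.contDiffOn e.open_source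
  · simpa [contDiffPregroupoid] using! he'.2.contDiffOn e.open_target

theorem isManifold_of_rigid {n : ℕ} {X : Type*} [TopologicalSpace X] [ChartedSpace (Cn n) X]
    [HasGroupoid X (rigidGroupoid n)] : IsManifold 𝓘(ℝ, Cn n) ∞ X := by
  have := hasGroupoid_of_le (M := X) (inferInstance : HasGroupoid X (rigidGroupoid n))
    (rigidGroupoid_le n)
  exact IsManifold.mk' _ _ _

section Alg
open scoped BigOperators

/-- The real basis `∂/∂x_j = e_j` (`inl j`), `∂/∂y_j = i e_j` (`inr j`) of `ℂⁿ`. -/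
noncomputable def stdFrame (n : ℕ) : Fin n ⊕ Fin n → Cn n
  | .inl j => Pi.single j 1
  | .inr j => Pi.single j Complex.I

/-- The complex valued `1`-forms `dz_j` (`inl j`) and `dz̄_j` (`inr j`) on `ℂⁿ`. -/
noncomputable def dzeta (n : ℕ) : Fin n ⊕ Fin n → (Cn n →L[ℝ] ℂ)
  | .inl j => ContinuousLinearMap.proj j
  | .inr j => (Complex.conjCLE : ℂ →L[ℝ] ℂ).comp (ContinuousLinearMap.proj j)

/-- The wedge product `θ₁ ∧ ⋯ ∧ θ_k` of `1`-forms: `(v₁, …, v_k) ↦ det (θ_a (v_b))`. -/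
noncomputable def wedgeOne {n k : ℕ} (θ : Fin k → (Cn n →L[ℝ] ℂ)) : Cn n [⋀^Fin k]→L[ℝ] ℂ :=
  { ((Matrix.detRowAlternating (n := Fin k) (R := ℂ)).toMultilinearMap.restrictScalars
      ℝ).compLinearMap fun _ => LinearMap.pi fun a => (θ a : Cn n →ₗ[ℝ] ℂ) with
    map_eq_zero_of_eq' := fun v i j h hij =>
      Matrix.det_zero_of_row_eq hij (funext fun a => by simp [h])
    cont := by
      refine Continuous.matrix_det (A := fun v : Fin k → Cn n => Matrix.of fun b a => θ a (v b)) ?_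
      exact continuous_matrix fun a b => (θ b).continuous.comp (continuous_apply a) }

theorem wedgeOne_apply {n k : ℕ} (θ : Fin k → (Cn n →L[ℝ] ℂ)) (v : Fin k → Cn n) :
    wedgeOne θ v = Matrix.det (Matrix.of fun a b => θ a (v b)) := by
  rw [← Matrix.det_transpose]
  rfl

/-- The product `dζ_{I 1} ∧ ⋯ ∧ dζ_{I k}` has refined type `(α, β)`: each `dz_j` occurs `α_j` times and
each `dz̄_j` occurs `β_j` times among its factors. In particular `k = |α| + |β|`. -/
def hasType {n k : ℕ} (α β : Fin n → Fin 2) (I : Fin k → Fin n ⊕ Fin n) : Prop :=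
  ∀ j, Fintype.card {l // I l = .inl j} = (α j : ℕ) ∧ Fintype.card {l // I l = .inr j} = (β j : ℕ)

instance {n k : ℕ} (α β : Fin n → Fin 2) (I : Fin k → Fin n ⊕ Fin n) :
    Decidable (hasType α β I) := by unfold hasType; infer_instance

/-- The coefficients of `∂/∂z_j = ½ ∂/∂x_j - (i/2) ∂/∂y_j` (`inl j`) and of
`∂/∂z̄_j = ½ ∂/∂x_j + (i/2) ∂/∂y_j` (`inr j`). -/
noncomputable def wirtCoeff {n : ℕ} : Fin n ⊕ Fin n → Fin 2 → ℂ
  | .inl _ => ![1 / 2, -Complex.I / 2]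
  | .inr _ => ![1 / 2, Complex.I / 2]

/-- The indices of the two real vectors `∂/∂x_j`, `∂/∂y_j` entering `∂/∂z_j` and `∂/∂z̄_j`. -/
def realIndex {n : ℕ} : Fin n ⊕ Fin n → Fin 2 → Fin n ⊕ Fin n
  | .inl j => ![.inl j, .inr j]
  | .inr j => ![.inl j, .inr j]

/-- The value `ψ(∂_{I 1}, …, ∂_{I k})` of (the complex multilinear extension of) `ψ`, where
`∂_{inl j} = ∂/∂z_j` and `∂_{inr j} = ∂/∂z̄_j`. -/
noncomputable def formCoeff {n k : ℕ} (ψ : Cn n [⋀^Fin k]→L[ℝ] ℂ) (I : Fin k → Fin n ⊕ Fin n) : ℂ :=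
  ∑ s : Fin k → Fin 2, (∏ l, wirtCoeff (I l) (s l)) * ψ fun l => stdFrame n (realIndex (I l) (s l))

/-- The component of refined type `(α, β)` of an alternating form on `ℂⁿ`: the sum of the terms of type
`(α, β)` in the expansion `ψ = (1/k!) ∑_I ψ(∂_I) dζ_{I 1} ∧ ⋯ ∧ dζ_{I k}`. -/
noncomputable def typePart {n k : ℕ} (α β : Fin n → Fin 2) (ψ : Cn n [⋀^Fin k]→L[ℝ] ℂ) :
    Cn n [⋀^Fin k]→L[ℝ] ℂ :=
  ((k.factorial : ℂ)⁻¹) • ∑ I : Fin k → Fin n ⊕ Fin n with hasType α β I,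
    formCoeff ψ I • wedgeOne fun l => dzeta n (I l)

/-- The alternating `k`-forms on `ℂⁿ` of refined type `(α, β)`: the complex line spanned by
`dz_α ∧ dz̄_β` if `k = |α| + |β|`, and `0` otherwise. -/
noncomputable def typeSpace {n : ℕ} (k : ℕ) (α β : Fin n → Fin 2) : Submodule ℂ (Cn n [⋀^Fin k]→L[ℝ] ℂ) :=
  Submodule.span ℂ {w | ∃ I : Fin k → Fin n ⊕ Fin n, hasType α β I ∧
    w = wedgeOne fun l => dzeta n (I l)}

/-- The factor by which a diagonal map `diag(c)` multiplies `dz_j` and `dz̄_j`. -/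
noncomputable def diagFactor {n : ℕ} (c : Fin n → ℂ) : Fin n ⊕ Fin n → ℂ
  | .inl j => c j
  | .inr j => star (c j)

theorem formCoeff_comp {n k : ℕ} (L : Cn n →L[ℝ] Cn n) (c : Fin n → ℂ)
    (hL : ∀ v, L v = fun j => c j * v j) (ψ : Cn n [⋀^Fin k]→L[ℝ] ℂ) (I : Fin k → Fin n ⊕ Fin n) :
    formCoeff (ψ.compContinuousLinearMap L) I = (∏ l, diagFactor c (I l)) * formCoeff ψ I := by
  have key : ∀ m : Fin n ⊕ Fin n, ∃ M : Fin 2 → Fin 2 → ℝ,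
      (∀ s, L (stdFrame n (realIndex m s)) = ∑ t, M s t • stdFrame n (realIndex m t)) ∧
      ∀ t, ∑ s, wirtCoeff m s * (M s t : ℂ) = diagFactor c m * wirtCoeff m t := by
    intro m
    rcases m with j | j
    all_goals
      refine ⟨![![(c j).re, (c j).im], ![-(c j).im, (c j).re]], ?_, ?_⟩
      · intro s
        fin_cases s
        all_goals
          rw [hL]
          ext i
          by_cases h : i = j
          · subst h
            simp [realIndex, stdFrame, Complex.ext_iff]
          · simp [realIndex, stdFrame, h]
      · intro t
        fin_cases t <;> simp [wirtCoeff, diagFactor, Complex.ext_iff] <;> constructor <;> ring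
  choose M h1 h2 using key
  unfold formCoeff
  have e1 : ∀ s : Fin k → Fin 2,
      (ψ.compContinuousLinearMap L) (fun l => stdFrame n (realIndex (I l) (s l))) =
      ∑ t : Fin k → Fin 2, (∏ l, (M (I l) (s l) (t l) : ℂ)) *
        ψ fun l => stdFrame n (realIndex (I l) (t l)) := by
    intro s
    have : (ψ.compContinuousLinearMap L) (fun l => stdFrame n (realIndex (I l) (s l))) =
      ψ.toMultilinearMap (fun l => ∑ t, M (I l) (s l) t • stdFrame n (realIndex (I l) t)) := by
      simp only [← h1]; rfl
    rw [this, MultilinearMap.map_sum]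
    refine Finset.sum_congr rfl fun t _ => ?_
    rw [MultilinearMap.map_smul_univ, Complex.real_smul]
    push_cast
    rfl
  simp_rw [e1, Finset.mul_sum]
  rw [Finset.sum_comm]
  refine Finset.sum_congr rfl fun t _ => ?_
  simp_rw [← mul_assoc, ← Finset.prod_mul_distrib]
  rw [← Finset.sum_mul]
  congr 1
  simp_rw [← h2]
  rw [Finset.prod_univ_sum]
  simp

theorem wedgeOne_comp {n k : ℕ} (L : Cn n →L[ℝ] Cn n) (c : Fin n → ℂ)
    (hL : ∀ v, L v = fun j => c j * v j) (I : Fin k → Fin n ⊕ Fin n) :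
    (wedgeOne fun l => dzeta n (I l)).compContinuousLinearMap L =
      (∏ l, diagFactor c (I l)) • wedgeOne fun l => dzeta n (I l) := by
  ext v
  have h : ∀ m (v : Cn n), dzeta n m (L v) = diagFactor c m * dzeta n m v := by
    intro m v
    rcases m with j | j <;> simp [dzeta, diagFactor, hL]
  rw [ContinuousAlternatingMap.compContinuousLinearMap_apply, ContinuousAlternatingMap.smul_apply,
    wedgeOne_apply, wedgeOne_apply, smul_eq_mul]
  simp only [Function.comp_apply]
  simp_rw [h]
  exact Matrix.det_mul_column _ _

theorem typePart_comp {n k : ℕ} (L : Cn n →L[ℝ] Cn n) (c : Fin n → ℂ)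
    (hL : ∀ v, L v = fun j => c j * v j) (α β : Fin n → Fin 2) (ψ : Cn n [⋀^Fin k]→L[ℝ] ℂ) :
    typePart α β (ψ.compContinuousLinearMap L) = (typePart α β ψ).compContinuousLinearMap L := by
  have : (typePart α β ψ).compContinuousLinearMap L = ((k.factorial : ℂ)⁻¹) •
      ∑ I : Fin k → Fin n ⊕ Fin n with hasType α β I,
      formCoeff ψ I • (wedgeOne fun l => dzeta n (I l)).compContinuousLinearMap L := by
    ext v
    simp [typePart, ContinuousAlternatingMap.sum_apply]
  rw [this, typePart]
  congr 1
  refine Finset.sum_congr rfl fun I _ => ?_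
  rw [formCoeff_comp L c hL, wedgeOne_comp L c hL, smul_smul, mul_comm]

theorem contDiffOn_typePart {n k : ℕ} (α β : Fin n → Fin 2) {s : Set (Cn n)}
    {ψ : Cn n → Cn n [⋀^Fin k]→L[ℝ] ℂ} (h : ContDiffOn ℝ ∞ ψ s) :
    ContDiffOn ℝ ∞ (fun y => typePart α β (ψ y)) s := by
  unfold typePart formCoeff
  refine (contDiffOn_const (c := ((k.factorial : ℂ)⁻¹))).smul ?_
  refine ContDiffOn.sum fun I _ => ?_
  refine ContDiffOn.smul (𝕜' := ℂ) ?_ contDiffOn_const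
  refine ContDiffOn.sum fun t _ => ?_
  refine contDiffOn_const.mul ?_
  have h1 : ContDiff ℝ ∞ (ContinuousAlternatingMap.apply ℝ (Cn n) ℂ
    fun l => stdFrame n (realIndex (I l) (t l))) := ContinuousLinearMap.contDiff _
  exact h1.comp_contDiffOn h

end Alg

section Forms
variable (n : ℕ) (X : Type*) [TopologicalSpace X] [ChartedSpace (Cn n) X]

/-- The complex structure of the tangent spaces of `X`. `TangentSpace 𝓘(ℝ, Cn n) x` is the model space
`Cn n`, identified with `T_x X` by the preferred chart at `x`. When the changes of charts are holomorphic,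
every chart induces the same multiplication by `i`. -/
noncomputable instance tangentComplexModule (x : X) : Module ℂ (TangentSpace 𝓘(ℝ, Cn n) x) :=
  inferInstanceAs (Module ℂ (Cn n))

/-- Complex valued differential `k`-forms on `X`, without regularity. -/
abbrev RawForm (k : ℕ) : Type _ := ∀ x : X, TangentSpace 𝓘(ℝ, Cn n) x [⋀^Fin k]→L[ℝ] ℂ

variable {n X}

/-- The expression `(e⁻¹)^* ψ` of a form in a chart `e`; it is meaningful on `e.target`. -/
noncomputable def chartExpr {k : ℕ} (e : OpenPartialHomeomorph X (Cn n)) (ψ : RawForm n X k)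
    (y : Cn n) : Cn n [⋀^Fin k]→L[ℝ] ℂ :=
  (ψ (e.symm y)).compContinuousLinearMap (mfderiv 𝓘(ℝ, Cn n) 𝓘(ℝ, Cn n) e.symm y)

/-- The form on `X` whose value at `x` is the pullback by the preferred chart `c` at `x` of the value
at `c x` of the form `η x` on `ℂⁿ`. -/
noncomputable def ofLocal {k : ℕ} (η : X → Cn n → Cn n [⋀^Fin k]→L[ℝ] ℂ) : RawForm n X k :=
  fun x => ContinuousAlternatingMap.compContinuousLinearMap
    (η x (chartAt (Cn n) x x) : TangentSpace 𝓘(ℝ, Cn n) (chartAt (Cn n) x x) [⋀^Fin k]→L[ℝ] ℂ)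
    (mfderiv 𝓘(ℝ, Cn n) 𝓘(ℝ, Cn n) (chartAt (Cn n) x) x)

theorem chartExpr_eq {k : ℕ} [IsManifold 𝓘(ℝ, Cn n) ∞ X] {e e' : OpenPartialHomeomorph X (Cn n)}
    (he : e ∈ atlas (Cn n) X) (he' : e' ∈ atlas (Cn n) X) (ψ : RawForm n X k) {y : Cn n}
    (hy : y ∈ (e.symm ≫ₕ e').source) :
    chartExpr e ψ y = (chartExpr e' ψ ((e.symm ≫ₕ e') y)).compContinuousLinearMap
      (fderiv ℝ (e.symm ≫ₕ e') y) := by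
  have : IsManifold 𝓘(ℝ, Cn n) 1 X := IsManifold.of_le (n := ∞) (by simp)
  have D := (mdifferentiable_of_mem_atlas (I := 𝓘(ℝ, Cn n)) he)
  have D' := (mdifferentiable_of_mem_atlas (I := 𝓘(ℝ, Cn n)) he')
  have hy' : y ∈ e.target ∧ e.symm y ∈ e'.source := by simpa using hy
  have hτ : MDifferentiableAt 𝓘(ℝ, Cn n) 𝓘(ℝ, Cn n) (e.symm ≫ₕ e') y :=
    (D.symm.trans D').mdifferentiableAt hy
  have hev : (e.symm : Cn n → X) =ᶠ[𝓝 y] e'.symm ∘ (e.symm ≫ₕ e') := by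
    filter_upwards [(e.symm ≫ₕ e').open_source.mem_nhds hy] with z hz
    have : e.symm z ∈ e'.source := by
      have : z ∈ e.target ∧ e.symm z ∈ e'.source := by simpa using hz
      exact this.2
    simp [e'.left_inv this]
  have hd : ∀ v : Cn n, (mfderiv 𝓘(ℝ, Cn n) 𝓘(ℝ, Cn n) e.symm y v : Cn n) =
      (mfderiv 𝓘(ℝ, Cn n) 𝓘(ℝ, Cn n) e'.symm ((e.symm ≫ₕ e') y)
        (fderiv ℝ (e.symm ≫ₕ e') y v) : Cn n) := by
    intro v
    rw [hev.mfderiv_eq, mfderiv_comp y (D'.mdifferentiableAt_symm ?_) hτ, mfderiv_eq_fderiv]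
    · rfl
    · exact (e.symm ≫ₕ e').map_source hy |>.1 
  have hp : e.symm y = e'.symm ((e.symm ≫ₕ e') y) := hev.self_of_nhds
  let ψ' : X → Cn n [⋀^Fin k]→L[ℝ] ℂ := ψ
  ext v
  change ψ' (e.symm y) (fun i => (mfderiv 𝓘(ℝ, Cn n) 𝓘(ℝ, Cn n) e.symm y (v i) : Cn n)) =
    ψ' (e'.symm ((e.symm ≫ₕ e') y)) (fun i => (mfderiv 𝓘(ℝ, Cn n) 𝓘(ℝ, Cn n) e'.symm
      ((e.symm ≫ₕ e') y) (fderiv ℝ (e.symm ≫ₕ e') y (v i)) : Cn n))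
  rw [← hp]
  congr 1
  ext1 i
  exact hd (v i)


/-- Smoothness of a form: its expression in every chart is smooth. -/
def IsSmoothForm {k : ℕ} (ψ : RawForm n X k) : Prop :=
  ∀ e ∈ atlas (Cn n) X, ContDiffOn ℝ ∞ (chartExpr e ψ) e.target

theorem chartExpr_ofLocal {k l : ℕ} [HasGroupoid X (rigidGroupoid n)]
    (T : (Cn n → Cn n [⋀^Fin k]→L[ℝ] ℂ) → Cn n → Cn n [⋀^Fin l]→L[ℝ] ℂ)
    (hloc : ∀ η₁ η₂ y, η₁ =ᶠ[𝓝 y] η₂ → T η₁ y = T η₂ y)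
    (hnat : ∀ (τ : Cn n → Cn n) (y : Cn n) (η : Cn n → Cn n [⋀^Fin k]→L[ℝ] ℂ),
      ContDiffAt ℝ ∞ τ y → (∃ c : Fin n → ℂ, ∀ v, fderiv ℝ τ y v = fun j => c j * v j) →
      ContDiffAt ℝ ∞ η (τ y) →
      T (fun z => (η (τ z)).compContinuousLinearMap (fderiv ℝ τ z)) y =
        (T η (τ y)).compContinuousLinearMap (fderiv ℝ τ y))
    {ψ : RawForm n X k} (hψ : IsSmoothForm ψ) {e : OpenPartialHomeomorph X (Cn n)}
    (he : e ∈ atlas (Cn n) X) {y : Cn n} (hy : y ∈ e.target) :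
    chartExpr e (ofLocal fun x => T (chartExpr (chartAt (Cn n) x) ψ)) y = T (chartExpr e ψ) y := by
  have : IsManifold 𝓘(ℝ, Cn n) ∞ X := isManifold_of_rigid
  have : IsManifold 𝓘(ℝ, Cn n) 1 X := IsManifold.of_le (n := ∞) (by simp)
  have D := (mdifferentiable_of_mem_atlas (I := 𝓘(ℝ, Cn n)) he)
  set x := e.symm y with hx
  set c := chartAt (Cn n) x with hc
  have hca : c ∈ atlas (Cn n) X := chart_mem_atlas _ _
  have D' := (mdifferentiable_of_mem_atlas (I := 𝓘(ℝ, Cn n)) hca)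
  have hys : y ∈ (e.symm ≫ₕ c).source := by
    simp only [OpenPartialHomeomorph.trans_source, OpenPartialHomeomorph.symm_source, mem_inter_iff,
      mem_preimage]
    exact ⟨hy, mem_chart_source _ _⟩
  have hrig : IsLocallyRigid (e.symm ≫ₕ c) (e.symm ≫ₕ c).source :=
    (HasGroupoid.compatible (G := rigidGroupoid n) he hca).1
  obtain ⟨u, hu, hyu, hr⟩ := hrig y hys
  have hdiag := hr.fderiv_eq ((e.symm ≫ₕ c).open_source.inter hu) ⟨hys, hyu⟩
  have hsm : ContDiffAt ℝ ∞ (e.symm ≫ₕ c) y :=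
    (hrig.contDiffOn (e.symm ≫ₕ c).open_source).contDiffAt
      ((e.symm ≫ₕ c).open_source.mem_nhds hys)
  have hcy : (e.symm ≫ₕ c) y ∈ c.target := ((e.symm ≫ₕ c).map_source hys).1
  have hη : ContDiffAt ℝ ∞ (chartExpr c ψ) ((e.symm ≫ₕ c) y) :=
    (hψ c hca).contDiffAt (c.open_target.mem_nhds hcy)
  have hev : chartExpr e ψ =ᶠ[𝓝 y] fun z =>
      (chartExpr c ψ ((e.symm ≫ₕ c) z)).compContinuousLinearMap (fderiv ℝ (e.symm ≫ₕ c) z) := by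
    filter_upwards [(e.symm ≫ₕ c).open_source.mem_nhds hys] with z hz
    exact chartExpr_eq he hca ψ hz
  rw [hloc _ _ _ hev, hnat _ _ _ hsm hdiag hη]
  have hd : ∀ v : Cn n, (fderiv ℝ (e.symm ≫ₕ c) y v : Cn n) =
      (mfderiv 𝓘(ℝ, Cn n) 𝓘(ℝ, Cn n) c x (mfderiv 𝓘(ℝ, Cn n) 𝓘(ℝ, Cn n) e.symm y v) : Cn n) := by
    intro v
    rw [← mfderiv_eq_fderiv]
    have := mfderiv_comp (I := 𝓘(ℝ, Cn n)) (I' := 𝓘(ℝ, Cn n)) (I'' := 𝓘(ℝ, Cn n)) y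
      (g := c) (f := e.symm) (D'.mdifferentiableAt (mem_chart_source _ _))
      (D.mdifferentiableAt_symm hy)
    exact congrArg (fun L => L v) this
  ext v
  change T (chartExpr c ψ) (c x) _ = T (chartExpr c ψ) (c x) _
  congr 1
  ext1 i
  exact (hd (v i)).symm

theorem IsSmoothForm.ofLocal {k l : ℕ} [HasGroupoid X (rigidGroupoid n)]
    (T : (Cn n → Cn n [⋀^Fin k]→L[ℝ] ℂ) → Cn n → Cn n [⋀^Fin l]→L[ℝ] ℂ)
    (hloc : ∀ η₁ η₂ y, η₁ =ᶠ[𝓝 y] η₂ → T η₁ y = T η₂ y)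
    (hnat : ∀ (τ : Cn n → Cn n) (y : Cn n) (η : Cn n → Cn n [⋀^Fin k]→L[ℝ] ℂ),
      ContDiffAt ℝ ∞ τ y → (∃ c : Fin n → ℂ, ∀ v, fderiv ℝ τ y v = fun j => c j * v j) →
      ContDiffAt ℝ ∞ η (τ y) →
      T (fun z => (η (τ z)).compContinuousLinearMap (fderiv ℝ τ z)) y =
        (T η (τ y)).compContinuousLinearMap (fderiv ℝ τ y))
    (hsmooth : ∀ η s, IsOpen s → ContDiffOn ℝ ∞ η s → ContDiffOn ℝ ∞ (T η) s)
    {ψ : RawForm n X k} (hψ : IsSmoothForm ψ) :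
    IsSmoothForm (ofLocal fun x => T (chartExpr (chartAt (Cn n) x) ψ)) := by
  intro e he
  exact (hsmooth _ _ e.open_target (hψ e he)).congr fun y hy =>
    chartExpr_ofLocal T hloc hnat hψ he hy

theorem contDiffOn_extDeriv {k : ℕ} {s : Set (Cn n)} (hs : IsOpen s)
    {η : Cn n → Cn n [⋀^Fin k]→L[ℝ] ℂ} (h : ContDiffOn ℝ ∞ η s) :
    ContDiffOn ℝ ∞ (extDeriv η) s := by
  have h1 : ContDiffOn ℝ ∞ (fderiv ℝ η) s := h.fderiv_of_isOpen hs (by simp)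
  have h2 : ContDiff ℝ ∞ (ContinuousAlternatingMap.alternatizeUncurryFinCLM ℝ (Cn n) ℂ (n := k)) :=
    ContinuousLinearMap.contDiff _
  exact h2.comp_contDiffOn h1

/-- The complex vector space `A^k(X)` of smooth complex valued `k`-forms. -/
noncomputable def smoothForms (n : ℕ) (X : Type*) [TopologicalSpace X] [ChartedSpace (Cn n) X] (k : ℕ) :
    Submodule ℂ (RawForm n X k) where
  carrier := {ψ | IsSmoothForm ψ}
  zero_mem' := fun e _ => by
    have : chartExpr e (0 : RawForm n X k) = fun _ => 0 := by ext y v; rfl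
    rw [this]; exact contDiffOn_const
  add_mem' := fun {a b} ha hb e he => by
    have : chartExpr e (a + b) = fun y => chartExpr e a y + chartExpr e b y := by ext y v; rfl
    rw [this]; exact (ha e he).add (hb e he)
  smul_mem' := fun c a ha e he => by
    have : chartExpr e (c • a) = fun y => c • chartExpr e a y := by ext y v; rfl
    rw [this]; exact (contDiffOn_const (c := c)).smul (ha e he)

variable [HasGroupoid X (rigidGroupoid n)]

/-- The exterior derivative `d : A^k(X) → A^{k+1}(X)`, computed in charts. -/
noncomputable def extD (k : ℕ) (ψ : smoothForms n X k) : smoothForms n X (k + 1) :=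
  ⟨ofLocal fun x => extDeriv (chartExpr (chartAt (Cn n) x) ψ.1),
    IsSmoothForm.ofLocal extDeriv (fun _ _ _ h => h.extDeriv_eq)
      (fun _ _ _ hτ _ hη => extDeriv_pullback (hη.differentiableAt (by simp))
        (hτ.of_le (m := 2) (WithTop.coe_le_coe.2 (le_top : (2 : ℕ∞) ≤ ⊤))) (by simp))
      (fun _ _ hs h => contDiffOn_extDeriv hs h) ψ.2⟩

/-- The projection of `A^k(X)` onto the forms of refined type `(α, β)`. -/
noncomputable def typeProj {k : ℕ} (α β : Fin n → Fin 2) (ψ : smoothForms n X k) :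
    smoothForms n X k :=
  ⟨ofLocal fun x y => typePart α β (chartExpr (chartAt (Cn n) x) ψ.1 y),
    IsSmoothForm.ofLocal (fun η y => typePart α β (η y))
      (fun _ _ _ h => by simp only [h.self_of_nhds])
      (fun _ _ _ _ ⟨c, hc⟩ _ => typePart_comp _ c hc α β _)
      (fun _ _ _ h => contDiffOn_typePart α β h) ψ.2⟩

/-- The operator `ξ_j`: on forms of refined type `(α, β)` it is `0` if `α_j = 1`, and if `α_j = 0` it is
`d` followed by the projection to the forms of type `(α + 1_j, β)`; it is extended additively to all
forms, which are the sums of their components of the various types. -/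
noncomputable def xi (j : Fin n) (k : ℕ) (ψ : smoothForms n X k) : smoothForms n X (k + 1) :=
  ∑ α : Fin n → Fin 2 with α j = 0, ∑ β : Fin n → Fin 2,
    typeProj (Function.update α j 1) β (extD k (typeProj α β ψ))

end Forms

section Metric
open MeasureTheory
variable (n : ℕ) (X : Type*) [TopologicalSpace X] [ChartedSpace (Cn n) X]

/-- A smooth hermitian metric `ds²` on the tangent bundle: positive definite hermitian forms on the complex
vector spaces `T_x X`, linear in the first and conjugate linear in the second variable, with smooth
coefficients in the charts. -/
structure HermitianMetric where
  toFun (x : X) : TangentSpace 𝓘(ℝ, Cn n) x →ₗ[ℂ] TangentSpace 𝓘(ℝ, Cn n) x →ₗ⋆[ℂ] ℂ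
  conj_symm (x : X) (u v : TangentSpace 𝓘(ℝ, Cn n) x) : star (toFun x u v) = toFun x v u
  pos (x : X) (v : TangentSpace 𝓘(ℝ, Cn n) x) : v ≠ 0 → 0 < (toFun x v v).re
  smooth (e : OpenPartialHomeomorph X (Cn n)) (he : e ∈ atlas (Cn n) X) (u v : Cn n) :
    ContDiffOn ℝ ∞ (fun y => toFun (e.symm y) (mfderiv 𝓘(ℝ, Cn n) 𝓘(ℝ, Cn n) e.symm y u)
      (mfderiv 𝓘(ℝ, Cn n) 𝓘(ℝ, Cn n) e.symm y v)) e.target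

variable {n X}

/-- The metric in a chart `e` at the point `y` of `e.target`, as a form on `ℂⁿ`. -/
noncomputable def HermitianMetric.inChart (h : HermitianMetric n X)
    (e : OpenPartialHomeomorph X (Cn n)) (y : Cn n) (u v : Cn n) : ℂ :=
  h.toFun (e.symm y) (mfderiv 𝓘(ℝ, Cn n) 𝓘(ℝ, Cn n) e.symm y u)
      (mfderiv 𝓘(ℝ, Cn n) 𝓘(ℝ, Cn n) e.symm y v)

/-- Distinctive Kähler metrics: near every point `x` there are a chart of the rigidified structure, with
coordinates `z_1, …, z_n`, and smooth functions `f_j` of the single variable `z_j` such that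
`φ_j = f_j(z_j) dz_j` is a unitary coframe, that is `ds² = ∑ φ_j ⊗ φ̄_j`, and `∂f_j/∂z̄_j` vanishes
at `x`. -/
def HermitianMetric.IsDistinctiveKahler (h : HermitianMetric n X) : Prop :=
  ∀ x : X, ∃ e ∈ (rigidGroupoid n).maximalAtlas X, x ∈ e.source ∧ ∃ f : Fin n → ℂ → ℂ,
    (∀ j, ContDiffOn ℝ ∞ (f j) ((fun z : Cn n => z j) '' e.target)) ∧
    (∀ y ∈ e.target, ∀ u v : Cn n,
      h.inChart e y u v = ∑ j, (f j (y j) * u j) * star (f j (y j) * v j)) ∧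
    ∀ j, (1 / 2 : ℂ) *
      (fderiv ℝ (f j) (e x j) 1 + Complex.I * fderiv ℝ (f j) (e x j) Complex.I) = 0

/-- The volume measure `ωⁿ/n!`, where `ω = (i/2) ∑ φ_j ∧ φ̄_j` for a unitary coframe `φ`. In a chart it is
`det (h(∂/∂z_j, ∂/∂z_k))` times Lebesgue measure. These measures on the domains of the charts agree on
overlaps; their supremum is the measure on `X` which restricts to each of them. -/
noncomputable def HermitianMetric.volume [MeasurableSpace X] (h : HermitianMetric n X) : Measure X :=
  ⨆ e ∈ atlas (Cn n) X,
    (((MeasureTheory.volume : Measure (Cn n)).restrict e.target).withDensity fun y =>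
      ENNReal.ofReal (Matrix.det (Matrix.of fun j k : Fin n =>
        h.inChart e y (Pi.single j 1) (Pi.single k 1))).re).map e.symm

/-- The Gram matrix, in a chart, of the Riemannian metric `Re ds²` in the real frame
`∂/∂x_j, ∂/∂y_j`. -/
noncomputable def HermitianMetric.gram (h : HermitianMetric n X)
    (e : OpenPartialHomeomorph X (Cn n)) (y : Cn n) : Matrix (Fin n ⊕ Fin n) (Fin n ⊕ Fin n) ℝ :=
  Matrix.of fun a b => (h.inChart e y (stdFrame n a) (stdFrame n b)).re

/-- The pointwise hermitian product `(ψ(x), η(x))` of `k`-forms induced by the metric: with `G` the Gram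
matrix of a real basis `b` of the tangent space, `(1/k!) ∑_{I, J} ∏_l (G⁻¹)_{I l, J l} ψ(b_I) conj(η(b_J))`.
It is independent of the basis; for a unitary coframe `φ` the forms `φ_A ∧ φ̄_B` are orthogonal, with square
length `2^k`. -/
noncomputable def HermitianMetric.formInner {k : ℕ} (h : HermitianMetric n X)
    (ψ η : RawForm n X k) (x : X) : ℂ :=
  let e := chartAt (Cn n) x
  ((k.factorial : ℂ)⁻¹) * ∑ I : Fin k → Fin n ⊕ Fin n, ∑ J : Fin k → Fin n ⊕ Fin n,
    ((∏ l, (h.gram e (e x))⁻¹ (I l) (J l) : ℝ) : ℂ) *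
      chartExpr e ψ (e x) (fun l => stdFrame n (I l)) *
      star (chartExpr e η (e x) fun l => stdFrame n (J l))

/-- The product `⟨ψ, η⟩ = ∫_X (ψ(x), η(x)) ωⁿ/n!`. -/
noncomputable def HermitianMetric.l2Inner [MeasurableSpace X] {k : ℕ} (h : HermitianMetric n X)
    (ψ η : smoothForms n X k) : ℂ :=
  ∫ x, h.formInner ψ.1 η.1 x ∂h.volume

/-- The form vanishes outside a compact set (no condition if `X` is compact). -/
def HasCompactSupportForm {k : ℕ} (ψ : smoothForms n X k) : Prop :=
  ∃ K : Set X, IsCompact K ∧ ∀ x ∉ K, ψ.1 x = 0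

/-- `Q` is the adjoint of `P`: `⟨Q ψ, η⟩ = ⟨ψ, P η⟩` for all smooth `ψ` and all smooth `η` with compact
support. -/
def IsFormalAdjoint [MeasurableSpace X] (h : HermitianMetric n X)
    (P : ∀ k, smoothForms n X k → smoothForms n X (k + 1))
    (Q : ∀ k, smoothForms n X (k + 1) → smoothForms n X k) : Prop :=
  ∀ k (ψ : smoothForms n X (k + 1)) (η : smoothForms n X k), HasCompactSupportForm η →
    h.l2Inner (Q k ψ) η = h.l2Inner ψ (P k η)

/-- The adjoint `P^*` (an arbitrary operator if there is no adjoint); on `A^0(X)` it is zero. -/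
noncomputable def formalAdjoint [MeasurableSpace X] (h : HermitianMetric n X)
    (P : ∀ k, smoothForms n X k → smoothForms n X (k + 1)) :
    ∀ k, smoothForms n X (k + 1) → smoothForms n X k :=
  Classical.epsilon (IsFormalAdjoint h P)

/-- The Laplacian `Δ_P = P P^* + P^* P` on `A^k(X)`; in degree `0` the first term is zero. -/
noncomputable def laplacian [MeasurableSpace X] (h : HermitianMetric n X)
    (P : ∀ k, smoothForms n X k → smoothForms n X (k + 1)) :
    ∀ k, smoothForms n X k → smoothForms n X k
  | 0, ψ => formalAdjoint h P 0 (P 0 ψ)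
  | k + 1, ψ => P k (formalAdjoint h P k ψ) + formalAdjoint h P (k + 1) (P (k + 1) ψ)

/-- The form `ψ` is of refined type `(α, β)`. -/
def IsOfType {k : ℕ} (α β : Fin n → Fin 2) (ψ : smoothForms n X k) : Prop :=
  ∀ e ∈ atlas (Cn n) X, ∀ y ∈ e.target, chartExpr e ψ.1 y ∈ typeSpace k α β

end Metric

/-! In every chart of the rigidified structure a distinctive metric has the form `ds² = ∑ H_j
|dz_j|²` with `H_j` locally a function of `z_j` alone
(`HermitianMetric.IsDistinctiveKahler.isSplit`). Locally it is a product of metrics on curves, and a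
metric on a curve is always Kähler. So the Kähler identities hold in each variable separately, and
this makes the Laplacian split.

Let `a` run over the `2n` directions `z_j`, `z̄_j`, and let `ā` be the conjugate direction
(`a.swap`). Then `d = ∑_a D_a`, where `D_a` collects the terms `dζ_a ∧ ∂_a`; in particular `D_{z_j}
= ξ_j`. Equality of mixed second derivatives gives `D_a D_b + D_b D_a = 0` (`extD_eq_sum`,
`partialDL_anticomm`). Let `Λ_j` be the contraction with `∂/∂x_j`, `∂/∂y_j` divided by `H_j`. Since
`H_j` depends on `z_j` only, `Λ_j` commutes with `D_a` for every `a` other than `z_j`, `z̄_j`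
(`lefschetz_partialDL_comm`). The Kähler identities are `D_{z_j}^* = i [Λ_j, D_{z̄_j}]` and
`D_{z̄_j}^* = -i [Λ_j, D_{z_j}]`.

Given these, the theorem is graded algebra. The anticommutator `{D_a, D_b^*}` vanishes for `a ≠ b`
(`kaehlerAnticomm_eq_zero`), and `{D_ā, D_ā^*} = {D_a, D_a^*}` (`kaehlerAnticomm_swap`). Hence `Δ_d
= ∑_{a,b} {D_a, D_b^*} = ∑_a {D_a, D_a^*} = 2 ∑_j Δ_{ξ_j}`. Types are preserved because `D_a` raises
the multidegree by `1_a` and `D_a^*` lowers it by `1_a`.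

The analysis consists in showing that the commutators are the adjoints. In coordinates the
commutator is computed in `coef_partialAdj`; it equals minus a `∂_ā`-derivative of the coefficients
weighted with the volume density and the pointwise metric
(`HermitianMetric.IsSplit.density_mul_partialAdj`). Integration by parts then gives the adjunction
for test forms supported in one chart, and a partition of unity gives it for all compactly supported
ones (`HermitianMetric.IsSplit.l2Inner_partialAdj`). Uniqueness is nondegeneracy of the product
(`HermitianMetric.IsSplit.eq_of_l2Inner_eq`). -/

/-! ### Coefficients of alternating forms in the frame `∂/∂z_j`, `∂/∂z̄_j` -/

section Coefficients
open scoped BigOperators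

/-- The coefficient of the real frame vector with index `r` in `∂_a`. -/
noncomputable def frameCoeff {n : ℕ} (a r : Fin n ⊕ Fin n) : ℂ :=
  ∑ s, if realIndex a s = r then wirtCoeff a s else 0

/-- The real coordinates on `ℂⁿ` dual to `stdFrame`. -/
noncomputable def realCoord {n : ℕ} : Fin n ⊕ Fin n → Cn n → ℝ
  | .inl j, v => (v j).re
  | .inr j, v => (v j).im

theorem sum_realCoord_smul_stdFrame {n : ℕ} (v : Cn n) :
    ∑ r, realCoord r v • stdFrame n r = v := by
  ext i
  simp only [Fintype.sum_sum_type, realCoord, stdFrame, Finset.sum_apply,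
    Pi.smul_apply, Pi.single_apply, smul_ite, smul_zero, Finset.sum_ite_eq, Finset.mem_univ, if_true]
  apply Complex.ext <;> simp

/-- Summing over all real multi-indices, instead of two choices per slot, presents the change of
frame as a product of matrix entries. It can then be inverted, or composed with the Gram matrix,
slot by slot. -/
theorem formCoeff_eq_sum {n k : ℕ} (ψ : Cn n [⋀^Fin k]→L[ℝ] ℂ) (I : Fin k → Fin n ⊕ Fin n) :
    formCoeff ψ I = ∑ K : Fin k → Fin n ⊕ Fin n,
      (∏ l, frameCoeff (I l) (K l)) * ψ fun l => stdFrame n (K l) := by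
  classical
  unfold frameCoeff formCoeff
  simp_rw [Finset.prod_univ_sum, Finset.sum_mul]
  rw [Finset.sum_comm]
  simp only [Fintype.piFinset_univ]
  refine Finset.sum_congr rfl fun s _ => ?_
  rw [Finset.sum_eq_single fun l => realIndex (I l) (s l)]
  · simp
  · intro K _ hK
    obtain ⟨l, hl⟩ := Function.ne_iff.1 hK
    rw [Finset.prod_eq_zero (Finset.mem_univ l), zero_mul]
    rw [if_neg (Ne.symm hl)]
  · simp

theorem sum_dzeta_mul_frameCoeff {n : ℕ} (v : Cn n) (r : Fin n ⊕ Fin n) :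
    ∑ a, dzeta n a v * frameCoeff a r = realCoord r v := by
  rcases r with j | j <;>
  · simp only [Fintype.sum_sum_type, dzeta, frameCoeff, realIndex, wirtCoeff, Fin.sum_univ_two,
      Matrix.cons_val_zero, Matrix.cons_val_one, Sum.inl.injEq, Sum.inr.injEq, reduceCtorEq,
      if_false, add_zero, zero_add, mul_ite, mul_zero, Finset.sum_ite_eq', Finset.mem_univ, if_true,
      realCoord]
    apply Complex.ext <;> simp <;> ring

theorem apply_eq_sum_formCoeff {n k : ℕ} (ψ : Cn n [⋀^Fin k]→L[ℝ] ℂ) (v : Fin k → Cn n) :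
    ψ v = ∑ I : Fin k → Fin n ⊕ Fin n, (∏ l, dzeta n (I l) (v l)) * formCoeff ψ I := by
  classical
  have h1 : ψ v = ∑ K : Fin k → Fin n ⊕ Fin n, (∏ l, (realCoord (K l) (v l) : ℂ)) *
      ψ fun l => stdFrame n (K l) := by
    have : ψ v = ψ.toMultilinearMap fun l => ∑ r, realCoord r (v l) • stdFrame n r := by
      simp only [sum_realCoord_smul_stdFrame]; rfl
    rw [this, MultilinearMap.map_sum]
    refine Finset.sum_congr rfl fun K _ => ?_
    rw [MultilinearMap.map_smul_univ, Complex.real_smul]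
    push_cast
    rfl
  rw [h1]
  simp_rw [formCoeff_eq_sum, Finset.mul_sum, ← mul_assoc, ← Finset.prod_mul_distrib]
  rw [Finset.sum_comm]
  refine Finset.sum_congr rfl fun K _ => ?_
  rw [← Finset.sum_mul]
  congr 1
  simp_rw [← sum_dzeta_mul_frameCoeff]
  rw [Finset.prod_univ_sum, Fintype.piFinset_univ]

/-- Later identities between operators are checked coefficient by coefficient on the strength of
this. -/
theorem formCoeff_ext {n k : ℕ} {ψ φ : Cn n [⋀^Fin k]→L[ℝ] ℂ}
    (h : ∀ I, formCoeff ψ I = formCoeff φ I) : ψ = φ := by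
  ext v
  simp only [apply_eq_sum_formCoeff ψ v, apply_eq_sum_formCoeff φ v, h]

/-- `formCoeff` as a continuous linear map. -/
noncomputable def formCoeffCLM {n k : ℕ} (I : Fin k → Fin n ⊕ Fin n) :
    (Cn n [⋀^Fin k]→L[ℝ] ℂ) →L[ℝ] ℂ :=
  ∑ s : Fin k → Fin 2, (∏ l, wirtCoeff (I l) (s l)) •
    ContinuousAlternatingMap.apply ℝ (Cn n) ℂ fun l => stdFrame n (realIndex (I l) (s l))

theorem formCoeffCLM_apply {n k : ℕ} (I : Fin k → Fin n ⊕ Fin n) (ψ : Cn n [⋀^Fin k]→L[ℝ] ℂ) :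
    formCoeffCLM I ψ = formCoeff ψ I := by
  simp [formCoeffCLM, formCoeff]

theorem formCoeff_add {n k : ℕ} (ψ φ : Cn n [⋀^Fin k]→L[ℝ] ℂ) (I : Fin k → Fin n ⊕ Fin n) :
    formCoeff (ψ + φ) I = formCoeff ψ I + formCoeff φ I := by
  simp only [← formCoeffCLM_apply, map_add]

theorem formCoeff_smul {n k : ℕ} (c : ℂ) (ψ : Cn n [⋀^Fin k]→L[ℝ] ℂ)
    (I : Fin k → Fin n ⊕ Fin n) : formCoeff (c • ψ) I = c * formCoeff ψ I := by
  simp only [formCoeff, ContinuousAlternatingMap.smul_apply, smul_eq_mul, Finset.mul_sum]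
  exact Finset.sum_congr rfl fun _ _ => by ring

theorem formCoeff_zero {n k : ℕ} (I : Fin k → Fin n ⊕ Fin n) :
    formCoeff (0 : Cn n [⋀^Fin k]→L[ℝ] ℂ) I = 0 := by
  rw [← formCoeffCLM_apply, map_zero]

theorem formCoeff_sum {n k : ℕ} {ι : Type*} (s : Finset ι) (ψ : ι → Cn n [⋀^Fin k]→L[ℝ] ℂ)
    (I : Fin k → Fin n ⊕ Fin n) : formCoeff (∑ i ∈ s, ψ i) I = ∑ i ∈ s, formCoeff (ψ i) I := by
  simp only [← formCoeffCLM_apply, map_sum]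

theorem perm_sign_mul_self {k : ℕ} (σ : Equiv.Perm (Fin k)) :
    ((Equiv.Perm.sign σ : ℤ) : ℂ) * ((Equiv.Perm.sign σ : ℤ) : ℂ) = 1 := by
  exact_mod_cast (by simp [← Units.val_mul] : ((Equiv.Perm.sign σ : ℤ)) * (Equiv.Perm.sign σ) = 1)

theorem formCoeff_perm {n k : ℕ} (ψ : Cn n [⋀^Fin k]→L[ℝ] ℂ) (I : Fin k → Fin n ⊕ Fin n)
    (σ : Equiv.Perm (Fin k)) :
    formCoeff ψ (I ∘ σ) = ((Equiv.Perm.sign σ : ℤ) : ℂ) * formCoeff ψ I := by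
  unfold formCoeff
  rw [Finset.mul_sum]
  conv_rhs => rw [← (Equiv.arrowCongr σ (Equiv.refl (Fin 2))).sum_comp]
  refine Finset.sum_congr rfl fun s _ => ?_
  have h1 : ∏ l, wirtCoeff (I l) ((Equiv.arrowCongr σ (Equiv.refl (Fin 2))) s l) =
      ∏ l, wirtCoeff ((I ∘ σ) l) (s l) := by
    rw [← Equiv.prod_comp σ]
    simp [Equiv.arrowCongr]
  have h2 := ψ.toAlternatingMap.map_perm
    (fun l => stdFrame n (realIndex (I l) ((Equiv.arrowCongr σ (Equiv.refl (Fin 2))) s l))) σ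
  rw [h1, mul_left_comm]
  congr 1
  have h3 : ((fun l => stdFrame n (realIndex (I l) ((Equiv.arrowCongr σ (Equiv.refl (Fin 2))) s l)))
      ∘ σ) = fun l => stdFrame n (realIndex ((I ∘ σ) l) (s l)) := by
    ext l; simp [Equiv.arrowCongr]
  rw [h3] at h2
  have h4 : ∀ v, ψ.toAlternatingMap v = ψ v := fun _ => rfl
  rw [h4, h4] at h2
  rw [h2, Units.smul_def, zsmul_eq_mul]

theorem formCoeff_eq_zero_of_not_injective {n k : ℕ} (ψ : Cn n [⋀^Fin k]→L[ℝ] ℂ)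
    {I : Fin k → Fin n ⊕ Fin n} (hI : ¬ Function.Injective I) : formCoeff ψ I = 0 := by
  obtain ⟨i, j, hij, hne⟩ : ∃ i j, I i = I j ∧ i ≠ j := by
    simpa [Function.Injective] using hI
  have h := formCoeff_perm ψ I (Equiv.swap i j)
  have h2 : I ∘ Equiv.swap i j = I := by
    ext l
    rw [Function.comp_apply, Equiv.swap_apply_def]
    split_ifs with h1 h2
    · rw [h1, hij]
    · rw [h2, hij]
    · rfl
  rw [h2, Equiv.Perm.sign_swap hne] at h
  push_cast at h
  have h3 : (2 : ℂ) * formCoeff ψ I = 0 := by linear_combination h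
  simpa using h3

/-- Moving the entry at position `i` to the front is a cycle of sign `(-1)^i`. -/
theorem formCoeff_insertNth {n k : ℕ} (ψ : Cn n [⋀^Fin (k + 1)]→L[ℝ] ℂ) (i : Fin (k + 1))
    (a : Fin n ⊕ Fin n) (I : Fin k → Fin n ⊕ Fin n) :
    formCoeff ψ (i.insertNth a I) = (-1) ^ (i : ℕ) * formCoeff ψ (Fin.cons a I) := by
  rw [← Fin.cons_comp_cycleRange, formCoeff_perm]
  simp

theorem formCoeff_cons {n k : ℕ} (ψ : Cn n [⋀^Fin (k + 1)]→L[ℝ] ℂ)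
    (a : Fin n ⊕ Fin n) (I : Fin k → Fin n ⊕ Fin n) :
    formCoeff ψ (Fin.cons a I) =
      ∑ s, wirtCoeff a s * formCoeff (ψ.curryLeft (stdFrame n (realIndex a s))) I := by
  unfold formCoeff
  rw [← (Fin.consEquiv fun _ => Fin 2).sum_comp, Fintype.sum_prod_type]
  refine Finset.sum_congr rfl fun s _ => ?_
  rw [Finset.mul_sum]
  refine Finset.sum_congr rfl fun t _ => ?_
  rw [Fin.prod_univ_succ]
  simp only [Fin.consEquiv_apply, Fin.cons_zero, Fin.cons_succ, mul_assoc]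
  congr 2
  change _ = ψ _
  congr 1
  ext l
  refine Fin.cases ?_ (fun l => ?_) l <;> simp

theorem dzeta_frame {n : ℕ} (a b : Fin n ⊕ Fin n) :
    ∑ s, wirtCoeff b s * dzeta n a (stdFrame n (realIndex b s)) = if a = b then 1 else 0 := by
  rcases a with i | i <;> rcases b with j | j <;> by_cases h : i = j <;>
    simp [wirtCoeff, dzeta, realIndex, stdFrame, Fin.sum_univ_two, h, Complex.ext_iff] <;>
    norm_num

theorem formCoeff_wedgeOne {n k : ℕ} (J I : Fin k → Fin n ⊕ Fin n) :
    formCoeff (wedgeOne fun l => dzeta n (J l)) I =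
      ∑ σ : Equiv.Perm (Fin k), ((Equiv.Perm.sign σ : ℤ) : ℂ) * if J ∘ σ = I then 1 else 0 := by
  classical
  unfold formCoeff
  simp_rw [wedgeOne_apply, Matrix.det_apply', Finset.mul_sum]
  rw [Finset.sum_comm]
  refine Finset.sum_congr rfl fun σ _ => ?_
  have h : (if J ∘ σ = I then (1 : ℂ) else 0) = ∏ b, if J (σ b) = I b then 1 else 0 := by
    rw [Finset.prod_ite_zero]
    simp [funext_iff]
  rw [h]
  simp_rw [← dzeta_frame, Finset.prod_univ_sum, Finset.mul_sum, Finset.prod_mul_distrib]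
  rw [Fintype.piFinset_univ]
  refine Finset.sum_congr rfl fun s _ => ?_
  simp only [Matrix.of_apply]
  ring

/-- In the coefficient of index `K`, each of the `k!` permutations contributes `ψ_K`: its sign
enters once from the determinant and once from rearranging the coefficient. -/
theorem eq_sum_formCoeff_smul_wedgeOne {n k : ℕ} (ψ : Cn n [⋀^Fin k]→L[ℝ] ℂ) :
    ψ = ((k.factorial : ℂ)⁻¹) • ∑ I : Fin k → Fin n ⊕ Fin n,
      formCoeff ψ I • wedgeOne fun l => dzeta n (I l) := by
  refine formCoeff_ext fun K => ?_
  rw [formCoeff_smul, formCoeff_sum]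
  simp_rw [formCoeff_smul, formCoeff_wedgeOne, Finset.mul_sum]
  rw [Finset.sum_comm]
  have : ∀ σ : Equiv.Perm (Fin k), ∑ I : Fin k → Fin n ⊕ Fin n, (k.factorial : ℂ)⁻¹ *
      (formCoeff ψ I * (((Equiv.Perm.sign σ : ℤ) : ℂ) * if I ∘ σ = K then 1 else 0)) =
      (k.factorial : ℂ)⁻¹ * formCoeff ψ K := by
    intro σ
    rw [Finset.sum_eq_single (K ∘ σ.symm)]
    · rw [formCoeff_perm, if_pos (by ext; simp), Equiv.Perm.sign_symm σ]
      linear_combination (k.factorial : ℂ)⁻¹ * formCoeff ψ K * perm_sign_mul_self σ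
    · intro I _ hI
      rw [if_neg, mul_zero, mul_zero, mul_zero]
      rintro rfl
      exact hI (by ext; simp)
    · simp
  rw [Finset.sum_congr rfl fun σ _ => this σ, Finset.sum_const, Finset.card_univ, Fintype.card_perm,
    Fintype.card_fin, nsmul_eq_mul, mul_inv_cancel_left₀]
  exact_mod_cast k.factorial_ne_zero

theorem hasType_comp_perm {n k : ℕ} (α β : Fin n → Fin 2) (I : Fin k → Fin n ⊕ Fin n)
    (σ : Equiv.Perm (Fin k)) : hasType α β (I ∘ σ) ↔ hasType α β I := by
  unfold hasType
  have : ∀ a, Fintype.card {l // (I ∘ σ) l = a} = Fintype.card {l // I l = a} := fun a =>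
    Fintype.card_congr (σ.subtypeEquiv fun _ => Iff.rfl)
  simp only [this]

theorem formCoeff_wedgeOne_eq_zero {n k : ℕ} {J I : Fin k → Fin n ⊕ Fin n}
    (h : ∀ σ : Equiv.Perm (Fin k), J ∘ σ ≠ I) :
    formCoeff (wedgeOne fun l => dzeta n (J l)) I = 0 := by
  rw [formCoeff_wedgeOne]
  exact Finset.sum_eq_zero fun σ _ => by rw [if_neg (h σ), mul_zero]

/-- A product `dζ_J` has nonzero coefficients only at rearrangements of `J`, and these have the same
type as `J`. So the projection truncates the list of coefficients. -/
theorem formCoeff_typePart {n k : ℕ} (α β : Fin n → Fin 2) (ψ : Cn n [⋀^Fin k]→L[ℝ] ℂ)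
    (K : Fin k → Fin n ⊕ Fin n) :
    formCoeff (typePart α β ψ) K = if hasType α β K then formCoeff ψ K else 0 := by
  unfold typePart
  by_cases hK : hasType α β K
  · rw [if_pos hK]
    conv_rhs => rw [eq_sum_formCoeff_smul_wedgeOne ψ]
    rw [formCoeff_smul, formCoeff_smul, formCoeff_sum, formCoeff_sum]
    congr 1
    refine Finset.sum_subset (Finset.subset_univ _) fun I _ hI => ?_
    rw [formCoeff_smul, formCoeff_wedgeOne_eq_zero, mul_zero]
    rintro σ rfl
    exact hI (by simpa using (hasType_comp_perm α β I σ).1 hK)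
  · rw [if_neg hK, formCoeff_smul, formCoeff_sum, Finset.sum_eq_zero, mul_zero]
    intro I hI
    rw [formCoeff_smul, formCoeff_wedgeOne_eq_zero, mul_zero]
    rintro σ rfl
    exact hK ((hasType_comp_perm α β I σ).2 (by simpa using hI))

end Coefficients

/-! ### Derivatives of coefficients, the exterior derivative and its components by type -/

section LocalCalculus
open scoped BigOperators

/-- The derivative `∂_a F` of a function on `ℂⁿ`: `∂F/∂z_j` for `a = inl j`, `∂F/∂z̄_j` for
`a = inr j`. -/
noncomputable def wirtD {n : ℕ} (a : Fin n ⊕ Fin n) (F : Cn n → ℂ) (y : Cn n) : ℂ :=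
  ∑ s, wirtCoeff a s * fderiv ℝ F y (stdFrame n (realIndex a s))

theorem wirtD_congr {n : ℕ} (a : Fin n ⊕ Fin n) {F G : Cn n → ℂ} {y : Cn n} (h : F =ᶠ[𝓝 y] G) :
    wirtD a F y = wirtD a G y := by
  simp only [wirtD, h.fderiv_eq]

theorem wirtD_const {n : ℕ} (a : Fin n ⊕ Fin n) (c : ℂ) (y : Cn n) :
    wirtD a (fun _ => c) y = 0 := by
  simp [wirtD]

theorem wirtD_eq_zero_of_eventuallyEq_zero {n : ℕ} (a : Fin n ⊕ Fin n) {F : Cn n → ℂ} {y : Cn n}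
    (h : ∀ᶠ z in 𝓝 y, F z = 0) : wirtD a F y = 0 := by
  rw [wirtD_congr a (G := fun _ => 0) h, wirtD_const]

theorem wirtD_sum {n : ℕ} (a : Fin n ⊕ Fin n) {ι : Type*} (s : Finset ι) {F : ι → Cn n → ℂ}
    {y : Cn n} (h : ∀ i ∈ s, DifferentiableAt ℝ (F i) y) :
    wirtD a (fun z => ∑ i ∈ s, F i z) y = ∑ i ∈ s, wirtD a (F i) y := by
  unfold wirtD
  rw [fderiv_fun_sum h, Finset.sum_comm]
  simp [Finset.mul_sum]

theorem wirtD_mul {n : ℕ} (a : Fin n ⊕ Fin n) {F G : Cn n → ℂ} {y : Cn n}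
    (hF : DifferentiableAt ℝ F y) (hG : DifferentiableAt ℝ G y) :
    wirtD a (fun z => F z * G z) y = wirtD a F y * G y + F y * wirtD a G y := by
  unfold wirtD
  rw [fderiv_fun_mul hF hG, Finset.sum_mul, Finset.mul_sum, ← Finset.sum_add_distrib]
  refine Finset.sum_congr rfl fun s _ => ?_
  simp only [add_apply, smul_apply, smul_eq_mul]
  ring

theorem wirtD_const_mul {n : ℕ} (a : Fin n ⊕ Fin n) (c : ℂ) {F : Cn n → ℂ} {y : Cn n}
    (hF : DifferentiableAt ℝ F y) : wirtD a (fun z => c * F z) y = c * wirtD a F y := by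
  rw [wirtD_mul a (differentiableAt_const c) hF, wirtD_const, zero_mul, zero_add]

theorem wirtD_star {n : ℕ} (a : Fin n ⊕ Fin n) {F : Cn n → ℂ} {y : Cn n}
    (hF : DifferentiableAt ℝ F y) :
    wirtD a (fun z => star (F z)) y = star (wirtD a.swap F y) := by
  have h : fderiv ℝ (fun z => star (F z)) y =
      (Complex.conjCLE : ℂ →L[ℝ] ℂ).comp (fderiv ℝ F y) :=
    ((Complex.conjCLE : ℂ →L[ℝ] ℂ).hasFDerivAt.comp y hF.hasFDerivAt).fderiv
  unfold wirtD
  rw [h, star_sum]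
  refine Finset.sum_congr rfl fun s _ => ?_
  rcases a with j | j <;> fin_cases s <;> simp [wirtCoeff, realIndex]

theorem contDiffOn_wirtD {n : ℕ} (a : Fin n ⊕ Fin n) {F : Cn n → ℂ} {s : Set (Cn n)}
    (hs : IsOpen s) (hF : ContDiffOn ℝ ∞ F s) : ContDiffOn ℝ ∞ (wirtD a F) s := by
  unfold wirtD
  refine ContDiffOn.sum fun i _ => contDiffOn_const.mul ?_
  exact (hF.fderiv_of_isOpen hs (by simp)).clm_apply contDiffOn_const

theorem wirtD_comm {n : ℕ} (a b : Fin n ⊕ Fin n) {F : Cn n → ℂ} {y : Cn n}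
    (hF : ContDiffAt ℝ ∞ F y) : wirtD a (wirtD b F) y = wirtD b (wirtD a F) y := by
  have hd : DifferentiableAt ℝ (fderiv ℝ F) y :=
    (hF.fderiv_right (m := 1) (by
      rw [one_add_one_eq_two]; exact WithTop.coe_le_coe.2 (le_top : (2 : ℕ∞) ≤ ⊤))).differentiableAt (by simp)
  have key : ∀ a b : Fin n ⊕ Fin n, wirtD a (wirtD b F) y = ∑ s, ∑ t, wirtCoeff a s *
      (wirtCoeff b t * fderiv ℝ (fderiv ℝ F) y (stdFrame n (realIndex a s))
        (stdFrame n (realIndex b t))) := by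
    intro a b
    conv_lhs => unfold wirtD
    have h1 : ∀ v : Cn n, DifferentiableAt ℝ (fun z => fderiv ℝ F z v) y := fun v =>
      hd.clm_apply (differentiableAt_const v)
    refine Finset.sum_congr rfl fun s _ => ?_
    rw [fderiv_fun_sum fun t _ => (h1 _).const_mul _, ← Finset.mul_sum]
    congr 1
    simp only [sum_apply]
    refine Finset.sum_congr rfl fun t _ => ?_
    rw [fderiv_const_mul (h1 _), fderiv_clm_apply hd (differentiableAt_const _)]
    simp
  have hsymm : IsSymmSndFDerivAt ℝ F y := hF.isSymmSndFDerivAt (by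
    simpa using WithTop.coe_le_coe.2 (le_top : (2 : ℕ∞) ≤ ⊤))
  rw [key, key, Finset.sum_comm]
  refine Finset.sum_congr rfl fun t _ => Finset.sum_congr rfl fun s _ => ?_
  rw [hsymm.eq]
  ring

theorem wirtD_formCoeff {n k : ℕ} {η : Cn n → Cn n [⋀^Fin k]→L[ℝ] ℂ} {y : Cn n}
    (hη : DifferentiableAt ℝ η y) (a : Fin n ⊕ Fin n) (I : Fin k → Fin n ⊕ Fin n) :
    wirtD a (fun z => formCoeff (η z) I) y =
      ∑ s, wirtCoeff a s * formCoeff (fderiv ℝ η y (stdFrame n (realIndex a s))) I := by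
  have h : fderiv ℝ (fun z => formCoeff (η z) I) y = (formCoeffCLM I).comp (fderiv ℝ η y) := by
    simp_rw [← formCoeffCLM_apply]
    exact ((formCoeffCLM I).hasFDerivAt.comp y hη.hasFDerivAt).fderiv
  simp only [wirtD, h, ContinuousLinearMap.comp_apply, formCoeffCLM_apply]

theorem contDiffOn_formCoeff {n k : ℕ} {η : Cn n → Cn n [⋀^Fin k]→L[ℝ] ℂ} {s : Set (Cn n)}
    (hη : ContDiffOn ℝ ∞ η s) (I : Fin k → Fin n ⊕ Fin n) :
    ContDiffOn ℝ ∞ (fun z => formCoeff (η z) I) s := by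
  simp_rw [← formCoeffCLM_apply]
  exact (formCoeffCLM I).contDiff.comp_contDiffOn hη

/-- For `f` the derivative of `η` this computes `d η`; for `f = dζ_a ⊗ ∂_a η` it computes `dζ_a ∧
∂_a η`. -/
theorem formCoeff_alternatizeUncurryFin {n k : ℕ} (f : Cn n →L[ℝ] Cn n [⋀^Fin k]→L[ℝ] ℂ)
    (J : Fin (k + 1) → Fin n ⊕ Fin n) :
    formCoeff (ContinuousAlternatingMap.alternatizeUncurryFin f) J =
      ∑ i : Fin (k + 1), (-1) ^ (i : ℕ) * ∑ s, wirtCoeff (J i) s *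
        formCoeff (f (stdFrame n (realIndex (J i) s))) (i.removeNth J) := by
  conv_lhs => unfold formCoeff
  simp_rw [ContinuousAlternatingMap.alternatizeUncurryFin_apply, Finset.mul_sum]
  rw [Finset.sum_comm]
  refine Finset.sum_congr rfl fun i _ => ?_
  rw [← (Fin.insertNthEquiv (fun _ => Fin 2) i).sum_comp, Fintype.sum_prod_type]
  refine Finset.sum_congr rfl fun s _ => ?_
  unfold formCoeff
  rw [Finset.mul_sum, Finset.mul_sum]
  refine Finset.sum_congr rfl fun t _ => ?_
  rw [Fin.prod_univ_succAbove _ i, zsmul_eq_mul]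
  simp only [Fin.insertNthEquiv_apply, Fin.insertNth_apply_same, Fin.insertNth_apply_succAbove,
    Fin.removeNth_apply]
  have : (i.removeNth fun l => stdFrame n (realIndex (J l)
      (Fin.insertNth (α := fun _ => Fin 2) i s t l))) =
      fun l => stdFrame n (realIndex (J (i.succAbove l)) (t l)) := by
    ext l; simp [Fin.removeNth_apply]
  rw [this]
  push_cast
  ring

theorem formCoeff_extDeriv {n k : ℕ} {η : Cn n → Cn n [⋀^Fin k]→L[ℝ] ℂ} {y : Cn n}
    (hη : DifferentiableAt ℝ η y) (J : Fin (k + 1) → Fin n ⊕ Fin n) :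
    formCoeff (extDeriv η y) J = ∑ i : Fin (k + 1), (-1) ^ (i : ℕ) *
      wirtD (J i) (fun z => formCoeff (η z) (i.removeNth J)) y := by
  simp_rw [wirtD_formCoeff hη]
  exact formCoeff_alternatizeUncurryFin _ J

/-- These are the coefficients of `dζ_a ∧ ∂_a η`. -/
theorem sum_wirtD_eq_zero_of_not_injective {n k : ℕ} {η : Cn n → Cn n [⋀^Fin k]→L[ℝ] ℂ} {y : Cn n}
    (hη : DifferentiableAt ℝ η y) (a : Fin n ⊕ Fin n) {J : Fin (k + 1) → Fin n ⊕ Fin n}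
    (hJ : ¬ Function.Injective J) :
    ∑ i : Fin (k + 1), (if J i = a then (-1) ^ (i : ℕ) *
      wirtD (J i) (fun z => formCoeff (η z) (i.removeNth J)) y else 0) = 0 := by
  have h := formCoeff_eq_zero_of_not_injective (ContinuousAlternatingMap.alternatizeUncurryFin
    ((dzeta n a).smulRight (∑ s, wirtCoeff a s • fderiv ℝ η y (stdFrame n (realIndex a s))))) hJ
  rw [formCoeff_alternatizeUncurryFin] at h
  refine Eq.trans (Finset.sum_congr rfl fun i _ => ?_) h
  simp only [ContinuousLinearMap.smulRight_apply, formCoeff_smul, ← mul_assoc, ← Finset.sum_mul]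
  rw [mul_assoc, dzeta_frame]
  by_cases hi : a = J i
  · subst hi
    rw [wirtD_formCoeff hη, formCoeff_sum]
    simp [formCoeff_smul]
  · simp [hi, Ne.symm hi]

/-- The number of occurrences of `a` in the multi-index `I`. -/
def indexCount {n k : ℕ} (I : Fin k → Fin n ⊕ Fin n) (a : Fin n ⊕ Fin n) : ℕ :=
  ∑ l, if I l = a then 1 else 0

theorem indexCount_eq_card {n k : ℕ} (I : Fin k → Fin n ⊕ Fin n) (a : Fin n ⊕ Fin n) :
    indexCount I a = Fintype.card {l // I l = a} := by
  rw [indexCount, Fintype.card_subtype, Finset.card_filter]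

theorem hasType_iff {n k : ℕ} (α β : Fin n → Fin 2) (I : Fin k → Fin n ⊕ Fin n) :
    hasType α β I ↔ ∀ a, indexCount I a = ((Sum.elim α β a : Fin 2) : ℕ) := by
  simp only [hasType, ← indexCount_eq_card, Sum.forall, Sum.elim_inl, Sum.elim_inr, forall_and]

theorem indexCount_eq_removeNth {n k : ℕ} (J : Fin (k + 1) → Fin n ⊕ Fin n) (i : Fin (k + 1))
    (a : Fin n ⊕ Fin n) :
    indexCount J a = (if J i = a then 1 else 0) + indexCount (i.removeNth J) a := by
  rw [indexCount, Fin.sum_univ_succAbove _ i]; rfl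

theorem indexCount_cons {n k : ℕ} (b : Fin n ⊕ Fin n) (I : Fin k → Fin n ⊕ Fin n)
    (a : Fin n ⊕ Fin n) :
    indexCount (Fin.cons b I) a = (if b = a then 1 else 0) + indexCount I a := by
  rw [indexCount, Fin.sum_univ_succ]; rfl

theorem indexCount_le_one {n k : ℕ} {I : Fin k → Fin n ⊕ Fin n} (hI : Function.Injective I)
    (a : Fin n ⊕ Fin n) : indexCount I a ≤ 1 := by
  rw [indexCount_eq_card, Fintype.card_le_one_iff]
  exact fun ⟨x, hx⟩ ⟨y, hy⟩ => Subtype.ext (hI (hx.trans hy.symm))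

theorem exists_hasType {n k : ℕ} {I : Fin k → Fin n ⊕ Fin n} (hI : Function.Injective I) :
    ∃ α β, hasType α β I := by
  refine ⟨fun j => ⟨indexCount I (.inl j), Nat.lt_succ_of_le (indexCount_le_one hI _)⟩,
    fun j => ⟨indexCount I (.inr j), Nat.lt_succ_of_le (indexCount_le_one hI _)⟩, ?_⟩
  rw [hasType_iff]
  rintro (j | j) <;> rfl

theorem hasType_unique {n k : ℕ} {I : Fin k → Fin n ⊕ Fin n} {α β α' β' : Fin n → Fin 2}
    (h : hasType α β I) (h' : hasType α' β' I) : α = α' ∧ β = β' := by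
  rw [hasType_iff] at h h'
  constructor
  · ext j; have := (h (.inl j)).symm.trans (h' (.inl j)); simpa using this
  · ext j; have := (h (.inr j)).symm.trans (h' (.inr j)); simpa using this

/-- An injective multi-index has exactly one type, so only the type `(α, β)` of `J` without its
entry `i` can contribute. Comparing the counts of `J` and of the shortened index, `J` has type `(α +
1_j, β)` with `α_j = 0` exactly if the removed entry is `dz_j`. -/
theorem sum_hasType_update_left {n k : ℕ} (j : Fin n) {J : Fin (k + 1) → Fin n ⊕ Fin n}
    (hJ : Function.Injective J) (i : Fin (k + 1)) (x : ℂ) :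
    (∑ α : Fin n → Fin 2 with α j = 0, ∑ β : Fin n → Fin 2,
      if hasType (Function.update α j 1) β J then (if hasType α β (i.removeNth J) then x else 0)
        else 0) = if J i = .inl j then x else 0 := by
  have hc := indexCount_eq_removeNth J i
  split_ifs with h
  · obtain ⟨α, β, hT⟩ := exists_hasType (hJ.comp (Fin.succAbove_right_injective (p := i)))
    change hasType α β (i.removeNth J) at hT
    have hT' := (hasType_iff _ _ _).1 hT
    have hα : α j = 0 := by
      have h1 := indexCount_le_one hJ (.inl j)
      have h2 := hT' (.inl j)
      rw [hc, if_pos h] at h1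
      simp only [Sum.elim_inl] at h2
      apply Fin.ext
      simp; omega
    have hT2 : hasType (Function.update α j 1) β J := by
      rw [hasType_iff]
      intro a
      rw [hc, hT' a, h]
      rcases a with l | l
      · by_cases hl : j = l
        · subst hl; simp [hα]
        · simp [hl, Ne.symm hl]
      · simp
    rw [Finset.sum_eq_single α, Finset.sum_eq_single β, if_pos hT2, if_pos hT]
    · intro β' _ hβ
      rw [if_neg (fun h' => hβ (hasType_unique h' hT).2)]; simp
    · simp
    · intro α' _ hα
      refine Finset.sum_eq_zero fun β' _ => ?_
      rw [if_neg (fun h' => hα (hasType_unique h' hT).1)]; simp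
    · simp [hα]
  · refine Finset.sum_eq_zero fun α hα => Finset.sum_eq_zero fun β _ => ?_
    split_ifs with h1 h2
    · exfalso
      have h3 := (hasType_iff _ _ _).1 h1 (.inl j)
      have h4 := (hasType_iff _ _ _).1 h2 (.inl j)
      rw [hc, if_neg h, h4] at h3
      simp at hα
      simp [hα] at h3
    · rfl
    · rfl

theorem sum_hasType_update_right {n k : ℕ} (j : Fin n) {J : Fin (k + 1) → Fin n ⊕ Fin n}
    (hJ : Function.Injective J) (i : Fin (k + 1)) (x : ℂ) :
    (∑ α : Fin n → Fin 2, ∑ β : Fin n → Fin 2 with β j = 0,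
      if hasType α (Function.update β j 1) J then (if hasType α β (i.removeNth J) then x else 0)
        else 0) = if J i = .inr j then x else 0 := by
  have hc := indexCount_eq_removeNth J i
  split_ifs with h
  · obtain ⟨α, β, hT⟩ := exists_hasType (hJ.comp (Fin.succAbove_right_injective (p := i)))
    change hasType α β (i.removeNth J) at hT
    have hT' := (hasType_iff _ _ _).1 hT
    have hβ : β j = 0 := by
      have h1 := indexCount_le_one hJ (.inr j)
      have h2 := hT' (.inr j)
      rw [hc, if_pos h] at h1
      simp only [Sum.elim_inr] at h2
      apply Fin.ext
      simp; omega
    have hT2 : hasType α (Function.update β j 1) J := by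
      rw [hasType_iff]
      intro a
      rw [hc, hT' a, h]
      rcases a with l | l
      · simp
      · by_cases hl : j = l
        · subst hl; simp [hβ]
        · simp [hl, Ne.symm hl]
    rw [Finset.sum_eq_single α, Finset.sum_eq_single β, if_pos hT2, if_pos hT]
    · intro β' _ hβ
      rw [if_neg (fun h' => hβ (hasType_unique h' hT).2)]; simp
    · simp [hβ]
    · intro α' _ hα
      refine Finset.sum_eq_zero fun β' _ => ?_
      rw [if_neg (fun h' => hα (hasType_unique h' hT).1)]; simp
    · simp
  · refine Finset.sum_eq_zero fun α _ => Finset.sum_eq_zero fun β hβ => ?_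
    split_ifs with h1 h2
    · exfalso
      have h3 := (hasType_iff _ _ _).1 h1 (.inr j)
      have h4 := (hasType_iff _ _ _).1 h2 (.inr j)
      rw [hc, if_neg h, h4] at h3
      simp at hβ
      simp [hβ] at h3
    · rfl
    · rfl

theorem formCoeff_typePart_extDeriv_typePart {n k : ℕ} {η : Cn n → Cn n [⋀^Fin k]→L[ℝ] ℂ} {y : Cn n}
    {s : Set (Cn n)} (hs : IsOpen s) (hη : ContDiffOn ℝ ∞ η s) (hy : y ∈ s) (α β α' β' : Fin n → Fin 2) (J : Fin (k + 1) → Fin n ⊕ Fin n) :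
    formCoeff (typePart α' β' (extDeriv (fun z => typePart α β (η z)) y)) J =
      ∑ i : Fin (k + 1), if hasType α' β' J then (if hasType α β (i.removeNth J) then
        (-1) ^ (i : ℕ) * wirtD (J i) (fun z => formCoeff (η z) (i.removeNth J)) y else 0) else 0 := by
  have hd : DifferentiableAt ℝ (fun z => typePart α β (η z)) y := by
    exact ((contDiffOn_typePart α β hη).contDiffAt (hs.mem_nhds hy)).differentiableAt (by simp)
  rw [formCoeff_typePart]
  split_ifs with h
  · rw [formCoeff_extDeriv hd]
    refine Finset.sum_congr rfl fun i _ => ?_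
    simp_rw [formCoeff_typePart]
    split_ifs with h2
    · rfl
    · rw [wirtD_const, mul_zero]
  · simp

theorem sum_left_formCoeff_typePart {n k : ℕ} {η : Cn n → Cn n [⋀^Fin k]→L[ℝ] ℂ} {y : Cn n}
    {s : Set (Cn n)} (hs : IsOpen s) (hη : ContDiffOn ℝ ∞ η s) (hy : y ∈ s) (j : Fin n) (J : Fin (k + 1) → Fin n ⊕ Fin n) :
    ∑ α : Fin n → Fin 2 with α j = 0, ∑ β : Fin n → Fin 2, formCoeff (typePart
      (Function.update α j 1) β (extDeriv (fun z => typePart α β (η z)) y)) J =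
    ∑ i : Fin (k + 1), (if J i = .inl j then (-1) ^ (i : ℕ) *
      wirtD (J i) (fun z => formCoeff (η z) (i.removeNth J)) y else 0) := by
  by_cases hJ : Function.Injective J
  · simp_rw [formCoeff_typePart_extDeriv_typePart hs hη hy]
    rw [Finset.sum_congr rfl fun α _ => Finset.sum_comm, Finset.sum_comm]
    exact Finset.sum_congr rfl fun i _ => sum_hasType_update_left j hJ i _
  -- An index with a repeated entry may have no type, so the counting argument does not apply; here
  -- both sides vanish because they are coefficients of alternating forms.
  · rw [sum_wirtD_eq_zero_of_not_injective
      ((hη.contDiffAt (hs.mem_nhds hy)).differentiableAt (by simp)) _ hJ]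
    exact Finset.sum_eq_zero fun _ _ => Finset.sum_eq_zero fun _ _ =>
      formCoeff_eq_zero_of_not_injective _ hJ

theorem sum_right_formCoeff_typePart {n k : ℕ} {η : Cn n → Cn n [⋀^Fin k]→L[ℝ] ℂ} {y : Cn n}
    {s : Set (Cn n)} (hs : IsOpen s) (hη : ContDiffOn ℝ ∞ η s) (hy : y ∈ s) (j : Fin n) (J : Fin (k + 1) → Fin n ⊕ Fin n) :
    ∑ α : Fin n → Fin 2, ∑ β : Fin n → Fin 2 with β j = 0, formCoeff (typePart
      α (Function.update β j 1) (extDeriv (fun z => typePart α β (η z)) y)) J =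
    ∑ i : Fin (k + 1), (if J i = .inr j then (-1) ^ (i : ℕ) *
      wirtD (J i) (fun z => formCoeff (η z) (i.removeNth J)) y else 0) := by
  by_cases hJ : Function.Injective J
  · simp_rw [formCoeff_typePart_extDeriv_typePart hs hη hy]
    rw [Finset.sum_congr rfl fun α _ => Finset.sum_comm, Finset.sum_comm]
    exact Finset.sum_congr rfl fun i _ => sum_hasType_update_right j hJ i _
  · rw [sum_wirtD_eq_zero_of_not_injective
      ((hη.contDiffAt (hs.mem_nhds hy)).differentiableAt (by simp)) _ hJ]
    exact Finset.sum_eq_zero fun _ _ => Finset.sum_eq_zero fun _ _ =>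
      formCoeff_eq_zero_of_not_injective _ hJ

/-- Antisymmetrizing a function of `J` without two entries that is symmetric in these gives zero. -/
theorem sum_sum_removeNth_eq_zero {ι : Type*} {k : ℕ} (J : Fin (k + 2) → ι) (S : ι → ι → ℂ)
    (hS : ∀ x y, S x y = S y x) (w : (Fin k → ι) → ℂ) :
    ∑ i : Fin (k + 2), ∑ l : Fin (k + 1), (-1) ^ (i : ℕ) * ((-1) ^ (l : ℕ) *
      (S (J i) (i.removeNth J l) * w (l.removeNth (i.removeNth J)))) = 0 := by
  rw [← Fintype.sum_prod_type']
  -- The involution exchanges the two orders of removing the same pair of entries. It leaves the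
  -- remaining index unchanged and reverses the sign.
  refine Finset.sum_involution (fun p _ => (p.1.succAbove p.2, p.2.predAbove p.1)) ?_ ?_ ?_ ?_
  · rintro ⟨i, l⟩ -
    have h1 : (i.succAbove l).removeNth J (l.predAbove i) = J i := by
      rw [Fin.removeNth_apply, Fin.succAbove_succAbove_predAbove]
    have h2 := Fin.neg_one_pow_succAbove_add_predAbove (R := ℂ) i l
    simp only [h1, ← Fin.removeNth_removeNth_eq_swap J l i]
    rw [Fin.removeNth_apply, hS (J (i.succAbove l))]
    rw [pow_add, pow_add] at h2
    linear_combination (S (J i) (J (i.succAbove l)) * w (l.removeNth (i.removeNth J))) * h2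
  · rintro ⟨i, l⟩ - - h
    exact Fin.succAbove_ne i l (congrArg Prod.fst h)
  · simp
  · rintro ⟨i, l⟩ -
    simp only [Prod.mk.injEq]
    exact ⟨Fin.succAbove_succAbove_predAbove i l, Fin.predAbove_predAbove_succAbove i l⟩

end LocalCalculus

/-! ### Changes of charts in the rigidified structure -/

section Transition

/-- The entries of the diagonal differential are themselves functions of one variable each. This is
what keeps `H_j` a function of `z_j` alone after a change of chart. -/
theorem IsRigid.exists_fderiv_eq {n : ℕ} {f : Cn n → Cn n} {U : Set (Cn n)} (hU : IsOpen U)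
    (h : IsRigid f U) : ∃ φ φ' : Fin n → ℂ → ℂ, ∀ x ∈ U, (f x = fun j => φ j (x j)) ∧
      ∀ v : Cn n, fderiv ℝ f x v = fun j => φ' j (x j) * v j := by
  obtain ⟨φ, h1, h2⟩ := h
  refine ⟨φ, fun j => deriv (φ j), fun x hx => ⟨h2 x hx, fun v => ?_⟩⟩
  have key : HasFDerivAt f (ContinuousLinearMap.pi fun j =>
      ((deriv (φ j) (x j)) • (ContinuousLinearMap.proj j : Cn n →L[ℝ] ℂ))) x := by
    have he : f =ᶠ[𝓝 x] fun z j => φ j (z j) :=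
      Filter.eventually_of_mem (hU.mem_nhds hx) h2
    refine HasFDerivAt.congr_of_eventuallyEq ?_ he
    refine hasFDerivAt_pi.2 fun j => ?_
    have hop : IsOpen ((fun z : Cn n => z j) '' U) := isOpenMap_eval j _ hU
    have hd : HasDerivAt (φ j) (deriv (φ j) (x j)) (x j) :=
      ((h1 j).differentiableAt (hop.mem_nhds ⟨x, hx, rfl⟩)).hasDerivAt
    have := hd.hasFDerivAt.restrictScalars ℝ |>.comp x
      ((ContinuousLinearMap.proj j : Cn n →L[ℝ] ℂ).hasFDerivAt (x := x))
    refine this.congr_fderiv ?_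
    ext v
    simp [mul_comm]
  rw [key.fderiv]
  ext j
  simp

theorem mem_transition_source {n : ℕ} {X : Type*} [TopologicalSpace X]
    {e e' : OpenPartialHomeomorph X (Cn n)} {y : Cn n} :
    y ∈ (e.symm ≫ₕ e').source ↔ y ∈ e.target ∧ e.symm y ∈ e'.source := by
  simp

variable {n : ℕ} {X : Type*} [TopologicalSpace X] [ChartedSpace (Cn n) X]

theorem mem_maximalAtlas_of_rigid {e : OpenPartialHomeomorph X (Cn n)}
    (he : e ∈ (rigidGroupoid n).maximalAtlas X) :
    e ∈ IsManifold.maximalAtlas 𝓘(ℝ, Cn n) 1 X := by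
  have h1 := StructureGroupoid.maximalAtlas_mono (M := X) (rigidGroupoid_le n) he
  have : IsManifold.maximalAtlas 𝓘(ℝ, Cn n) ∞ X ⊆ IsManifold.maximalAtlas 𝓘(ℝ, Cn n) 1 X :=
    IsManifold.maximalAtlas_subset_of_le (by simp)
  exact this h1

theorem isLocallyRigid_transition {e e' : OpenPartialHomeomorph X (Cn n)}
    (he : e ∈ (rigidGroupoid n).maximalAtlas X) (he' : e' ∈ (rigidGroupoid n).maximalAtlas X) :
    IsLocallyRigid (e.symm ≫ₕ e') (e.symm ≫ₕ e').source :=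
  ((rigidGroupoid n).compatible_of_mem_maximalAtlas he he').1

variable [HasGroupoid X (rigidGroupoid n)]

theorem mdifferentiable_of_rigid {e : OpenPartialHomeomorph X (Cn n)}
    (he : e ∈ (rigidGroupoid n).maximalAtlas X) :
    e.MDifferentiable 𝓘(ℝ, Cn n) 𝓘(ℝ, Cn n) :=
  ⟨fun _ hx => (mdifferentiableAt_of_mem_maximalAtlas (mem_maximalAtlas_of_rigid he)
    hx).mdifferentiableWithinAt, fun _ hx => (mdifferentiableAt_symm_of_mem_maximalAtlas
    (mem_maximalAtlas_of_rigid he) hx).mdifferentiableWithinAt⟩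

theorem mfderiv_symm_eq {e e' : OpenPartialHomeomorph X (Cn n)}
    (he : e ∈ (rigidGroupoid n).maximalAtlas X) (he' : e' ∈ (rigidGroupoid n).maximalAtlas X)
    {y : Cn n} (hy : y ∈ (e.symm ≫ₕ e').source) (v : Cn n) :
    (mfderiv 𝓘(ℝ, Cn n) 𝓘(ℝ, Cn n) e.symm y v : Cn n) =
      (mfderiv 𝓘(ℝ, Cn n) 𝓘(ℝ, Cn n) e'.symm ((e.symm ≫ₕ e') y)
        (fderiv ℝ (e.symm ≫ₕ e') y v) : Cn n) := by
  have : IsManifold 𝓘(ℝ, Cn n) ∞ X := isManifold_of_rigid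
  have : IsManifold 𝓘(ℝ, Cn n) 1 X := IsManifold.of_le (n := ∞) (by simp)
  have D := mdifferentiable_of_rigid he
  have D' := mdifferentiable_of_rigid he'
  have hτ : MDifferentiableAt 𝓘(ℝ, Cn n) 𝓘(ℝ, Cn n) (e.symm ≫ₕ e') y :=
    (D.symm.trans D').mdifferentiableAt hy
  have hev : (e.symm : Cn n → X) =ᶠ[𝓝 y] e'.symm ∘ (e.symm ≫ₕ e') := by
    filter_upwards [(e.symm ≫ₕ e').open_source.mem_nhds hy] with z hz
    simp [e'.left_inv (mem_transition_source.1 hz).2]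
  rw [hev.mfderiv_eq, mfderiv_comp y (D'.mdifferentiableAt_symm ?_) hτ, mfderiv_eq_fderiv]
  · rfl
  · exact (e.symm ≫ₕ e').map_source hy |>.1

theorem symm_transition_apply {e e' : OpenPartialHomeomorph X (Cn n)} {y : Cn n}
    (hy : y ∈ (e.symm ≫ₕ e').source) : e'.symm ((e.symm ≫ₕ e') y) = e.symm y := by
  simp [e'.left_inv (mem_transition_source.1 hy).2]

theorem HermitianMetric.inChart_eq (h : HermitianMetric n X)
    {e e' : OpenPartialHomeomorph X (Cn n)}
    (he : e ∈ (rigidGroupoid n).maximalAtlas X) (he' : e' ∈ (rigidGroupoid n).maximalAtlas X)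
    {y : Cn n} (hy : y ∈ (e.symm ≫ₕ e').source) (u v : Cn n) :
    h.inChart e y u v = h.inChart e' ((e.symm ≫ₕ e') y) (fderiv ℝ (e.symm ≫ₕ e') y u)
      (fderiv ℝ (e.symm ≫ₕ e') y v) := by
  let h' : X → Cn n → Cn n → ℂ := fun x u v => h.toFun x u v
  change h' (e.symm y) _ _ = h' (e'.symm ((e.symm ≫ₕ e') y)) _ _
  rw [symm_transition_apply hy, mfderiv_symm_eq he he' hy, mfderiv_symm_eq he he' hy]
  rfl

/-- Only the chain rule at one point is involved, so `η` need not come from a natural operator. This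
suits `Λ_j`, whose independence of the chart rests on the metric. -/
theorem chartExpr_ofLocal_eq {k : ℕ} (η : X → Cn n → Cn n [⋀^Fin k]→L[ℝ] ℂ)
    {e : OpenPartialHomeomorph X (Cn n)} (he : e ∈ atlas (Cn n) X) {y : Cn n} (hy : y ∈ e.target) :
    chartExpr e (ofLocal η) y =
      (η (e.symm y) ((e.symm ≫ₕ chartAt (Cn n) (e.symm y)) y)).compContinuousLinearMap
        (fderiv ℝ (e.symm ≫ₕ chartAt (Cn n) (e.symm y)) y) := by
  have : IsManifold 𝓘(ℝ, Cn n) ∞ X := isManifold_of_rigid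
  have : IsManifold 𝓘(ℝ, Cn n) 1 X := IsManifold.of_le (n := ∞) (by simp)
  have D := mdifferentiable_of_mem_atlas (I := 𝓘(ℝ, Cn n)) he
  set x := e.symm y with hx
  set c := chartAt (Cn n) x with hc
  have D' := mdifferentiable_of_mem_atlas (I := 𝓘(ℝ, Cn n)) (chart_mem_atlas (Cn n) x)
  have hd : ∀ v : Cn n, (fderiv ℝ (e.symm ≫ₕ c) y v : Cn n) =
      (mfderiv 𝓘(ℝ, Cn n) 𝓘(ℝ, Cn n) c x (mfderiv 𝓘(ℝ, Cn n) 𝓘(ℝ, Cn n) e.symm y v) : Cn n) := by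
    intro v
    rw [← mfderiv_eq_fderiv]
    have := mfderiv_comp (I := 𝓘(ℝ, Cn n)) (I' := 𝓘(ℝ, Cn n)) (I'' := 𝓘(ℝ, Cn n)) y
      (g := c) (f := e.symm) (D'.mdifferentiableAt (mem_chart_source _ _))
      (D.mdifferentiableAt_symm hy)
    exact congrArg (fun L => L v) this
  ext v
  change η x (c x) _ = η x (c x) _
  congr 1
  ext1 i
  exact (hd (v i)).symm

/-- Near a point of its domain, a change of charts has diagonal differential, with entries depending
on one variable each. -/
theorem exists_transition_eq {e e' : OpenPartialHomeomorph X (Cn n)}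
    (he : e ∈ (rigidGroupoid n).maximalAtlas X) (he' : e' ∈ (rigidGroupoid n).maximalAtlas X)
    {y : Cn n} (hy : y ∈ (e.symm ≫ₕ e').source) : ∃ φ φ' : Fin n → ℂ → ℂ, ∀ᶠ z in 𝓝 y,
      z ∈ (e.symm ≫ₕ e').source ∧ ((e.symm ≫ₕ e') z = fun j => φ j (z j)) ∧
      ∀ v : Cn n, fderiv ℝ (e.symm ≫ₕ e') z v = fun j => φ' j (z j) * v j := by
  obtain ⟨u, hu, hyu, hr⟩ := isLocallyRigid_transition he he' y hy
  have ho := (e.symm ≫ₕ e').open_source.inter hu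
  obtain ⟨φ, φ', h⟩ := hr.exists_fderiv_eq ho
  exact ⟨φ, φ', Filter.eventually_of_mem (ho.mem_nhds ⟨hy, hyu⟩) fun z hz => ⟨hz.1, h z hz⟩⟩

theorem exists_fderiv_transition_eq {e e' : OpenPartialHomeomorph X (Cn n)}
    (he : e ∈ (rigidGroupoid n).maximalAtlas X) (he' : e' ∈ (rigidGroupoid n).maximalAtlas X)
    {y : Cn n} (hy : y ∈ (e.symm ≫ₕ e').source) : ∃ c : Fin n → ℂ,
      ∀ v : Cn n, fderiv ℝ (e.symm ≫ₕ e') y v = fun j => c j * v j := by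
  obtain ⟨φ, φ', h⟩ := exists_transition_eq he he' hy
  exact ⟨fun j => φ' j (y j), h.self_of_nhds.2.2⟩

end Transition

/-! ### Distinctive metrics split into one-variable factors -/

section MetricCoeff
variable {n : ℕ} {X : Type*} [TopologicalSpace X] [ChartedSpace (Cn n) X]

/-- The coefficient `h(∂/∂z_j, ∂/∂z_j)` of the metric in a chart. -/
noncomputable def HermitianMetric.metricCoeff (h : HermitianMetric n X)
    (e : OpenPartialHomeomorph X (Cn n)) (j : Fin n) (y : Cn n) : ℝ :=
  (h.inChart e y (Pi.single j 1) (Pi.single j 1)).re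

/-- A metric that in every chart is `∑ H_j |dz_j|²`, with `H_j` locally a function of `z_j` alone. -/
def HermitianMetric.IsSplit (h : HermitianMetric n X) : Prop :=
  ∀ e ∈ atlas (Cn n) X, ∀ y ∈ e.target,
    (∀ u v : Cn n, h.inChart e y u v = ∑ j, (h.metricCoeff e j y : ℂ) * (u j * star (v j))) ∧
    ∀ j, ∃ g : ℂ → ℝ, ∀ᶠ z in 𝓝 y, h.metricCoeff e j z = g (z j)

theorem HermitianMetric.contDiffOn_metricCoeff (h : HermitianMetric n X)
    {e : OpenPartialHomeomorph X (Cn n)} (he : e ∈ atlas (Cn n) X) (j : Fin n) :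
    ContDiffOn ℝ ∞ (h.metricCoeff e j) e.target :=
  Complex.reCLM.contDiff.comp_contDiffOn (h.smooth e he _ _)

variable [HasGroupoid X (rigidGroupoid n)]

theorem HermitianMetric.metricCoeff_pos (h : HermitianMetric n X)
    {e : OpenPartialHomeomorph X (Cn n)} (he : e ∈ atlas (Cn n) X) (j : Fin n) {y : Cn n}
    (hy : y ∈ e.target) : 0 < h.metricCoeff e j y := by
  refine h.pos _ _ fun h0 => ?_
  have D := mdifferentiable_of_rigid ((rigidGroupoid n).subset_maximalAtlas he)
  have hinj := D.symm.mfderiv_injective (x := y) hy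
  have : (Pi.single j 1 : Cn n) = 0 := hinj (by rw [h0]; exact (map_zero _).symm)
  simpa using congrFun this j

/-- In the distinguished chart `H_j = |f_j(z_j)|²`. A rigid change of chart `z_j ↦ φ_j(z_j)`
replaces it by `|f_j(φ_j(z_j)) φ_j'(z_j)|²`, again a function of `z_j`. -/
theorem HermitianMetric.IsDistinctiveKahler.isSplit {h : HermitianMetric n X}
    (hd : h.IsDistinctiveKahler) : h.IsSplit := by
  intro e he y hy
  have he1 := (rigidGroupoid n).subset_maximalAtlas he
  obtain ⟨e', he', hx, f, -, hf, -⟩ := hd (e.symm y)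
  obtain ⟨φ, φ', h1⟩ := exists_transition_eq he1 he' (mem_transition_source.2 ⟨hy, hx⟩)
  have h2 : ∀ᶠ z in 𝓝 y, ∀ u v : Cn n, h.inChart e z u v =
      ∑ j, (Complex.normSq (f j (φ j (z j)) * φ' j (z j)) : ℂ) * (u j * star (v j)) := by
    filter_upwards [h1] with z hz u v
    rw [h.inChart_eq he1 he' hz.1, hf _ ((e.symm ≫ₕ e').map_source hz.1).1]
    refine Finset.sum_congr rfl fun j _ => ?_
    rw [hz.2.2, hz.2.2, hz.2.1, ← Complex.mul_conj]
    simp only [star_mul', starRingEnd_apply]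
    ring
  have h3 : ∀ᶠ z in 𝓝 y, ∀ j, h.metricCoeff e j z =
      Complex.normSq (f j (φ j (z j)) * φ' j (z j)) := by
    filter_upwards [h2] with z hz j
    rw [HermitianMetric.metricCoeff, hz, Finset.sum_eq_single j]
    · simp
    · intro i _ hi
      simp [hi]
    · simp
  refine ⟨fun u v => ?_, fun j => ⟨fun w => Complex.normSq (f j (φ j w) * φ' j w), ?_⟩⟩
  · rw [h2.self_of_nhds]
    exact Finset.sum_congr rfl fun j _ => by rw [h3.self_of_nhds]
  · filter_upwards [h3] with z hz using hz j

theorem wirtD_eq_zero_of_eventually_eq {j : Fin n} {F : Cn n → ℂ} {y : Cn n}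
    (hF : DifferentiableAt ℝ F y) {g : ℂ → ℂ} (hg : ∀ᶠ z in 𝓝 y, F z = g (z j))
    {a : Fin n ⊕ Fin n} (ha : a ≠ .inl j) (ha' : a ≠ .inr j) : wirtD a F y = 0 := by
  have key : ∀ i, i ≠ j → ∀ w : ℂ, fderiv ℝ F y (Pi.single i w) = 0 := by
    intro i hi w
    -- Along the line `y + t w e_i` the coordinate `z_j` is fixed, so `F` is constant for small `t`.
    have h1 : HasDerivAt (fun t : ℝ => F (y + t • (Pi.single i w : Cn n))) (fderiv ℝ F y (Pi.single i w)) 0 := by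
      have h2 : HasDerivAt (fun t : ℝ => y + t • (Pi.single i w : Cn n)) (Pi.single i w) 0 := by
        simpa using ((hasDerivAt_id (0 : ℝ)).smul_const (Pi.single i w : Cn n)).const_add y
      have h3 : HasFDerivAt F (fderiv ℝ F y) (y + (0 : ℝ) • (Pi.single i w : Cn n)) := by
        simpa using hF.hasFDerivAt
      exact h3.comp_hasDerivAt 0 h2
    have h4 : Filter.Tendsto (fun t : ℝ => y + t • (Pi.single i w : Cn n)) (𝓝 0) (𝓝 y) := by
      have : Continuous (fun t : ℝ => y + t • (Pi.single i w : Cn n)) := by fun_prop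
      simpa using this.tendsto 0
    have h5 : (fun t : ℝ => F (y + t • (Pi.single i w : Cn n))) =ᶠ[𝓝 0] fun _ => g (y j) := by
      filter_upwards [h4.eventually hg] with t ht
      rw [ht]
      simp [Ne.symm hi]
    exact (h1.unique ((hasDerivAt_const (0 : ℝ) (g (y j))).congr_of_eventuallyEq h5))
  unfold wirtD
  refine Finset.sum_eq_zero fun s _ => ?_
  rcases a with i | i <;>
  · have hi : i ≠ j := fun hh => by simp [hh] at ha ha'
    fin_cases s <;> simp [realIndex, stdFrame, key i hi]

end MetricCoeff

/-! ### Contraction with a coordinate plane -/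

section Contraction

/-- The contraction of an alternating form with `∂/∂x_j` and `∂/∂y_j`. -/
noncomputable def contraction {n : ℕ} (j : Fin n) (k : ℕ) :
    (Cn n [⋀^Fin (k + 2)]→L[ℝ] ℂ) →L[ℝ] Cn n [⋀^Fin k]→L[ℝ] ℂ :=
  ((ContinuousLinearMap.apply ℝ (Cn n [⋀^Fin k]→L[ℝ] ℂ) (Pi.single j Complex.I : Cn n)).comp
    (ContinuousAlternatingMap.curryLeftLI (𝕜 := ℝ) (E := Cn n) (F := ℂ)
      (n := k)).toContinuousLinearMap).comp
  ((ContinuousLinearMap.apply ℝ (Cn n [⋀^Fin (k + 1)]→L[ℝ] ℂ) (Pi.single j 1 : Cn n)).comp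
    (ContinuousAlternatingMap.curryLeftLI (𝕜 := ℝ) (E := Cn n) (F := ℂ)
      (n := k + 1)).toContinuousLinearMap)

theorem contraction_apply {n : ℕ} (j : Fin n) {k : ℕ} (ψ : Cn n [⋀^Fin (k + 2)]→L[ℝ] ℂ) :
    contraction j k ψ = (ψ.curryLeft (Pi.single j 1)).curryLeft (Pi.single j Complex.I) := rfl

theorem curryLeft_curryLeft_self {n k : ℕ} (ψ : Cn n [⋀^Fin (k + 2)]→L[ℝ] ℂ) (u : Cn n) :
    (ψ.curryLeft u).curryLeft u = 0 := by
  ext v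
  exact ψ.map_eq_zero_of_eq _ (i := 0) (j := 1) rfl (by simp)

theorem curryLeft_curryLeft_swap {n k : ℕ} (ψ : Cn n [⋀^Fin (k + 2)]→L[ℝ] ℂ) (u v : Cn n) :
    (ψ.curryLeft v).curryLeft u = -(ψ.curryLeft u).curryLeft v := by
  have h := curryLeft_curryLeft_self ψ (u + v)
  have h1 := curryLeft_curryLeft_self ψ u
  have h2 := curryLeft_curryLeft_self ψ v
  have hc : ∀ a b c : Cn n, (ψ.curryLeft (a + b)).curryLeft c =
      (ψ.curryLeft a).curryLeft c + (ψ.curryLeft b).curryLeft c := fun a b c => by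
    rw [map_add]; rfl
  rw [hc, map_add, map_add, h1, h2, zero_add, add_zero] at h
  exact eq_neg_of_add_eq_zero_right h

/-- The constant comes from `∂/∂z_j ∧ ∂/∂z̄_j = (i/2) ∂/∂x_j ∧ ∂/∂y_j`. -/
theorem formCoeff_contraction {n : ℕ} (j : Fin n) {k : ℕ} (ψ : Cn n [⋀^Fin (k + 2)]→L[ℝ] ℂ)
    (I : Fin k → Fin n ⊕ Fin n) : formCoeff (contraction j k ψ) I =
      -2 * Complex.I * formCoeff ψ (Fin.cons (.inl j) (Fin.cons (.inr j) I)) := by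
  have h : formCoeff ψ (Fin.cons (.inl j) (Fin.cons (.inr j) I)) =
      Complex.I / 2 * formCoeff (contraction j k ψ) I := by
    simp only [formCoeff_cons, Fin.sum_univ_two, wirtCoeff, realIndex, Matrix.cons_val_zero,
      Matrix.cons_val_one, stdFrame, curryLeft_curryLeft_self, formCoeff_zero]
    rw [curryLeft_curryLeft_swap ψ (Pi.single j 1), ← contraction_apply,
      ← neg_one_smul ℂ (contraction j k ψ), formCoeff_smul]
    ring
  rw [h]
  linear_combination formCoeff (contraction j k ψ) I * Complex.I_mul_I

end Contraction

/-! ### Coefficients of smooth forms on `X` and the operators `D_a` -/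

section Coef
variable {n : ℕ} {X : Type*} [TopologicalSpace X] [ChartedSpace (Cn n) X] {k : ℕ}

/-- The coefficients of a form in a chart with respect to `∂/∂z_j`, `∂/∂z̄_j`. -/
noncomputable def coef (e : OpenPartialHomeomorph X (Cn n)) (ψ : smoothForms n X k)
    (I : Fin k → Fin n ⊕ Fin n) (y : Cn n) : ℂ :=
  formCoeff (chartExpr e ψ.1 y) I

theorem chartExpr_add (e : OpenPartialHomeomorph X (Cn n)) (ψ φ : smoothForms n X k) (y : Cn n) :
    chartExpr e (ψ + φ).1 y = chartExpr e ψ.1 y + chartExpr e φ.1 y := by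
  ext v; rfl

theorem chartExpr_smul (e : OpenPartialHomeomorph X (Cn n)) (c : ℂ) (ψ : smoothForms n X k)
    (y : Cn n) : chartExpr e (c • ψ).1 y = c • chartExpr e ψ.1 y := by
  ext v; rfl

theorem chartExpr_zero (e : OpenPartialHomeomorph X (Cn n)) (y : Cn n) :
    chartExpr e (0 : smoothForms n X k).1 y = 0 := by
  ext v; rfl

theorem coef_add (e : OpenPartialHomeomorph X (Cn n)) (ψ φ : smoothForms n X k)
    (I : Fin k → Fin n ⊕ Fin n) (y : Cn n) : coef e (ψ + φ) I y = coef e ψ I y + coef e φ I y := by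
  rw [coef, chartExpr_add, formCoeff_add, coef, coef]

theorem coef_smul (e : OpenPartialHomeomorph X (Cn n)) (c : ℂ) (ψ : smoothForms n X k)
    (I : Fin k → Fin n ⊕ Fin n) (y : Cn n) : coef e (c • ψ) I y = c * coef e ψ I y := by
  rw [coef, chartExpr_smul, formCoeff_smul, coef]

theorem coef_zero (e : OpenPartialHomeomorph X (Cn n))
    (I : Fin k → Fin n ⊕ Fin n) (y : Cn n) : coef e (0 : smoothForms n X k) I y = 0 := by
  rw [coef, chartExpr_zero, formCoeff_zero]

theorem coef_sum (e : OpenPartialHomeomorph X (Cn n)) {ι : Type*} (s : Finset ι)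
    (ψ : ι → smoothForms n X k) (I : Fin k → Fin n ⊕ Fin n) (y : Cn n) :
    coef e (∑ i ∈ s, ψ i) I y = ∑ i ∈ s, coef e (ψ i) I y := by
  classical
  induction s using Finset.induction_on with
  | empty => simp [coef_zero]
  | insert i s hi ih => rw [Finset.sum_insert hi, Finset.sum_insert hi, coef_add, ih]

theorem contDiffOn_coef {e : OpenPartialHomeomorph X (Cn n)} (he : e ∈ atlas (Cn n) X)
    (ψ : smoothForms n X k) (I : Fin k → Fin n ⊕ Fin n) : ContDiffOn ℝ ∞ (coef e ψ I) e.target :=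
  contDiffOn_formCoeff (ψ.2 e he) I

theorem differentiableAt_coef {e : OpenPartialHomeomorph X (Cn n)} (he : e ∈ atlas (Cn n) X)
    (ψ : smoothForms n X k) (I : Fin k → Fin n ⊕ Fin n) {y : Cn n} (hy : y ∈ e.target) :
    DifferentiableAt ℝ (coef e ψ I) y :=
  ((contDiffOn_coef he ψ I).contDiffAt (e.open_target.mem_nhds hy)).differentiableAt (by simp)

theorem wirtD_coef_add {e : OpenPartialHomeomorph X (Cn n)} (he : e ∈ atlas (Cn n) X)
    (a : Fin n ⊕ Fin n) (ψ φ : smoothForms n X k) (I : Fin k → Fin n ⊕ Fin n) {y : Cn n}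
    (hy : y ∈ e.target) :
    wirtD a (coef e (ψ + φ) I) y = wirtD a (coef e ψ I) y + wirtD a (coef e φ I) y := by
  have : coef e (ψ + φ) I = fun y => ∑ b : Bool, coef e (if b then ψ else φ) I y := by
    funext y; simp [coef_add]
  rw [this, wirtD_sum]
  · simp
  · intro b _
    exact differentiableAt_coef he _ I hy

theorem wirtD_coef_smul {e : OpenPartialHomeomorph X (Cn n)} (he : e ∈ atlas (Cn n) X)
    (a : Fin n ⊕ Fin n) (c : ℂ) (ψ : smoothForms n X k) (I : Fin k → Fin n ⊕ Fin n) {y : Cn n}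
    (hy : y ∈ e.target) : wirtD a (coef e (c • ψ) I) y = c * wirtD a (coef e ψ I) y := by
  rw [← wirtD_const_mul a c (differentiableAt_coef he _ I hy)]
  congr 1
  funext y
  exact coef_smul e c ψ I y

variable [HasGroupoid X (rigidGroupoid n)]

/-- The differential of the inverse chart is surjective, so pulling back by it loses no information.
-/
theorem chartExpr_eq_iff (ψ φ : RawForm n X k) {e : OpenPartialHomeomorph X (Cn n)}
    (he : e ∈ atlas (Cn n) X) {y : Cn n} (hy : y ∈ e.target) :
    chartExpr e ψ y = chartExpr e φ y ↔ ψ (e.symm y) = φ (e.symm y) := by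
  have D := mdifferentiable_of_rigid ((rigidGroupoid n).subset_maximalAtlas he)
  constructor
  · intro h
    ext v
    choose w hw using fun i => D.symm.mfderiv_surjective (x := y) hy (v i)
    have := congrArg (fun L => L w) h
    have h2 : v = fun i => mfderiv 𝓘(ℝ, Cn n) 𝓘(ℝ, Cn n) e.symm y (w i) :=
      funext fun i => (hw i).symm
    rw [h2]
    exact this
  · intro h
    rw [chartExpr, h, chartExpr]

theorem smoothForms_ext {ψ φ : smoothForms n X k} (h : ∀ e ∈ atlas (Cn n) X, ∀ y ∈ e.target,
    ∀ I, coef e ψ I y = coef e φ I y) : ψ = φ := by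
  ext1
  funext x
  have hx := mem_chart_source (Cn n) x
  have hy := (chartAt (Cn n) x).map_source hx
  have h1 := (chartExpr_eq_iff ψ.1 φ.1 (chart_mem_atlas (Cn n) x) hy).1
    (formCoeff_ext fun I => h _ (chart_mem_atlas _ _) _ hy I)
  rwa [(chartAt (Cn n) x).left_inv hx] at h1

theorem chartExpr_extD {e : OpenPartialHomeomorph X (Cn n)} (he : e ∈ atlas (Cn n) X)
    (ψ : smoothForms n X k) {y : Cn n} (hy : y ∈ e.target) :
    chartExpr e (extD k ψ).1 y = extDeriv (chartExpr e ψ.1) y :=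
  chartExpr_ofLocal extDeriv (fun _ _ _ h => h.extDeriv_eq)
    (fun _ _ _ hτ _ hη => extDeriv_pullback (hη.differentiableAt (by simp))
      (hτ.of_le (m := 2) (WithTop.coe_le_coe.2 (le_top : (2 : ℕ∞) ≤ ⊤))) (by simp)) ψ.2 he hy

theorem chartExpr_typeProj {e : OpenPartialHomeomorph X (Cn n)} (he : e ∈ atlas (Cn n) X)
    (α β : Fin n → Fin 2) (ψ : smoothForms n X k) {y : Cn n} (hy : y ∈ e.target) :
    chartExpr e (typeProj α β ψ).1 y = typePart α β (chartExpr e ψ.1 y) :=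
  chartExpr_ofLocal (fun η y => typePart α β (η y)) (fun _ _ _ h => by simp only [h.self_of_nhds])
    (fun _ _ _ _ ⟨c, hc⟩ _ => typePart_comp _ c hc α β _) ψ.2 he hy

theorem coef_extD {e : OpenPartialHomeomorph X (Cn n)} (he : e ∈ atlas (Cn n) X)
    (ψ : smoothForms n X k) (J : Fin (k + 1) → Fin n ⊕ Fin n) {y : Cn n} (hy : y ∈ e.target) :
    coef e (extD k ψ) J y = ∑ i : Fin (k + 1), (-1) ^ (i : ℕ) *
      wirtD (J i) (coef e ψ (i.removeNth J)) y := by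
  rw [coef, chartExpr_extD he ψ hy, formCoeff_extDeriv]
  · rfl
  · exact ((ψ.2 e he).contDiffAt (e.open_target.mem_nhds hy)).differentiableAt (by simp)

theorem coef_typeProj_extD_typeProj {e : OpenPartialHomeomorph X (Cn n)} (he : e ∈ atlas (Cn n) X)
    (α β α' β' : Fin n → Fin 2) (ψ : smoothForms n X k) (J : Fin (k + 1) → Fin n ⊕ Fin n)
    {y : Cn n} (hy : y ∈ e.target) :
    coef e (typeProj α' β' (extD k (typeProj α β ψ))) J y = formCoeff (typePart α' β'
      (extDeriv (fun z => typePart α β (chartExpr e ψ.1 z)) y)) J := by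
  have h : chartExpr e (typeProj α β ψ).1 =ᶠ[𝓝 y] fun z => typePart α β (chartExpr e ψ.1 z) :=
    Filter.eventually_of_mem (e.open_target.mem_nhds hy) fun z hz => chartExpr_typeProj he α β ψ hz
  rw [coef, chartExpr_typeProj he _ _ _ hy, chartExpr_extD he _ hy, h.extDeriv_eq]

/-- The operator which on forms of type `(α, β)` is `d` followed by the projection to the forms of
type `(α, β + 1_j)`. -/
noncomputable def xiBar (j : Fin n) (k : ℕ) (ψ : smoothForms n X k) : smoothForms n X (k + 1) :=
  ∑ α : Fin n → Fin 2, ∑ β : Fin n → Fin 2 with β j = 0,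
    typeProj α (Function.update β j 1) (extD k (typeProj α β ψ))

/-- The components `ξ_j` (`inl j`) and `ξ̄_j` (`inr j`) of the exterior derivative. -/
noncomputable def partialD : Fin n ⊕ Fin n → ∀ k, smoothForms n X k → smoothForms n X (k + 1)
  | .inl j => xi j
  | .inr j => xiBar j

/-- The double projection in the definition of `ξ_j` amounts to keeping those terms of `d` that
differentiate in the direction `a`. The later computations with `D_a` rest on this formula. -/
theorem coef_partialD {e : OpenPartialHomeomorph X (Cn n)} (he : e ∈ atlas (Cn n) X)
    (a : Fin n ⊕ Fin n) (ψ : smoothForms n X k) (J : Fin (k + 1) → Fin n ⊕ Fin n) {y : Cn n}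
    (hy : y ∈ e.target) : coef e (partialD a k ψ) J y = ∑ i : Fin (k + 1),
      if J i = a then (-1) ^ (i : ℕ) * wirtD a (coef e ψ (i.removeNth J)) y else 0 := by
  have key : coef e (partialD a k ψ) J y = ∑ i : Fin (k + 1),
      if J i = a then (-1) ^ (i : ℕ) * wirtD (J i) (coef e ψ (i.removeNth J)) y else 0 := by
    rcases a with j | j
    · simp only [partialD, xi, coef_sum, coef_typeProj_extD_typeProj he _ _ _ _ _ _ hy]
      exact sum_left_formCoeff_typePart e.open_target (ψ.2 e he) hy j J
    · simp only [partialD, xiBar, coef_sum, coef_typeProj_extD_typeProj he _ _ _ _ _ _ hy]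
      exact sum_right_formCoeff_typePart e.open_target (ψ.2 e he) hy j J
  rw [key]
  refine Finset.sum_congr rfl fun i _ => ?_
  split_ifs with h
  · rw [h]
  · rfl

/-- `partialD` as a linear map. -/
noncomputable def partialDL (a : Fin n ⊕ Fin n) (k : ℕ) :
    smoothForms n X k →ₗ[ℂ] smoothForms n X (k + 1) where
  toFun := partialD a k
  map_add' ψ φ := smoothForms_ext fun e he y hy J => by
    simp only [coef_add, coef_partialD he a _ J hy, wirtD_coef_add he a _ _ _ hy, mul_add,
      ← Finset.sum_add_distrib]
    exact Finset.sum_congr rfl fun i _ => by split_ifs <;> simp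
  map_smul' c ψ := smoothForms_ext fun e he y hy J => by
    simp only [RingHom.id_apply, coef_smul, coef_partialD he a _ J hy, wirtD_coef_smul he a _ _ _ hy,
      Finset.mul_sum]
    exact Finset.sum_congr rfl fun i _ => by split_ifs <;> ring

theorem coef_partialDL {e : OpenPartialHomeomorph X (Cn n)} (he : e ∈ atlas (Cn n) X)
    (a : Fin n ⊕ Fin n) (ψ : smoothForms n X k) (J : Fin (k + 1) → Fin n ⊕ Fin n) {y : Cn n}
    (hy : y ∈ e.target) : coef e (partialDL a k ψ) J y = ∑ i : Fin (k + 1),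
      if J i = a then (-1) ^ (i : ℕ) * wirtD a (coef e ψ (i.removeNth J)) y else 0 :=
  coef_partialD he a ψ J hy

/-- Every term of `d` differentiates in the direction `J i`, hence belongs to exactly one `D_a`. -/
theorem extD_eq_sum (ψ : smoothForms n X k) : extD k ψ = ∑ a, partialDL a k ψ := by
  refine smoothForms_ext fun e he y hy J => ?_
  rw [coef_extD he ψ J hy, coef_sum]
  simp_rw [coef_partialDL he _ ψ J hy]
  rw [Finset.sum_comm]
  simp

/-- `ξ_a ξ_b + ξ_b ξ_a = 0`. -/
theorem partialDL_anticomm (a b : Fin n ⊕ Fin n) (ψ : smoothForms n X k) :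
    partialDL a (k + 1) (partialDL b k ψ) + partialDL b (k + 1) (partialDL a k ψ) = 0 := by
  refine smoothForms_ext fun e he y hy J => ?_
  have key : ∀ a b : Fin n ⊕ Fin n, coef e (partialDL a (k + 1) (partialDL b k ψ)) J y =
      ∑ i : Fin (k + 2), ∑ l : Fin (k + 1), (-1) ^ (i : ℕ) * ((-1) ^ (l : ℕ) *
        ((if J i = a ∧ i.removeNth J l = b then 1 else 0) *
          wirtD a (wirtD b (coef e ψ (l.removeNth (i.removeNth J)))) y)) := by
    intro a b
    rw [coef_partialDL he _ _ _ hy]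
    refine Finset.sum_congr rfl fun i _ => ?_
    have h1 : coef e (partialDL b k ψ) (i.removeNth J) =ᶠ[𝓝 y] fun z => ∑ l : Fin (k + 1),
        (if i.removeNth J l = b then (-1) ^ (l : ℕ) else 0) *
          wirtD b (coef e ψ (l.removeNth (i.removeNth J))) z := by
      filter_upwards [e.open_target.mem_nhds hy] with z hz
      rw [coef_partialDL he _ _ _ hz]
      exact Finset.sum_congr rfl fun l _ => by split_ifs <;> simp
    have h2 : ∀ I : Fin k → Fin n ⊕ Fin n, DifferentiableAt ℝ (wirtD b (coef e ψ I)) y := fun I =>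
      ((contDiffOn_wirtD b e.open_target (contDiffOn_coef he ψ I)).contDiffAt
        (e.open_target.mem_nhds hy)).differentiableAt (by simp)
    rw [wirtD_congr a h1, wirtD_sum a _ fun l _ => (h2 _).const_mul _]
    simp_rw [wirtD_const_mul a _ (h2 _)]
    by_cases hi : J i = a
    · simp only [hi, if_true, true_and, Finset.mul_sum]
      refine Finset.sum_congr rfl fun l _ => ?_
      split_ifs <;> simp
    · simp [hi]
  rw [coef_add, coef_zero, key, key, ← Finset.sum_add_distrib]
  simp_rw [← Finset.sum_add_distrib, ← mul_add]
  -- Since `∂_a` and `∂_b` commute, both compositions involve the same second derivative, and the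
  -- sum of their indicator factors is symmetric in the two removed entries.
  refine Eq.trans ?_ (sum_sum_removeNth_eq_zero J (fun x y => (if x = a ∧ y = b then 1 else 0) +
    (if x = b ∧ y = a then 1 else 0)) (fun x y => by
      rw [add_comm]; simp only [and_comm]) fun I => wirtD a (wirtD b (coef e ψ I)) y)
  refine Finset.sum_congr rfl fun i _ => Finset.sum_congr rfl fun l _ => ?_
  rw [wirtD_comm b a ((contDiffOn_coef he ψ _).contDiffAt (e.open_target.mem_nhds hy)), ← add_mul]

end Coef

/-! ### The operators `Λ_j` -/

section Lefschetz
variable {n : ℕ} {X : Type*} [TopologicalSpace X] [ChartedSpace (Cn n) X] {k : ℕ}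
  [HasGroupoid X (rigidGroupoid n)]

theorem HermitianMetric.IsSplit.metricCoeff_eq {h : HermitianMetric n X} (hs : h.IsSplit)
    {e e' : OpenPartialHomeomorph X (Cn n)} (he : e ∈ atlas (Cn n) X) (he' : e' ∈ atlas (Cn n) X)
    {y : Cn n} (hy : y ∈ (e.symm ≫ₕ e').source) {c : Fin n → ℂ}
    (hc : ∀ v : Cn n, fderiv ℝ (e.symm ≫ₕ e') y v = fun j => c j * v j) (j : Fin n) :
    h.metricCoeff e j y = Complex.normSq (c j) * h.metricCoeff e' j ((e.symm ≫ₕ e') y) := by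
  conv_lhs => rw [HermitianMetric.metricCoeff]
  rw [h.inChart_eq ((rigidGroupoid n).subset_maximalAtlas he)
    ((rigidGroupoid n).subset_maximalAtlas he') hy,
    (hs e' he' _ ((e.symm ≫ₕ e').map_source hy).1).1, hc, Finset.sum_eq_single j]
  · simp only [Pi.single_eq_same, mul_one]
    rw [← starRingEnd_apply, Complex.mul_conj, ← Complex.ofReal_mul, Complex.ofReal_re, mul_comm]
  · intro i _ hi
    simp [hi]
  · simp

/-- The operator `Λ_j`, the adjoint of the exterior product with the `j`-th summand of the Kähler
form. -/
noncomputable def lefschetzRaw (h : HermitianMetric n X) (j : Fin n) (k : ℕ)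
    (ψ : RawForm n X (k + 2)) : RawForm n X k :=
  ofLocal fun x y => (((h.metricCoeff (chartAt (Cn n) x) j y)⁻¹ : ℝ) : ℂ) •
    contraction j k (chartExpr (chartAt (Cn n) x) ψ y)

/-- Under a change of chart with diagonal differential `c`, the contraction and `H_j` are both
multiplied by `|c_j|²`, so their quotient does not depend on the chart. -/
theorem chartExpr_lefschetzRaw {h : HermitianMetric n X} (hs : h.IsSplit) (j : Fin n)
    (ψ : RawForm n X (k + 2)) {e : OpenPartialHomeomorph X (Cn n)} (he : e ∈ atlas (Cn n) X)
    {y : Cn n} (hy : y ∈ e.target) : chartExpr e (lefschetzRaw h j k ψ) y =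
      (((h.metricCoeff e j y)⁻¹ : ℝ) : ℂ) • contraction j k (chartExpr e ψ y) := by
  have : IsManifold 𝓘(ℝ, Cn n) ∞ X := isManifold_of_rigid
  have hc := chart_mem_atlas (Cn n) (e.symm y)
  have hy' : y ∈ (e.symm ≫ₕ chartAt (Cn n) (e.symm y)).source :=
    mem_transition_source.2 ⟨hy, mem_chart_source _ _⟩
  obtain ⟨c, hL⟩ := exists_fderiv_transition_eq ((rigidGroupoid n).subset_maximalAtlas he)
    ((rigidGroupoid n).subset_maximalAtlas hc) hy'
  have hm := hs.metricCoeff_eq he hc hy' hL j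
  have hpos := h.metricCoeff_pos he j hy
  rw [lefschetzRaw, chartExpr_ofLocal_eq _ he hy, chartExpr_eq he hc ψ hy']
  refine formCoeff_ext fun I => ?_
  rw [formCoeff_comp _ c hL, formCoeff_smul, formCoeff_smul, formCoeff_contraction,
    formCoeff_contraction, formCoeff_comp _ c hL, Fin.prod_univ_succ, Fin.prod_univ_succ]
  simp only [Fin.cons_zero, Fin.cons_succ, diagFactor]
  have h1 : (((h.metricCoeff e j y)⁻¹ : ℝ) : ℂ) * (c j * star (c j)) =
      (((h.metricCoeff (chartAt (Cn n) (e.symm y)) j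
        ((e.symm ≫ₕ chartAt (Cn n) (e.symm y)) y))⁻¹ : ℝ) : ℂ) := by
    rw [← starRingEnd_apply, Complex.mul_conj, hm]
    rw [hm] at hpos
    have h2 := left_ne_zero_of_mul hpos.ne'
    have h3 := right_ne_zero_of_mul hpos.ne'
    rw [← Complex.ofReal_mul]
    congr 1
    field_simp
  rw [← h1]
  ring

/-- `lefschetzRaw` on smooth forms. -/
noncomputable def lefschetz {h : HermitianMetric n X} (hs : h.IsSplit) (j : Fin n) (k : ℕ) :
    smoothForms n X (k + 2) →ₗ[ℂ] smoothForms n X k where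
  toFun ψ := ⟨lefschetzRaw h j k ψ.1, fun e he => by
    refine ContDiffOn.congr ?_ fun y hy => chartExpr_lefschetzRaw hs j ψ.1 he hy
    refine ContDiffOn.smul (𝕜' := ℂ) ?_ ((contraction j k).contDiff.comp_contDiffOn (ψ.2 e he))
    exact Complex.ofRealCLM.contDiff.comp_contDiffOn
      ((h.contDiffOn_metricCoeff he j).inv fun y hy => (h.metricCoeff_pos he j hy).ne')⟩
  map_add' ψ φ := smoothForms_ext fun e he y hy J => by
    rw [coef_add]
    simp only [coef, chartExpr_lefschetzRaw hs j _ he hy]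
    rw [chartExpr_add, map_add, smul_add, formCoeff_add]
  map_smul' c ψ := smoothForms_ext fun e he y hy J => by
    rw [coef_smul]
    simp only [coef, chartExpr_lefschetzRaw hs j _ he hy, RingHom.id_apply]
    rw [chartExpr_smul, formCoeff_smul, formCoeff_smul, formCoeff_contraction,
      formCoeff_contraction, formCoeff_smul]
    ring

theorem coef_lefschetz {h : HermitianMetric n X} (hs : h.IsSplit) (j : Fin n)
    (ψ : smoothForms n X (k + 2)) {e : OpenPartialHomeomorph X (Cn n)} (he : e ∈ atlas (Cn n) X)
    (I : Fin k → Fin n ⊕ Fin n) {y : Cn n} (hy : y ∈ e.target) :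
    coef e (lefschetz hs j k ψ) I y = -2 * Complex.I * ((h.metricCoeff e j y)⁻¹ : ℝ) *
      coef e ψ (Fin.cons (.inl j) (Fin.cons (.inr j) I)) y := by
  change formCoeff (chartExpr e (lefschetzRaw h j k ψ.1) y) I = _
  rw [chartExpr_lefschetzRaw hs j _ he hy, formCoeff_smul, formCoeff_contraction, coef]
  ring

end Lefschetz

/-! ### Graded algebra: from the Kähler identities to the Laplacians -/

section GradedAlgebra
variable {n : ℕ} {V : ℕ → Type*} [∀ k, AddCommGroup (V k)] [∀ k, Module ℂ (V k)]

/-- The constants in the Kähler identities `ξ_j^* = i [Λ_j, ξ̄_j]` and `ξ̄_j^* = -i [Λ_j, ξ_j]`. -/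
noncomputable def kaehlerSign : Fin n ⊕ Fin n → ℂ
  | .inl _ => Complex.I
  | .inr _ => -Complex.I

/-- The underlying coordinate index. -/
def coordIndex : Fin n ⊕ Fin n → Fin n := Sum.elim id id

variable (D : Fin n ⊕ Fin n → ∀ k, V k →ₗ[ℂ] V (k + 1)) (L : Fin n → ∀ k, V (k + 2) →ₗ[ℂ] V k)

/-- The operator `± i [L_j, D_ā]`, where `j` is the coordinate index of `a`. -/
noncomputable def kaehlerAdjoint (a : Fin n ⊕ Fin n) : ∀ k, V (k + 1) →ₗ[ℂ] V k
  | 0 => kaehlerSign a • (L (coordIndex a) 0).comp (D a.swap 1)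
  | k + 1 => kaehlerSign a • ((L (coordIndex a) (k + 1)).comp (D a.swap (k + 2)) -
      (D a.swap k).comp (L (coordIndex a) k))

/-- The anticommutator of `D_a` and `kaehlerAdjoint D L b`. -/
noncomputable def kaehlerAnticomm (a b : Fin n ⊕ Fin n) : ∀ k, V k →ₗ[ℂ] V k
  | 0 => (kaehlerAdjoint D L b 0).comp (D a 0)
  | k + 1 => (D a k).comp (kaehlerAdjoint D L b k) + (kaehlerAdjoint D L b (k + 1)).comp (D a (k + 1))

theorem kaehlerAdjoint_succ_apply (a : Fin n ⊕ Fin n) (k : ℕ) (ψ : V (k + 2)) :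
    kaehlerAdjoint D L a (k + 1) ψ = kaehlerSign a • L (coordIndex a) (k + 1) (D a.swap (k + 2) ψ) +
      (-1 : ℂ) • D a.swap k (kaehlerSign a • L (coordIndex a) k ψ) := by
  simp only [kaehlerAdjoint, LinearMap.smul_apply, LinearMap.sub_apply, LinearMap.comp_apply,
    map_smul]
  module

variable {D L}

/-- With `a = z_j`, expanding gives `{D_a, i[Λ, D_ā]} = i(D_a Λ D_ā - D_a D_ā Λ + Λ D_ā D_a - D_ā Λ
D_a)`. Exchanging `a` with `ā` and `i` with `-i` returns the same four terms, because `D_ā D_a =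
-D_a D_ā`. -/
theorem kaehlerAnticomm_swap
    (hD : ∀ a b k (ψ : V k), D a (k + 1) (D b k ψ) + D b (k + 1) (D a k ψ) = 0) (j : Fin n) (k : ℕ) (ψ : V k) :
    kaehlerAnticomm D L (.inr j) (.inr j) k ψ = kaehlerAnticomm D L (.inl j) (.inl j) k ψ := by
  have h : ∀ k (ψ : V k), D (.inr j) (k + 1) (D (.inl j) k ψ) =
      -D (.inl j) (k + 1) (D (.inr j) k ψ) := fun k ψ =>
    eq_neg_of_add_eq_zero_left (hD _ _ k ψ)
  -- `Λ_j` lowers the degree by two and so is absent on forms of degree `0` and `1`; there some of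
  -- the four terms are missing.
  match k with
  | 0 => simp [kaehlerAnticomm, kaehlerAdjoint, kaehlerSign, coordIndex, h]
  | 1 =>
    simp [kaehlerAnticomm, kaehlerAdjoint, kaehlerSign, coordIndex, h]
    module
  | k + 2 =>
    simp [kaehlerAnticomm, kaehlerAdjoint, kaehlerSign, coordIndex, h]
    module

/-- If `a = b̄`, then `D_b^*` is a multiple of `[Λ, D_a]`; in its anticommutator with `D_a` the
terms `D_a Λ D_a` cancel and the others contain `D_a² = 0`. If `a` belongs to another variable than
`b`, then `D_a` commutes with `Λ` and anticommutes with `D_b̄`, hence anticommutes with `[Λ, D_b̄]`.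
-/
theorem kaehlerAnticomm_eq_zero
    (hD : ∀ a b k (ψ : V k), D a (k + 1) (D b k ψ) + D b (k + 1) (D a k ψ) = 0)
    (hL : ∀ j a k (ψ : V (k + 2)), a ≠ .inl j → a ≠ .inr j →
      L j (k + 1) (D a (k + 2) ψ) = D a k (L j k ψ))
    (hL1 : ∀ j a (ψ : V 1), a ≠ .inl j → a ≠ .inr j → L j 0 (D a 1 ψ) = 0)
    {a b : Fin n ⊕ Fin n} (hab : a ≠ b) (k : ℕ) (ψ : V k) :
    kaehlerAnticomm D L a b k ψ = 0 := by
  by_cases h : b.swap = a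
  · subst h
    have h2 : ∀ k (ψ : V k), D b.swap (k + 1) (D b.swap k ψ) = 0 := fun k ψ => by
      have := hD b.swap b.swap k ψ
      rw [← two_smul ℂ] at this
      simpa using this
    match k with
    | 0 => simp [kaehlerAnticomm, kaehlerAdjoint, h2]
    | 1 => simp [kaehlerAnticomm, kaehlerAdjoint, h2]
    | k + 2 => simp [kaehlerAnticomm, kaehlerAdjoint, h2]
  · have ha : a ≠ .inl (coordIndex b) ∧ a ≠ .inr (coordIndex b) := by
      rcases b with j | j
      · exact ⟨hab, fun h' => h h'.symm⟩
      · exact ⟨fun h' => h h'.symm, hab⟩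
    have h2 : ∀ k (ψ : V k), D b.swap (k + 1) (D a k ψ) = -D a (k + 1) (D b.swap k ψ) :=
      fun k ψ => eq_neg_of_add_eq_zero_left (hD _ _ k ψ)
    have h3 := fun k (ψ : V (k + 2)) => hL (coordIndex b) a k ψ ha.1 ha.2
    have h4 := fun (ψ : V 1) => hL1 (coordIndex b) a ψ ha.1 ha.2
    match k with
    | 0 => simp [kaehlerAnticomm, kaehlerAdjoint, h2, h4]
    | 1 => simp [kaehlerAnticomm, kaehlerAdjoint, h2, h3, h4]
    | k + 2 =>
      simp [kaehlerAnticomm, kaehlerAdjoint, h2, h3]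
      module

theorem sum_kaehlerAnticomm
    (hD : ∀ a b k (ψ : V k), D a (k + 1) (D b k ψ) + D b (k + 1) (D a k ψ) = 0)
    (hL : ∀ j a k (ψ : V (k + 2)), a ≠ .inl j → a ≠ .inr j →
      L j (k + 1) (D a (k + 2) ψ) = D a k (L j k ψ))
    (hL1 : ∀ j a (ψ : V 1), a ≠ .inl j → a ≠ .inr j → L j 0 (D a 1 ψ) = 0)
    (k : ℕ) (ψ : V k) :
    ∑ a, ∑ b, kaehlerAnticomm D L a b k ψ =
      (2 : ℂ) • ∑ j, kaehlerAnticomm D L (.inl j) (.inl j) k ψ := by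
  have h : ∀ a, ∑ b, kaehlerAnticomm D L a b k ψ = kaehlerAnticomm D L a a k ψ := fun a =>
    Finset.sum_eq_single a (fun b _ hb => kaehlerAnticomm_eq_zero hD hL hL1 hb.symm k ψ) (by simp)
  simp_rw [h, Fintype.sum_sum_type, kaehlerAnticomm_swap hD, two_smul]

end GradedAlgebra

/-! ### Commutators of `Λ_j` with `D_a`, and the coordinate form of the Kähler identities -/

section Commutator
variable {n : ℕ} {X : Type*} [TopologicalSpace X] [ChartedSpace (Cn n) X] {k : ℕ}
  [HasGroupoid X (rigidGroupoid n)] {h : HermitianMetric n X} (hs : h.IsSplit)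

theorem removeNth_succ_cons {ι : Type*} {k : ℕ} (i : Fin (k + 1)) (a : ι) (I : Fin (k + 1) → ι) :
    i.succ.removeNth (Fin.cons a I : Fin (k + 2) → ι) = Fin.cons a (i.removeNth I) := by
  ext l
  refine Fin.cases ?_ (fun l => ?_) l <;> simp [Fin.removeNth_apply]

theorem removeNth_zero_cons {ι : Type*} {k : ℕ} (a : ι) (I : Fin k → ι) :
    (0 : Fin (k + 1)).removeNth (Fin.cons a I : Fin (k + 1) → ι) = I := by
  ext l; simp [Fin.removeNth_apply]

theorem removeNth_one_cons_cons {ι : Type*} {k : ℕ} (a b : ι) (I : Fin k → ι) :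
    (1 : Fin (k + 2)).removeNth (Fin.cons a (Fin.cons b I : Fin (k + 1) → ι) : Fin (k + 2) → ι) =
      Fin.cons a I := by
  have := removeNth_succ_cons 0 a (Fin.cons b I : Fin (k + 1) → ι)
  rwa [removeNth_zero_cons] at this

theorem HermitianMetric.contDiffOn_inv_metricCoeff (h : HermitianMetric n X)
    {e : OpenPartialHomeomorph X (Cn n)} (he : e ∈ atlas (Cn n) X) (j : Fin n) :
    ContDiffOn ℝ ∞ (fun z => (((h.metricCoeff e j z)⁻¹ : ℝ) : ℂ)) e.target :=
  Complex.ofRealCLM.contDiff.comp_contDiffOn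
    ((h.contDiffOn_metricCoeff he j).inv fun _ hy => (h.metricCoeff_pos he j hy).ne')

theorem formCoeff_cons_cons_swap (ψ : Cn n [⋀^Fin (k + 2)]→L[ℝ] ℂ) (a b : Fin n ⊕ Fin n)
    (I : Fin k → Fin n ⊕ Fin n) :
    formCoeff ψ (Fin.cons a (Fin.cons b I)) = -formCoeff ψ (Fin.cons b (Fin.cons a I)) := by
  have := formCoeff_insertNth ψ 1 b (Fin.cons a I)
  rw [Fin.val_one, pow_one, neg_one_mul] at this
  rw [← this]
  congr 1
  rw [Fin.eq_insertNth_iff]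
  exact ⟨rfl, removeNth_one_cons_cons a b I⟩

theorem formCoeff_cons_insertNth (ψ : Cn n [⋀^Fin (k + 2)]→L[ℝ] ℂ) (a b : Fin n ⊕ Fin n)
    (i : Fin (k + 1)) (I : Fin k → Fin n ⊕ Fin n) :
    formCoeff ψ (Fin.cons a (i.insertNth b I)) =
      (-1) ^ (i : ℕ) * formCoeff ψ (Fin.cons a (Fin.cons b I)) := by
  rw [formCoeff_cons, formCoeff_cons, Finset.mul_sum]
  refine Finset.sum_congr rfl fun s _ => ?_
  rw [formCoeff_insertNth]
  ring

theorem coef_partialDL_cons_cons (a b c : Fin n ⊕ Fin n) (ψ : smoothForms n X (k + 1))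
    {e : OpenPartialHomeomorph X (Cn n)} (he : e ∈ atlas (Cn n) X)
    (I : Fin k → Fin n ⊕ Fin n) {y : Cn n} (hy : y ∈ e.target) :
    coef e (partialDL a (k + 1) ψ) (Fin.cons b (Fin.cons c I)) y =
      (if b = a then wirtD a (coef e ψ (Fin.cons c I)) y else 0) -
      (if c = a then wirtD a (coef e ψ (Fin.cons b I)) y else 0) +
      ∑ i : Fin k, if I i = a then (-1) ^ (i : ℕ) * wirtD a (coef e ψ
        (i.succ.succ.removeNth
          (Fin.cons b (Fin.cons c I : Fin (k + 1) → Fin n ⊕ Fin n) : Fin (k + 2) → Fin n ⊕ Fin n))) y else 0 := by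
  have h1 : (Fin.cons b (Fin.cons c I : Fin (k + 1) → Fin n ⊕ Fin n) :
    Fin (k + 2) → Fin n ⊕ Fin n) 1 = c := rfl
  rw [coef_partialDL he a _ _ hy, Fin.sum_univ_succ, Fin.sum_univ_succ]
  simp only [Fin.cons_zero, Fin.cons_succ, removeNth_zero_cons, Fin.val_zero, pow_zero, one_mul,
    Fin.succ_zero_eq_one, removeNth_one_cons_cons, h1, Fin.val_one, Fin.val_succ, pow_succ,
    mul_neg, mul_one, neg_neg, neg_mul]
  split_ifs <;> ring

theorem HermitianMetric.IsSplit.wirtD_inv_metricCoeff {h : HermitianMetric n X} (hs : h.IsSplit)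
    {e : OpenPartialHomeomorph X (Cn n)} (he : e ∈ atlas (Cn n) X) {j : Fin n} {a : Fin n ⊕ Fin n}
    (ha : a ≠ .inl j) (ha' : a ≠ .inr j) {y : Cn n} (hy : y ∈ e.target) :
    wirtD a (fun z => (((h.metricCoeff e j z)⁻¹ : ℝ) : ℂ)) y = 0 := by
  obtain ⟨g, hg⟩ := (hs e he y hy).2 j
  refine wirtD_eq_zero_of_eventually_eq (j := j) (g := fun w => (((g w)⁻¹ : ℝ) : ℂ)) ?_ ?_ ha ha'
  · exact (h.contDiffOn_inv_metricCoeff he j |>.contDiffAt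
      (e.open_target.mem_nhds hy)).differentiableAt (by simp)
  · filter_upwards [hg] with z hz
    rw [hz]

theorem wirtD_lefschetz (j : Fin n) (a : Fin n ⊕ Fin n) (ψ : smoothForms n X (k + 2))
    {e : OpenPartialHomeomorph X (Cn n)} (he : e ∈ atlas (Cn n) X)
    (I : Fin k → Fin n ⊕ Fin n) {y : Cn n} (hy : y ∈ e.target) :
    wirtD a (coef e (lefschetz hs j k ψ) I) y = -2 * Complex.I *
      (wirtD a (fun z => (((h.metricCoeff e j z)⁻¹ : ℝ) : ℂ)) y *
        coef e ψ (Fin.cons (.inl j) (Fin.cons (.inr j) I)) y +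
      ((h.metricCoeff e j y)⁻¹ : ℝ) *
        wirtD a (coef e ψ (Fin.cons (.inl j) (Fin.cons (.inr j) I))) y) := by
  have hd := (h.contDiffOn_inv_metricCoeff he j |>.contDiffAt
    (e.open_target.mem_nhds hy)).differentiableAt (by simp)
  rw [← wirtD_mul _ hd (differentiableAt_coef he _ _ hy),
    ← wirtD_const_mul _ _ (hd.fun_mul (differentiableAt_coef he _ _ hy))]
  refine wirtD_congr _ ?_
  filter_upwards [e.open_target.mem_nhds hy] with z hz
  rw [coef_lefschetz hs j _ he _ hz, mul_assoc]

/-- `D_a` neither differentiates along the two contracted slots, which are `z_j` and `z̄_j`, nor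
sees the factor `1/H_j`, which depends on `z_j` only. -/
theorem lefschetz_partialDL_comm (j : Fin n) {a : Fin n ⊕ Fin n} (ha : a ≠ .inl j) (ha' : a ≠ .inr j)
    (ψ : smoothForms n X (k + 2)) :
    lefschetz hs j (k + 1) (partialDL a (k + 2) ψ) = partialDL a k (lefschetz hs j k ψ) := by
  refine smoothForms_ext fun e he y hy I => ?_
  rw [coef_lefschetz hs j _ he _ hy, coef_partialDL_cons_cons _ _ _ _ he _ hy,
    if_neg ha.symm, if_neg ha'.symm, coef_partialDL he _ _ _ hy, sub_self, zero_add, Finset.mul_sum]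
  refine Finset.sum_congr rfl fun i _ => ?_
  split_ifs with hi
  · rw [wirtD_lefschetz hs j a ψ he _ hy, hs.wirtD_inv_metricCoeff he ha ha' hy,
      removeNth_succ_cons, removeNth_succ_cons]
    ring
  · simp

/-- The same commutation in the lowest degree, where `Λ_j` of a `1`-form is zero. -/
theorem lefschetz_partialDL_eq_zero (j : Fin n) {a : Fin n ⊕ Fin n} (ha : a ≠ .inl j)
    (ha' : a ≠ .inr j) (ψ : smoothForms n X 1) : lefschetz hs j 0 (partialDL a 1 ψ) = 0 := by
  refine smoothForms_ext fun e he y hy I => ?_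
  rw [coef_lefschetz hs j _ he _ hy, coef_partialDL_cons_cons _ _ _ _ he _ hy,
    if_neg ha.symm, if_neg ha'.symm, coef_zero]
  simp

/-- The adjoint of `partialDL a`. -/
noncomputable def partialAdj (a : Fin n ⊕ Fin n) (k : ℕ) :
    smoothForms n X (k + 1) →ₗ[ℂ] smoothForms n X k :=
  kaehlerAdjoint (V := fun k => smoothForms n X k) partialDL (lefschetz hs) a k

/-- The signs `±i` make the formula uniform in `a`: `i · (-2i) = 2`, and for `a = z̄_j` the opposite
sign compensates for exchanging the two contracted slots. -/
theorem kaehlerSign_mul_coef_lefschetz (a : Fin n ⊕ Fin n) (ψ : smoothForms n X (k + 2))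
    {e : OpenPartialHomeomorph X (Cn n)} (he : e ∈ atlas (Cn n) X)
    (I : Fin k → Fin n ⊕ Fin n) {y : Cn n} (hy : y ∈ e.target) :
    kaehlerSign a * coef e (lefschetz hs (coordIndex a) k ψ) I y =
      2 * ((h.metricCoeff e (coordIndex a) y)⁻¹ : ℝ) *
        coef e ψ (Fin.cons a (Fin.cons a.swap I)) y := by
  rw [coef_lefschetz hs _ _ he _ hy]
  rcases a with j | j
  · simp only [kaehlerSign, coordIndex, Sum.elim_inl, id_eq, Sum.swap_inl]
    linear_combination -2 * ((h.metricCoeff e j y)⁻¹ : ℝ) *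
      coef e ψ (Fin.cons (.inl j) (Fin.cons (.inr j) I)) y * Complex.I_mul_I
  · simp only [kaehlerSign, coordIndex, Sum.elim_inr, id_eq, Sum.swap_inr]
    have : coef e ψ (Fin.cons (.inr j) (Fin.cons (.inl j) I)) y =
        -coef e ψ (Fin.cons (.inl j) (Fin.cons (.inr j) I)) y := formCoeff_cons_cons_swap _ _ _ _
    rw [this]
    linear_combination 2 * ((h.metricCoeff e j y)⁻¹ : ℝ) *
      coef e ψ (Fin.cons (.inl j) (Fin.cons (.inr j) I)) y * Complex.I_mul_I

theorem swap_ne_self (a : Fin n ⊕ Fin n) : a ≠ a.swap := by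
  rcases a with j | j <;> simp

/-- In the commutator `[Λ_j, D_ā]` the terms that differentiate `ψ` after removing an entry `ā` of
`I` occur in both products and cancel. What remains is the derivative along the contracted slot `ā`,
and the derivative of `1/H_j` in `D_ā Λ_j`, once for each occurrence of `ā` in `I`. -/
theorem coef_partialAdj (a : Fin n ⊕ Fin n) (ψ : smoothForms n X (k + 1))
    {e : OpenPartialHomeomorph X (Cn n)} (he : e ∈ atlas (Cn n) X)
    (I : Fin k → Fin n ⊕ Fin n) {y : Cn n} (hy : y ∈ e.target) :
    coef e (partialAdj hs a k ψ) I y =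
      -2 * (((h.metricCoeff e (coordIndex a) y)⁻¹ : ℝ) * wirtD a.swap (coef e ψ (Fin.cons a I)) y +
        indexCount I a.swap *
          wirtD a.swap (fun z => (((h.metricCoeff e (coordIndex a) z)⁻¹ : ℝ) : ℂ)) y *
          coef e ψ (Fin.cons a I) y) := by
  have h0 : ∀ I : Fin k → Fin n ⊕ Fin n, kaehlerSign a *
      coef e (lefschetz hs (coordIndex a) k (partialDL a.swap (k + 1) ψ)) I y =
      2 * ((h.metricCoeff e (coordIndex a) y)⁻¹ : ℝ) *
      (-wirtD a.swap (coef e ψ (Fin.cons a I)) y + ∑ i : Fin k, if I i = a.swap then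
        (-1) ^ (i : ℕ) * wirtD a.swap (coef e ψ
          (i.succ.succ.removeNth (Fin.cons a
            (Fin.cons a.swap I : Fin (k + 1) → Fin n ⊕ Fin n) : Fin (k + 2) → Fin n ⊕ Fin n))) y else 0) := by
    intro I
    rw [kaehlerSign_mul_coef_lefschetz hs a _ he _ hy, coef_partialDL_cons_cons _ _ _ _ he _ hy,
      if_neg (swap_ne_self a), if_pos rfl, zero_sub]
  cases k with
  | zero =>
    change coef e (kaehlerSign a • lefschetz hs (coordIndex a) 0 (partialDL a.swap 1 ψ)) I y = _
    rw [coef_smul, h0]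
    simp [indexCount]
    ring
  | succ k =>
    have e1 : partialAdj hs a (k + 1) ψ =
        kaehlerSign a • lefschetz hs (coordIndex a) (k + 1) (partialDL a.swap (k + 2) ψ) +
        (-1 : ℂ) • partialDL a.swap k (kaehlerSign a • lefschetz hs (coordIndex a) k ψ) :=
      kaehlerAdjoint_succ_apply (V := fun k => smoothForms n X k) _ _ a k ψ
    rw [e1, coef_add, coef_smul, h0, coef_smul, coef_partialDL he _ _ _ hy]
    have h1 : ∀ I : Fin k → Fin n ⊕ Fin n,
        wirtD a.swap (coef e (kaehlerSign a • lefschetz hs (coordIndex a) k ψ) I) y =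
        2 * (wirtD a.swap (fun z => (((h.metricCoeff e (coordIndex a) z)⁻¹ : ℝ) : ℂ)) y *
          coef e ψ (Fin.cons a (Fin.cons a.swap I)) y +
          ((h.metricCoeff e (coordIndex a) y)⁻¹ : ℝ) *
          wirtD a.swap (coef e ψ (Fin.cons a (Fin.cons a.swap I))) y) := by
      intro I
      have hd := (h.contDiffOn_inv_metricCoeff he (coordIndex a) |>.contDiffAt
        (e.open_target.mem_nhds hy)).differentiableAt (by simp)
      rw [← wirtD_mul _ hd (differentiableAt_coef he _ _ hy),
        ← wirtD_const_mul _ _ (hd.fun_mul (differentiableAt_coef he _ _ hy))]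
      refine wirtD_congr _ ?_
      filter_upwards [e.open_target.mem_nhds hy] with z hz
      rw [coef_smul, kaehlerSign_mul_coef_lefschetz hs a _ he _ hz, mul_assoc]
    -- Bringing the entry `ā` of `I` next to `a` costs `(-1)^i`, the sign with which `D_ā` removes
    -- it. So every occurrence contributes the same `ψ_{a I}`, and their number is `indexCount I ā`.
    have h2 : ∀ i : Fin (k + 1), I i = a.swap → coef e ψ (Fin.cons a I) y =
        (-1) ^ (i : ℕ) * coef e ψ (Fin.cons a (Fin.cons a.swap (i.removeNth I))) y := by
      intro i hi
      have := formCoeff_cons_insertNth (chartExpr e ψ.1 y) a a.swap i (i.removeNth I)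
      rwa [← hi, Fin.insertNth_self_removeNth, hi] at this
    have h3 : (indexCount I a.swap : ℂ) * coef e ψ (Fin.cons a I) y = ∑ i, if I i = a.swap then
        (-1) ^ (i : ℕ) * coef e ψ (Fin.cons a (Fin.cons a.swap (i.removeNth I))) y else 0 := by
      rw [indexCount]
      push_cast
      rw [Finset.sum_mul]
      refine Finset.sum_congr rfl fun i _ => ?_
      split_ifs with hi
      · rw [h2 i hi, one_mul]
      · rw [zero_mul]
    simp_rw [h1, removeNth_succ_cons]
    have h4 : (∑ i, if I i = a.swap then (-1) ^ (i : ℕ) * (2 *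
        (wirtD a.swap (fun z => (((h.metricCoeff e (coordIndex a) z)⁻¹ : ℝ) : ℂ)) y *
          coef e ψ (Fin.cons a (Fin.cons a.swap (i.removeNth I))) y +
        ((h.metricCoeff e (coordIndex a) y)⁻¹ : ℝ) *
          wirtD a.swap (coef e ψ (Fin.cons a (Fin.cons a.swap (i.removeNth I)))) y)) else 0) =
        2 * wirtD a.swap (fun z => (((h.metricCoeff e (coordIndex a) z)⁻¹ : ℝ) : ℂ)) y *
          ((indexCount I a.swap : ℂ) * coef e ψ (Fin.cons a I) y) +
        2 * ((h.metricCoeff e (coordIndex a) y)⁻¹ : ℝ) * ∑ i, if I i = a.swap then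
          (-1) ^ (i : ℕ) * wirtD a.swap
            (coef e ψ (Fin.cons a (Fin.cons a.swap (i.removeNth I)))) y else 0 := by
      rw [h3, Finset.mul_sum, Finset.mul_sum, ← Finset.sum_add_distrib]
      refine Finset.sum_congr rfl fun i _ => ?_
      split_ifs <;> ring
    rw [h4]
    ring

end Commutator

/-! ### Multidegrees, and the Laplacians in terms of the commutators -/

section Degree
variable {n : ℕ} {X : Type*} [TopologicalSpace X] [ChartedSpace (Cn n) X] {k : ℕ}

theorem mem_typeSpace_iff {α β : Fin n → Fin 2} (w : Cn n [⋀^Fin k]→L[ℝ] ℂ) :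
    w ∈ typeSpace k α β ↔ ∀ I, formCoeff w I ≠ 0 → hasType α β I := by
  constructor
  · intro hw I
    contrapose
    intro hI
    refine Submodule.span_induction (p := fun w _ => formCoeff w I = 0) ?_ (formCoeff_zero I) ?_ ?_ hw
    · rintro w ⟨J, hJ, rfl⟩
      refine formCoeff_wedgeOne_eq_zero ?_
      rintro σ rfl
      exact hI ((hasType_comp_perm α β J σ).2 hJ)
    · intro x y _ _ hx hy
      rw [formCoeff_add, hx, hy, add_zero]
    · intro c x _ hx
      rw [formCoeff_smul, hx, mul_zero]
  · intro h
    rw [eq_sum_formCoeff_smul_wedgeOne w]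
    refine Submodule.smul_mem _ _ (Submodule.sum_mem _ fun I _ => ?_)
    by_cases hI : formCoeff w I = 0
    · rw [hI]
      convert (typeSpace k α β).zero_mem
      ext v
      simp
    · exact Submodule.smul_mem _ _ (Submodule.subset_span ⟨I, h I hI, rfl⟩)

/-- The form `ψ` has multidegree `m`: its nonzero coefficients have indices in which every `a` occurs
`m a` times. -/
def HasMultidegree (m : Fin n ⊕ Fin n → ℤ) (ψ : smoothForms n X k) : Prop :=
  ∀ e ∈ atlas (Cn n) X, ∀ y ∈ e.target, ∀ I, coef e ψ I y ≠ 0 → ∀ a, (indexCount I a : ℤ) = m a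

/-- Multidegrees take integer values, so that `D_a^*` can lower them without case distinctions. -/
theorem isOfType_iff (α β : Fin n → Fin 2) (ψ : smoothForms n X k) :
    IsOfType α β ψ ↔ HasMultidegree (fun a => ((Sum.elim α β a : Fin 2) : ℕ)) ψ := by
  simp only [IsOfType, HasMultidegree, mem_typeSpace_iff, hasType_iff, coef, Nat.cast_inj]

theorem HasMultidegree.add {m : Fin n ⊕ Fin n → ℤ} {ψ φ : smoothForms n X k}
    (hψ : HasMultidegree m ψ) (hφ : HasMultidegree m φ) : HasMultidegree m (ψ + φ) := by
  intro e he y hy I hI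
  rw [coef_add] at hI
  by_cases h : coef e ψ I y = 0
  · exact hφ e he y hy I fun h' => hI (by rw [h, h', add_zero])
  · exact hψ e he y hy I h

theorem HasMultidegree.smul {m : Fin n ⊕ Fin n → ℤ} {ψ : smoothForms n X k}
    (hψ : HasMultidegree m ψ) (c : ℂ) : HasMultidegree m (c • ψ) := by
  intro e he y hy I hI
  rw [coef_smul] at hI
  exact hψ e he y hy I (right_ne_zero_of_mul hI)

theorem HasMultidegree.sum {m : Fin n ⊕ Fin n → ℤ} {ι : Type*} (s : Finset ι)
    {ψ : ι → smoothForms n X k} (hψ : ∀ i, HasMultidegree m (ψ i)) :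
    HasMultidegree m (∑ i ∈ s, ψ i) := by
  intro e he y hy I hI
  rw [coef_sum] at hI
  obtain ⟨i, -, hi⟩ := Finset.exists_ne_zero_of_sum_ne_zero hI
  exact hψ i e he y hy I hi

/-- A coefficient whose index has the wrong multidegree vanishes on the whole chart, and so do its
derivatives. -/
theorem HasMultidegree.of_wirtD_ne_zero {m : Fin n ⊕ Fin n → ℤ} {ψ : smoothForms n X k}
    (hψ : HasMultidegree m ψ) {e : OpenPartialHomeomorph X (Cn n)} (he : e ∈ atlas (Cn n) X)
    {y : Cn n} (hy : y ∈ e.target) {a : Fin n ⊕ Fin n} {I : Fin k → Fin n ⊕ Fin n}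
    (h : wirtD a (coef e ψ I) y ≠ 0) (b : Fin n ⊕ Fin n) : (indexCount I b : ℤ) = m b := by
  by_contra hb
  refine h (wirtD_eq_zero_of_eventuallyEq_zero a ?_)
  filter_upwards [e.open_target.mem_nhds hy] with z hz
  by_contra h0
  exact hb (hψ e he z hz I h0 b)

variable [HasGroupoid X (rigidGroupoid n)]

theorem HasMultidegree.partialDL {m : Fin n ⊕ Fin n → ℤ} {ψ : smoothForms n X k}
    (hψ : HasMultidegree m ψ) (a : Fin n ⊕ Fin n) :
    HasMultidegree (m + Pi.single a 1) (_root_.partialDL a k ψ) := by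
  intro e he y hy J hJ b
  rw [coef_partialDL he _ _ _ hy] at hJ
  obtain ⟨i, -, hi⟩ := Finset.exists_ne_zero_of_sum_ne_zero hJ
  split_ifs at hi with h
  · rw [indexCount_eq_removeNth J i, h]
    push_cast
    rw [hψ.of_wirtD_ne_zero he hy (right_ne_zero_of_mul hi) b, Pi.add_apply, Pi.single_apply, add_comm]
    simp only [eq_comm]
  · exact absurd rfl hi

theorem HasMultidegree.partialAdj {h : HermitianMetric n X} (hs : h.IsSplit)
    {m : Fin n ⊕ Fin n → ℤ} {ψ : smoothForms n X (k + 1)}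
    (hψ : HasMultidegree m ψ) (a : Fin n ⊕ Fin n) :
    HasMultidegree (m - Pi.single a 1) (_root_.partialAdj hs a k ψ) := by
  intro e he y hy I hI b
  rw [coef_partialAdj hs a ψ he I hy] at hI
  have key : (indexCount (Fin.cons a I : Fin (k + 1) → Fin n ⊕ Fin n) b : ℤ) = m b := by
    by_cases h0 : coef e ψ (Fin.cons a I) y = 0
    · rw [h0, mul_zero, add_zero] at hI
      exact hψ.of_wirtD_ne_zero he hy (right_ne_zero_of_mul (right_ne_zero_of_mul hI)) b
    · exact hψ e he y hy _ h0 b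
  rw [indexCount_cons] at key
  push_cast at key
  rw [Pi.sub_apply, Pi.single_apply, ← key]
  simp only [eq_comm, add_sub_cancel_left]

/-- The Laplacian of `partialDL a`. -/
noncomputable def partialLaplacian {h : HermitianMetric n X} (hs : h.IsSplit)
    (a b : Fin n ⊕ Fin n) (k : ℕ) : smoothForms n X k →ₗ[ℂ] smoothForms n X k :=
  kaehlerAnticomm (V := fun k => smoothForms n X k) partialDL (lefschetz hs) a b k

theorem HasMultidegree.partialLaplacian {h : HermitianMetric n X} (hs : h.IsSplit)
    {m : Fin n ⊕ Fin n → ℤ} (k : ℕ) {ψ : smoothForms n X k}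
    (hψ : HasMultidegree m ψ) (a : Fin n ⊕ Fin n) :
    HasMultidegree m (partialLaplacian hs a a k ψ) := by
  have h1 : HasMultidegree m (_root_.partialAdj hs a k (_root_.partialDL a k ψ)) := by
    simpa using (hψ.partialDL a).partialAdj hs a
  match k, ψ, hψ, h1 with
  | 0, ψ, hψ, h1 => exact h1
  | k + 1, ψ, hψ, h1 =>
    have h2 : HasMultidegree m (_root_.partialDL a k (_root_.partialAdj hs a k ψ)) := by
      simpa using (hψ.partialAdj hs a).partialDL a
    exact HasMultidegree.add h2 h1

theorem sum_partialLaplacian {h : HermitianMetric n X} (hs : h.IsSplit) (k : ℕ)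
    (ψ : smoothForms n X k) : ∑ a, ∑ b, partialLaplacian hs a b k ψ =
      (2 : ℂ) • ∑ j, partialLaplacian hs (.inl j) (.inl j) k ψ :=
  sum_kaehlerAnticomm (V := fun k => smoothForms n X k) (fun a b _ ψ => partialDL_anticomm a b ψ)
    (fun j _ _ ψ ha ha' => lefschetz_partialDL_comm hs j ha ha' ψ)
    (fun j _ ψ ha ha' => lefschetz_partialDL_eq_zero hs j ha ha' ψ) k ψ

variable [MeasurableSpace X]

/-- The identification of the adjoint enters as a hypothesis, which separates the algebra from the
integration by parts that provides it. -/
theorem laplacian_xi {h : HermitianMetric n X} (hs : h.IsSplit) (j : Fin n)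
    (hadj : formalAdjoint h (xi j) = fun k ψ => partialAdj hs (.inl j) k ψ) (k : ℕ)
    (ψ : smoothForms n X k) :
    laplacian h (xi j) k ψ = partialLaplacian hs (.inl j) (.inl j) k ψ := by
  match k with
  | 0 => rw [laplacian, hadj]; rfl
  | k + 1 => rw [laplacian, hadj]; rfl

theorem laplacian_extD {h : HermitianMetric n X} (hs : h.IsSplit)
    (hadj : formalAdjoint h extD = fun k ψ => ∑ b, partialAdj hs b k ψ) (k : ℕ)
    (ψ : smoothForms n X k) :
    laplacian h extD k ψ = ∑ a, ∑ b, partialLaplacian hs a b k ψ := by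
  match k with
  | 0 =>
    rw [laplacian, hadj, extD_eq_sum]
    simp_rw [map_sum]
    rw [Finset.sum_comm]
    rfl
  | k + 1 =>
    rw [laplacian, hadj, extD_eq_sum, extD_eq_sum]
    simp_rw [map_sum]
    rw [Finset.sum_comm (f := fun b a => partialAdj hs b (k + 1) (partialDL a (k + 1) ψ)),
      ← Finset.sum_add_distrib]
    simp_rw [← Finset.sum_add_distrib]
    rfl

end Degree

/-! ### The pointwise product in the complex frame -/

section ChartInner
variable {n : ℕ} {X : Type*} [TopologicalSpace X] [ChartedSpace (Cn n) X] {k : ℕ}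

/-- The square length of `dζ_{I 1} ∧ ⋯ ∧ dζ_{I k}` for a split metric, if `I` is injective. -/
noncomputable def HermitianMetric.weight (h : HermitianMetric n X)
    (e : OpenPartialHomeomorph X (Cn n)) (I : Fin k → Fin n ⊕ Fin n) (y : Cn n) : ℝ :=
  ∏ l, 2 * (h.metricCoeff e (coordIndex (I l)) y)⁻¹

/-- The pointwise product of forms in a chart, for a split metric. -/
noncomputable def HermitianMetric.chartInner (h : HermitianMetric n X)
    (e : OpenPartialHomeomorph X (Cn n)) (ψ η : smoothForms n X k) (y : Cn n) : ℂ :=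
  ((k.factorial : ℂ)⁻¹) * ∑ I : Fin k → Fin n ⊕ Fin n,
    (h.weight e I y : ℂ) * coef e ψ I y * star (coef e η I y)

/-- In each variable the matrix from `∂/∂x_j, ∂/∂y_j` to `∂/∂z_j, ∂/∂z̄_j` is `1/√2` times a unitary
matrix. This accounts for the factor `2`; the weight `G` depends on the variable only and passes
through. -/
theorem sum_frameCoeff_mul_star (G : Fin n → ℂ) (r s : Fin n ⊕ Fin n) :
    ∑ a, 2 * G (coordIndex a) * frameCoeff a r * star (frameCoeff a s) =
      if r = s then G (coordIndex r) else 0 := by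
  rcases r with i | i <;> rcases s with j | j <;>
  · simp only [Fintype.sum_sum_type, frameCoeff, realIndex, wirtCoeff, Fin.sum_univ_two,
      Matrix.cons_val_zero, Matrix.cons_val_one, Sum.inl.injEq, Sum.inr.injEq, reduceCtorEq,
      if_false, add_zero, zero_add, mul_ite, mul_zero, ite_mul, zero_mul, Finset.sum_ite_eq',
      Finset.mem_univ, if_true, coordIndex, Sum.elim_inl, Sum.elim_inr, id_eq, apply_ite star,
      star_zero]
    by_cases h : i = j
    · subst h
      simp
      try ring_nf
      try simp
      try ring
    · simp [h, Ne.symm h]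

theorem HermitianMetric.IsSplit.gram_inv [HasGroupoid X (rigidGroupoid n)] {h : HermitianMetric n X}
    (hs : h.IsSplit) {e : OpenPartialHomeomorph X (Cn n)} (he : e ∈ atlas (Cn n) X) {y : Cn n}
    (hy : y ∈ e.target) : (h.gram e y)⁻¹ =
      Matrix.diagonal fun a => (h.metricCoeff e (coordIndex a) y)⁻¹ := by
  have h1 : h.gram e y = Matrix.diagonal fun a => h.metricCoeff e (coordIndex a) y := by
    ext a b
    rw [HermitianMetric.gram, Matrix.of_apply, (hs e he y hy).1, Matrix.diagonal_apply]
    rcases a with i | i <;> rcases b with j | j <;> by_cases hij : i = j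
    all_goals
      try subst hij
      rw [Finset.sum_eq_single i]
      · simp_all [stdFrame, coordIndex]
      · intro l _ hl
        simp [stdFrame, hl]
      · simp
  rw [h1]
  refine Matrix.inv_eq_right_inv ?_
  rw [Matrix.diagonal_mul_diagonal, ← Matrix.diagonal_one]
  congr 1
  funext a
  exact mul_inv_cancel₀ (h.metricCoeff_pos he _ hy).ne'

variable [HasGroupoid X (rigidGroupoid n)]

/-- The inverse Gram matrix is `diag(1/H_j)` on the real frame, and `sum_frameCoeff_mul_star` turns
it, in each slot, into the weights `2/H_j` on the complex frame. -/
theorem HermitianMetric.IsSplit.formInner_eq_chartAt {h : HermitianMetric n X} (hs : h.IsSplit)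
    (ψ η : smoothForms n X k) (x : X) : h.formInner ψ.1 η.1 x =
      h.chartInner (chartAt (Cn n) x) ψ η (chartAt (Cn n) x x) := by
  set e := chartAt (Cn n) x with he'
  have he : e ∈ atlas (Cn n) X := chart_mem_atlas _ _
  have hy : e x ∈ e.target := e.map_source (mem_chart_source _ _)
  rw [HermitianMetric.formInner, HermitianMetric.chartInner]
  simp only [← he', hs.gram_inv he hy]
  congr 1
  simp only [coef, formCoeff_eq_sum, star_sum, star_mul', star_prod]
  have h1 : ∀ I : Fin k → Fin n ⊕ Fin n,
      (h.weight e I (e x) : ℂ) * (∑ K : Fin k → Fin n ⊕ Fin n, (∏ l, frameCoeff (I l) (K l)) *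
        chartExpr e ψ.1 (e x) fun l => stdFrame n (K l)) * (∑ K : Fin k → Fin n ⊕ Fin n,
        (∏ l, star (frameCoeff (I l) (K l))) * star (chartExpr e η.1 (e x) fun l => stdFrame n (K l))) =
      ∑ K : Fin k → Fin n ⊕ Fin n, ∑ K' : Fin k → Fin n ⊕ Fin n,
        (∏ l, 2 * ((h.metricCoeff e (coordIndex (I l)) (e x))⁻¹ : ℂ) * frameCoeff (I l) (K l) *
          star (frameCoeff (I l) (K' l))) *
        (chartExpr e ψ.1 (e x) fun l => stdFrame n (K l)) *
        star (chartExpr e η.1 (e x) fun l => stdFrame n (K' l)) := by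
    intro I
    rw [mul_assoc, Finset.sum_mul_sum, Finset.mul_sum]
    refine Finset.sum_congr rfl fun K _ => ?_
    rw [Finset.mul_sum]
    refine Finset.sum_congr rfl fun K' _ => ?_
    rw [Finset.prod_mul_distrib, Finset.prod_mul_distrib, HermitianMetric.weight]
    push_cast
    ring
  rw [Finset.sum_congr rfl fun I _ => h1 I]
  conv_rhs => rw [Finset.sum_comm]
  refine Finset.sum_congr rfl fun K _ => ?_
  conv_rhs => rw [Finset.sum_comm]
  refine Finset.sum_congr rfl fun K' _ => ?_
  rw [← Finset.sum_mul, ← Finset.sum_mul]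
  congr 2
  have h2 := Finset.prod_univ_sum (fun _ : Fin k => (Finset.univ : Finset (Fin n ⊕ Fin n)))
    fun l a => 2 * ((h.metricCoeff e (coordIndex a) (e x))⁻¹ : ℂ) * frameCoeff a (K l) *
          star (frameCoeff a (K' l))
  rw [Fintype.piFinset_univ] at h2
  rw [← h2]
  push_cast
  refine Finset.prod_congr rfl fun l _ => ?_
  rw [sum_frameCoeff_mul_star fun j => ((h.metricCoeff e j (e x))⁻¹ : ℂ), Matrix.diagonal_apply]
  split_ifs <;> simp

theorem coef_transition {e e' : OpenPartialHomeomorph X (Cn n)} (he : e ∈ atlas (Cn n) X)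
    (he' : e' ∈ atlas (Cn n) X) {y : Cn n} (hy : y ∈ (e.symm ≫ₕ e').source) {c : Fin n → ℂ}
    (hc : ∀ v : Cn n, fderiv ℝ (e.symm ≫ₕ e') y v = fun j => c j * v j) (ψ : smoothForms n X k)
    (I : Fin k → Fin n ⊕ Fin n) :
    coef e ψ I y = (∏ l, diagFactor c (I l)) * coef e' ψ I ((e.symm ≫ₕ e') y) := by
  have : IsManifold 𝓘(ℝ, Cn n) ∞ X := isManifold_of_rigid
  rw [coef, chartExpr_eq he he' ψ.1 hy, formCoeff_comp _ c hc, coef]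

theorem diagFactor_mul_star (c : Fin n → ℂ) (a : Fin n ⊕ Fin n) :
    diagFactor c a * star (diagFactor c a) = Complex.normSq (c (coordIndex a)) := by
  rcases a with j | j
  · simp [diagFactor, coordIndex, Complex.mul_conj]
  · simp [diagFactor, coordIndex, mul_comm, Complex.mul_conj]

/-- The factors `|c_j|²` from the coefficients of `ψ` and `η` cancel against those from the weights.
Thus the product, defined by preferred charts, can be computed in any chart. -/
theorem HermitianMetric.IsSplit.chartInner_transition {h : HermitianMetric n X} (hs : h.IsSplit)
    {e e' : OpenPartialHomeomorph X (Cn n)} (he : e ∈ atlas (Cn n) X)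
    (he' : e' ∈ atlas (Cn n) X) {y : Cn n} (hy : y ∈ (e.symm ≫ₕ e').source)
    (ψ η : smoothForms n X k) :
    h.chartInner e ψ η y = h.chartInner e' ψ η ((e.symm ≫ₕ e') y) := by
  obtain ⟨c, hc⟩ := exists_fderiv_transition_eq ((rigidGroupoid n).subset_maximalAtlas he)
    ((rigidGroupoid n).subset_maximalAtlas he') hy
  rw [HermitianMetric.chartInner, HermitianMetric.chartInner]
  congr 1
  refine Finset.sum_congr rfl fun I _ => ?_
  rw [coef_transition he he' hy hc, coef_transition he he' hy hc]
  have h1 : (h.weight e I y : ℂ) * ((∏ l, diagFactor c (I l)) * star (∏ l, diagFactor c (I l))) =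
      h.weight e' I ((e.symm ≫ₕ e') y) := by
    rw [star_prod, ← Finset.prod_mul_distrib, HermitianMetric.weight, HermitianMetric.weight]
    push_cast
    rw [← Finset.prod_mul_distrib]
    refine Finset.prod_congr rfl fun l _ => ?_
    have h2 := h.metricCoeff_pos he (coordIndex (I l)) (mem_transition_source.1 hy).1
    rw [hs.metricCoeff_eq he he' hy hc] at h2 ⊢
    rw [diagFactor_mul_star]
    have h3 := left_ne_zero_of_mul h2.ne'
    have h4 := right_ne_zero_of_mul h2.ne'
    have h5 : ∀ p q : ℝ, p ≠ 0 → q ≠ 0 → 2 * (p * q)⁻¹ * p = 2 * q⁻¹ := fun p q hp hq => by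
      field_simp
    have h6 := congrArg Complex.ofReal (h5 _ _ h3 h4)
    simp only [Complex.ofReal_mul, Complex.ofReal_inv, Complex.ofReal_ofNat] at h6 ⊢
    exact h6
  rw [← h1, star_mul']
  ring

theorem HermitianMetric.IsSplit.formInner_eq {h : HermitianMetric n X} (hs : h.IsSplit)
    (ψ η : smoothForms n X k) {e : OpenPartialHomeomorph X (Cn n)} (he : e ∈ atlas (Cn n) X)
    {y : Cn n} (hy : y ∈ e.target) :
    h.formInner ψ.1 η.1 (e.symm y) = h.chartInner e ψ η y := by
  rw [hs.formInner_eq_chartAt, hs.chartInner_transition he (chart_mem_atlas _ (e.symm y))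
    (mem_transition_source.2 ⟨hy, mem_chart_source _ _⟩)]
  rfl

end ChartInner

/-! ### The volume measure in charts -/

section ChartMeasure
open MeasureTheory
variable {n : ℕ} {X : Type*} [TopologicalSpace X] [ChartedSpace (Cn n) X]

theorem measurableSet_target_inter_preimage [MeasurableSpace X] [BorelSpace X]
    (e : OpenPartialHomeomorph X (Cn n)) {A : Set X} (hA : MeasurableSet A) :
    MeasurableSet (e.target ∩ e.symm ⁻¹' A) := by
  have h1 := (continuousOn_iff_continuous_domRestrict.1 e.continuousOn_symm).measurable hA
  have h2 := (MeasurableEmbedding.subtype_coe e.open_target.measurableSet).measurableSet_image.2 h1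
  convert h2 using 1
  ext y
  simp [and_comm]

/-- The density of the volume measure in a chart, for a split metric. -/
noncomputable def HermitianMetric.density (h : HermitianMetric n X)
    (e : OpenPartialHomeomorph X (Cn n)) (y : Cn n) : ℝ :=
  ∏ j, h.metricCoeff e j y

theorem HermitianMetric.contDiffOn_density (h : HermitianMetric n X)
    {e : OpenPartialHomeomorph X (Cn n)} (he : e ∈ atlas (Cn n) X) :
    ContDiffOn ℝ ∞ (h.density e) e.target := by
  have := contDiffOn_prod (t := Finset.univ) (fun j _ => h.contDiffOn_metricCoeff he j)
  exact this.congr fun y _ => by simp [density]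

theorem HermitianMetric.IsSplit.det_re {h : HermitianMetric n X} (hs : h.IsSplit)
    {e : OpenPartialHomeomorph X (Cn n)} (he : e ∈ atlas (Cn n) X) {y : Cn n}
    (hy : y ∈ e.target) : (Matrix.det (Matrix.of fun j k : Fin n =>
        h.inChart e y (Pi.single j 1) (Pi.single k 1))).re = h.density e y := by
  have h1 : (Matrix.of fun j k : Fin n => h.inChart e y (Pi.single j 1) (Pi.single k 1)) =
      Matrix.diagonal fun j => (h.metricCoeff e j y : ℂ) := by
    ext j k
    rw [Matrix.of_apply, (hs e he y hy).1, Matrix.diagonal_apply, Finset.sum_eq_single j]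
    · by_cases hjk : j = k
      · subst hjk
        simp
      · simp [hjk]
    · intro i _ hi
      simp [hi]
    · simp
  rw [h1, Matrix.det_diagonal, ← Complex.ofReal_prod, Complex.ofReal_re, density]

/-- The contribution of a chart to the volume measure. -/
noncomputable def HermitianMetric.chartMeasure [MeasurableSpace X] (h : HermitianMetric n X)
    (e : OpenPartialHomeomorph X (Cn n)) : Measure X :=
  (((MeasureTheory.volume : Measure (Cn n)).restrict e.target).withDensity fun y =>
    ENNReal.ofReal (h.density e y)).map e.symm

theorem HermitianMetric.IsSplit.volume_eq [MeasurableSpace X] {h : HermitianMetric n X}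
    (hs : h.IsSplit) : h.volume = ⨆ e ∈ atlas (Cn n) X, h.chartMeasure e := by
  unfold HermitianMetric.volume
  refine iSup_congr fun e => iSup_congr fun he => ?_
  rw [chartMeasure]
  congr 1
  refine withDensity_congr_ae ?_
  filter_upwards [ae_restrict_mem e.open_target.measurableSet] with y hy
  rw [hs.det_re he hy]

variable [MeasurableSpace X] [BorelSpace X]

theorem aemeasurable_symm (e : OpenPartialHomeomorph X (Cn n)) (f : Cn n → ENNReal) :
    AEMeasurable e.symm (((MeasureTheory.volume : Measure (Cn n)).restrict e.target).withDensity f) :=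
  (e.continuousOn_symm.aemeasurable e.open_target.measurableSet).mono_ac
    (withDensity_absolutelyContinuous _ _)

theorem HermitianMetric.chartMeasure_apply (h : HermitianMetric n X)
    (e : OpenPartialHomeomorph X (Cn n)) {A : Set X} (hA : MeasurableSet A) :
    h.chartMeasure e A = ∫⁻ y in e.target ∩ e.symm ⁻¹' A, ENNReal.ofReal (h.density e y) := by
  have hm := measurableSet_target_inter_preimage e hA
  rw [chartMeasure, Measure.map_apply_of_aemeasurable (aemeasurable_symm e _) hA]
  have h1 : (((MeasureTheory.volume : Measure (Cn n)).restrict e.target).withDensity fun y =>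
      ENNReal.ofReal (h.density e y)) e.targetᶜ = 0 := by
    refine withDensity_absolutelyContinuous _ _ ?_
    rw [Measure.restrict_apply e.open_target.measurableSet.compl]
    simp
  rw [← measure_inter_add_sdiff (e.symm ⁻¹' A) e.open_target.measurableSet,
    measure_mono_null (s := e.symm ⁻¹' A \ e.target) (fun y hy => hy.2) h1, add_zero, inter_comm, withDensity_apply _ hm,
    Measure.restrict_restrict hm]
  congr 2
  ext y
  simp
  tauto

theorem HermitianMetric.chartMeasure_compl_source (h : HermitianMetric n X)
    (e : OpenPartialHomeomorph X (Cn n)) : h.chartMeasure e e.sourceᶜ = 0 := by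
  rw [h.chartMeasure_apply e e.open_source.measurableSet.compl]
  have : e.target ∩ e.symm ⁻¹' e.sourceᶜ = ∅ := by
    ext y
    simp only [mem_inter_iff, mem_preimage, mem_compl_iff, mem_empty_iff_false, iff_false, not_and,
      not_not]
    exact fun hy => e.map_target hy
  rw [this, Measure.restrict_empty, lintegral_zero_measure]

/-- The real determinant of a complex linear map is the squared modulus of its complex determinant.
-/
theorem abs_det_of_diagonal {L : Cn n →L[ℝ] Cn n} {c : Fin n → ℂ}
    (hL : ∀ v, L v = fun j => c j * v j) : |L.det| = ∏ j, Complex.normSq (c j) := by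
  have h1 : (L : Cn n →ₗ[ℝ] Cn n) = (Matrix.toLin' (Matrix.diagonal c)).restrictScalars ℝ := by
    refine LinearMap.ext fun v => funext fun j => ?_
    simp [hL, Matrix.mulVec_diagonal]
  rw [ContinuousLinearMap.det, h1, LinearMap.det_restrictScalars, Algebra.norm_complex_apply,
    LinearMap.det_toLin', Matrix.det_diagonal, map_prod, abs_of_nonneg]
  exact Finset.prod_nonneg fun j _ => Complex.normSq_nonneg _

variable [HasGroupoid X (rigidGroupoid n)]

theorem HermitianMetric.density_pos (h : HermitianMetric n X)
    {e : OpenPartialHomeomorph X (Cn n)} (he : e ∈ atlas (Cn n) X) {y : Cn n}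
    (hy : y ∈ e.target) : 0 < h.density e y :=
  Finset.prod_pos fun j _ => h.metricCoeff_pos he j hy

/-- Change of variables: the Jacobian `∏ |c_j|²` is the ratio of the two densities. -/
theorem HermitianMetric.IsSplit.chartMeasure_eq {h : HermitianMetric n X} (hs : h.IsSplit)
    {e e' : OpenPartialHomeomorph X (Cn n)} (he : e ∈ atlas (Cn n) X) (he' : e' ∈ atlas (Cn n) X)
    {A : Set X} (hA : MeasurableSet A) (h1 : A ⊆ e.source) (h2 : A ⊆ e'.source) :
    h.chartMeasure e' A = h.chartMeasure e A := by
  rw [h.chartMeasure_apply e hA, h.chartMeasure_apply e' hA]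
  have hsub : e.target ∩ e.symm ⁻¹' A ⊆ (e.symm ≫ₕ e').source := fun y hy =>
    mem_transition_source.2 ⟨hy.1, h2 hy.2⟩
  have himg : e'.target ∩ e'.symm ⁻¹' A = (e.symm ≫ₕ e') '' (e.target ∩ e.symm ⁻¹' A) := by
    ext y
    constructor
    · rintro ⟨hy, hyA⟩
      refine ⟨e (e'.symm y), ⟨e.map_source (h1 hyA), ?_⟩, ?_⟩
      · rw [mem_preimage, e.left_inv (h1 hyA)]
        exact hyA
      · simp [e.left_inv (h1 hyA), e'.right_inv hy]
    · rintro ⟨z, hz, rfl⟩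
      refine ⟨((e.symm ≫ₕ e').map_source (hsub hz)).1, ?_⟩
      rw [mem_preimage, symm_transition_apply (hsub hz)]
      exact hz.2
  have hr := isLocallyRigid_transition ((rigidGroupoid n).subset_maximalAtlas he)
    ((rigidGroupoid n).subset_maximalAtlas he')
  have hm := measurableSet_target_inter_preimage e hA
  rw [himg, lintegral_image_eq_lintegral_abs_det_fderiv_mul MeasureTheory.volume hm
    (f' := fun y => fderiv ℝ (e.symm ≫ₕ e') y) ?_
    ((e.symm ≫ₕ e').injOn.mono hsub)]
  · refine setLIntegral_congr_fun hm fun y hy => ?_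
    obtain ⟨c, hc⟩ := exists_fderiv_transition_eq ((rigidGroupoid n).subset_maximalAtlas he)
      ((rigidGroupoid n).subset_maximalAtlas he') (hsub hy)
    rw [abs_det_of_diagonal hc, ← ENNReal.ofReal_mul
      (Finset.prod_nonneg fun j _ => Complex.normSq_nonneg _), density, density,
      ← Finset.prod_mul_distrib]
    congr 1
    exact Finset.prod_congr rfl fun j _ => (hs.metricCoeff_eq he he' (hsub hy) hc j).symm
  · intro y hy
    exact (((hr.contDiffOn (e.symm ≫ₕ e').open_source).contDiffAt
      ((e.symm ≫ₕ e').open_source.mem_nhds (hsub hy))).differentiableAt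
      (by simp)).hasFDerivAt.hasFDerivWithinAt

/-- A supremum of measures is not computed set by set, so the upper bound is proved for each member:
every chart measure is at most that of `e` plus the volume outside the domain of `e`. Hence the
supremum is too, and restricting to the domain removes the second term. -/
theorem HermitianMetric.IsSplit.volume_restrict_source {h : HermitianMetric n X} (hs : h.IsSplit)
    {e : OpenPartialHomeomorph X (Cn n)} (he : e ∈ atlas (Cn n) X) :
    h.volume.restrict e.source = h.chartMeasure e := by
  have hU := e.open_source.measurableSet
  have hle : ∀ e' ∈ atlas (Cn n) X, h.chartMeasure e' ≤ h.volume := fun e' he' => by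
    rw [hs.volume_eq]
    exact le_iSup₂ (f := fun (e : OpenPartialHomeomorph X (Cn n)) (_ : e ∈ atlas (Cn n) X) =>
      h.chartMeasure e) e' he'
  refine le_antisymm ?_ ?_
  · have h1 : h.volume ≤ h.chartMeasure e + h.volume.restrict e.sourceᶜ := by
      conv_lhs => rw [hs.volume_eq]
      refine iSup₂_le fun e' he' => Measure.le_iff.2 fun A hA => ?_
      rw [Measure.add_apply, Measure.restrict_apply hA, ← measure_inter_add_sdiff A hU]
      refine add_le_add ?_ ?_
      · rw [← measure_inter_add_sdiff (A ∩ e.source) e'.open_source.measurableSet,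
          measure_mono_null (s := (A ∩ e.source) \ e'.source) (fun y hy => hy.2) (h.chartMeasure_compl_source e'), add_zero,
          hs.chartMeasure_eq he he' ((hA.inter hU).inter e'.open_source.measurableSet)
            (fun x hx => hx.1.2) fun x hx => hx.2]
        exact measure_mono fun x hx => hx.1.1
      · exact hle e' he' _
    calc h.volume.restrict e.source
        ≤ (h.chartMeasure e + h.volume.restrict e.sourceᶜ).restrict e.source :=
          Measure.restrict_mono le_rfl h1
      _ = (h.chartMeasure e).restrict e.source := by
          rw [Measure.restrict_add, Measure.restrict_restrict hU]
          simp
      _ ≤ h.chartMeasure e := Measure.restrict_le_self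
  · rw [← Measure.restrict_eq_self_of_ae_mem (μ := h.chartMeasure e) (s := e.source)]
    · exact Measure.restrict_mono le_rfl (hle e he)
    · exact mem_ae_iff.2 (h.chartMeasure_compl_source e)

theorem HermitianMetric.IsSplit.integral_eq {h : HermitianMetric n X} (hs : h.IsSplit)
    {e : OpenPartialHomeomorph X (Cn n)} (he : e ∈ atlas (Cn n) X) {f : X → ℂ}
    (hf : ContinuousOn f e.source) (h0 : ∀ x ∉ e.source, f x = 0) :
    ∫ x, f x ∂h.volume = ∫ y in e.target, (h.density e y : ℂ) * f (e.symm y) := by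
  have hm : AEStronglyMeasurable f (h.chartMeasure e) := by
    rw [← hs.volume_restrict_source he]
    exact hf.aestronglyMeasurable e.open_source.measurableSet
  have hd : AEMeasurable (fun y => ENNReal.ofReal (h.density e y))
      ((MeasureTheory.volume : Measure (Cn n)).restrict e.target) :=
    ((h.contDiffOn_density he).continuousOn.aemeasurable
      e.open_target.measurableSet).ennreal_ofReal
  rw [← setIntegral_eq_integral_of_forall_compl_eq_zero h0, hs.volume_restrict_source he,
    chartMeasure, integral_map (aemeasurable_symm e _) hm,
    integral_withDensity_eq_integral_toReal_smul₀ hd (by simp)]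
  refine setIntegral_congr_fun e.open_target.measurableSet fun y hy => ?_
  simp only [ENNReal.toReal_ofReal (h.density_pos he hy).le, Complex.real_smul]

theorem HermitianMetric.IsSplit.integrable {h : HermitianMetric n X} (hs : h.IsSplit)
    {e : OpenPartialHomeomorph X (Cn n)} (he : e ∈ atlas (Cn n) X) {f : X → ℂ}
    (hf : ContinuousOn f e.source) {K : Set X} (hK : IsCompact K) (hKe : K ⊆ e.source)
    (h0 : ∀ x ∉ K, f x = 0) : Integrable f h.volume := by
  have hm : AEStronglyMeasurable f (h.chartMeasure e) := by
    rw [← hs.volume_restrict_source he]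
    exact hf.aestronglyMeasurable e.open_source.measurableSet
  have hd : AEMeasurable (fun y => ENNReal.ofReal (h.density e y))
      ((MeasureTheory.volume : Measure (Cn n)).restrict e.target) :=
    ((h.contDiffOn_density he).continuousOn.aemeasurable
      e.open_target.measurableSet).ennreal_ofReal
  have hsupp : Function.support f ⊆ e.source := fun x hx => by
    by_contra hx'
    exact hx (h0 x fun hK' => hx' (hKe hK'))
  rw [← integrableOn_iff_integrable_of_support_subset hsupp, IntegrableOn,
    hs.volume_restrict_source he, chartMeasure]
  refine (integrable_map_measure hm (aemeasurable_symm e _)).2 ?_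
  rw [integrable_withDensity_iff_integrable_smul₀' hd (by simp)]
  have hK' : IsCompact (e '' K) := hK.image_of_continuousOn (e.continuousOn.mono hKe)
  have hKt : e '' K ⊆ e.target := by
    rintro _ ⟨x, hx, rfl⟩
    exact e.map_source (hKe hx)
  have hc : ContinuousOn (fun y => (ENNReal.ofReal (h.density e y)).toReal • (f ∘ e.symm) y)
      e.target := by
    refine ContinuousOn.smul (M := ℝ) (X := ℂ) ?_ (hf.comp e.continuousOn_symm fun y hy => e.map_target hy)
    refine (h.contDiffOn_density he).continuousOn.congr fun y hy => ?_
    exact ENNReal.toReal_ofReal (h.density_pos he hy).le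
  refine IntegrableOn.of_forall_sdiff_eq_zero (s := e '' K)
    ((hc.mono hKt).integrableOn_compact hK') e.open_target.measurableSet fun y hy => ?_
  have : e.symm y ∉ K := fun hyK => hy.2 ⟨_, hyK, e.right_inv hy.1⟩
  simp [h0 _ this]

end ChartMeasure

/-! ### Integration by parts on `ℂⁿ` -/

section IntegrationByParts
open MeasureTheory
variable {n : ℕ}

/-- Outside `U` the extension by zero vanishes on the open complement of `K`, so it is smooth there
as well. -/
theorem contDiff_indicator {U K : Set (Cn n)} (hU : IsOpen U) (hK : IsCompact K)
    (hKU : K ⊆ U) {u : Cn n → ℂ} (hu : ContDiffOn ℝ ∞ u U) (h0 : ∀ y ∈ U, y ∉ K → u y = 0) :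
    ContDiff ℝ ∞ (U.indicator u) := by
  refine contDiff_iff_contDiffAt.2 fun y => ?_
  by_cases hy : y ∈ U
  · refine (hu.contDiffAt (hU.mem_nhds hy)).congr_of_eventuallyEq ?_
    filter_upwards [hU.mem_nhds hy] with z hz using indicator_of_mem hz u
  · have hyK : y ∈ Kᶜ := fun h => hy (hKU h)
    refine (contDiffAt_const (c := (0 : ℂ))).congr_of_eventuallyEq ?_
    filter_upwards [hK.isClosed.isOpen_compl.mem_nhds hyK] with z hz
    by_cases hzU : z ∈ U
    · rw [indicator_of_mem hzU, h0 z hzU hz]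
    · exact indicator_of_notMem hzU u

/-- Integration by parts against the constant function `1`. -/
theorem integral_fderiv_eq_zero {v : Cn n → ℂ} (hv : ContDiff ℝ ∞ v) (hc : HasCompactSupport v)
    (w : Cn n) : ∫ y, fderiv ℝ v y w = 0 := by
  have hd : Continuous fun y => fderiv ℝ v y w :=
    (hv.continuous_fderiv (by simp)).clm_apply continuous_const
  have hdc : HasCompactSupport fun y => fderiv ℝ v y w := hc.fderiv_apply ℝ w
  have h := integral_mul_fderiv_eq_neg_fderiv_mul_of_integrable (μ := volume) (𝕜 := ℂ)
    (f := fun _ : Cn n => (1 : ℂ)) (g := v) (v := w) (by simp)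
    (by simpa using hd.integrable_of_hasCompactSupport hdc)
    (by simpa using hv.continuous.integrable_of_hasCompactSupport hc)
    (fun _ _ => differentiableAt_const _)
    (fun y _ => (hv.differentiable (by simp)) y)
  simpa using h

theorem setIntegral_wirtD_eq_zero (a : Fin n ⊕ Fin n) {U K : Set (Cn n)} (hU : IsOpen U)
    (hK : IsCompact K) (hKU : K ⊆ U) {u : Cn n → ℂ} (hu : ContDiffOn ℝ ∞ u U)
    (h0 : ∀ y ∈ U, y ∉ K → u y = 0) : ∫ y in U, wirtD a u y = 0 := by
  set v := U.indicator u with hv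
  have hs := contDiff_indicator hU hK hKU hu h0
  have hz : ∀ y ∉ K, v y = 0 := fun y hy => by
    by_cases hyU : y ∈ U
    · rw [hv, indicator_of_mem hyU, h0 y hyU hy]
    · exact indicator_of_notMem hyU u
  have hc : HasCompactSupport v := HasCompactSupport.intro hK hz
  have h1 : ∫ y in U, wirtD a u y = ∫ y in U, wirtD a v y := by
    refine setIntegral_congr_fun hU.measurableSet fun y hy => wirtD_congr a ?_
    filter_upwards [hU.mem_nhds hy] with z hz using (indicator_of_mem hz u).symm
  have h2 : ∀ y ∉ U, wirtD a v y = 0 := fun y hy => by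
    refine wirtD_eq_zero_of_eventuallyEq_zero a ?_
    filter_upwards [hK.isClosed.isOpen_compl.mem_nhds fun h => hy (hKU h)] with z hzK using hz z hzK
  rw [h1, setIntegral_eq_integral_of_forall_compl_eq_zero h2]
  unfold wirtD
  rw [integral_finsetSum]
  · refine Finset.sum_eq_zero fun s _ => ?_
    rw [integral_const_mul, integral_fderiv_eq_zero hs hc, mul_zero]
  · intro s _
    exact (((hs.continuous_fderiv (by simp)).clm_apply
      continuous_const).integrable_of_hasCompactSupport (hc.fderiv_apply ℝ _)).const_mul _

end IntegrationByParts

/-! ### The adjunction in a chart, up to a derivative -/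

section ChartAdjunction
variable {n : ℕ} {X : Type*} [TopologicalSpace X] [ChartedSpace (Cn n) X] {k : ℕ}

theorem HermitianMetric.weight_cons (h : HermitianMetric n X)
    (e : OpenPartialHomeomorph X (Cn n)) (a : Fin n ⊕ Fin n) (I : Fin k → Fin n ⊕ Fin n)
    (y : Cn n) : h.weight e (Fin.cons a I : Fin (k + 1) → Fin n ⊕ Fin n) y =
      2 * (h.metricCoeff e (coordIndex a) y)⁻¹ * h.weight e I y := by
  rw [weight, Fin.prod_univ_succ]
  simp [weight]

theorem HermitianMetric.weight_insertNth (h : HermitianMetric n X)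
    (e : OpenPartialHomeomorph X (Cn n)) (i : Fin (k + 1)) (a : Fin n ⊕ Fin n)
    (I : Fin k → Fin n ⊕ Fin n) (y : Cn n) :
    h.weight e (i.insertNth a I : Fin (k + 1) → Fin n ⊕ Fin n) y =
      h.weight e (Fin.cons a I : Fin (k + 1) → Fin n ⊕ Fin n) y := by
  rw [h.weight_cons, weight, Fin.prod_univ_succAbove _ i]
  simp [weight]

variable [HasGroupoid X (rigidGroupoid n)]

theorem HermitianMetric.contDiffOn_weight (h : HermitianMetric n X)
    {e : OpenPartialHomeomorph X (Cn n)} (he : e ∈ atlas (Cn n) X) (I : Fin k → Fin n ⊕ Fin n) :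
    ContDiffOn ℝ ∞ (fun y => (h.weight e I y : ℂ)) e.target := by
  have h1 : (fun y => (h.weight e I y : ℂ)) = fun y => ∏ l, (2 : ℂ) *
      (((h.metricCoeff e (coordIndex (I l)) y)⁻¹ : ℝ) : ℂ) := by
    funext y
    simp [weight]
  rw [h1]
  exact contDiffOn_prod fun l _ => contDiffOn_const.mul (h.contDiffOn_inv_metricCoeff he _)

theorem HermitianMetric.contDiffOn_ofReal_density (h : HermitianMetric n X)
    {e : OpenPartialHomeomorph X (Cn n)} (he : e ∈ atlas (Cn n) X) :
    ContDiffOn ℝ ∞ (fun y => (h.density e y : ℂ)) e.target :=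
  Complex.ofRealCLM.contDiff.comp_contDiffOn (h.contDiffOn_density he)

theorem contDiffOn_star_coef {e : OpenPartialHomeomorph X (Cn n)} (he : e ∈ atlas (Cn n) X)
    (ψ : smoothForms n X k) (I : Fin k → Fin n ⊕ Fin n) :
    ContDiffOn ℝ ∞ (fun y => star (coef e ψ I y)) e.target :=
  Complex.conjCLE.contDiff.comp_contDiffOn (contDiffOn_coef he ψ I)

theorem HermitianMetric.contDiffOn_chartInner (h : HermitianMetric n X)
    {e : OpenPartialHomeomorph X (Cn n)} (he : e ∈ atlas (Cn n) X) (ψ η : smoothForms n X k) :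
    ContDiffOn ℝ ∞ (h.chartInner e ψ η) e.target :=
  contDiffOn_const.mul (ContDiffOn.sum fun I _ => ((h.contDiffOn_weight he I).mul
    (contDiffOn_coef he ψ I)).mul (contDiffOn_star_coef he η I))

/-- The sign `(-1)^i` occurs twice, in `D_a η` and in moving `a` to the front of the index of `ψ`.
So the `k + 1` possible positions of `a` contribute equally, and `(k + 1)/(k + 1)! = 1/k!`. -/
theorem HermitianMetric.chartInner_partialDL (h : HermitianMetric n X)
    {e : OpenPartialHomeomorph X (Cn n)} (he : e ∈ atlas (Cn n) X) (a : Fin n ⊕ Fin n)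
    (ψ : smoothForms n X (k + 1)) (η : smoothForms n X k) {y : Cn n} (hy : y ∈ e.target) :
    h.chartInner e ψ (partialDL a k η) y = ((k.factorial : ℂ)⁻¹) *
      ∑ I : Fin k → Fin n ⊕ Fin n,
        (h.weight e (Fin.cons a I : Fin (k + 1) → Fin n ⊕ Fin n) y : ℂ) *
          coef e ψ (Fin.cons a I) y * star (wirtD a (coef e η I) y) := by
  have h1 : ∀ i : Fin (k + 1), ∑ J : Fin (k + 1) → Fin n ⊕ Fin n,
      (h.weight e J y : ℂ) * coef e ψ J y * star (if J i = a then
        (-1) ^ (i : ℕ) * wirtD a (coef e η (i.removeNth J)) y else 0) =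
      ∑ I : Fin k → Fin n ⊕ Fin n,
        (h.weight e (Fin.cons a I : Fin (k + 1) → Fin n ⊕ Fin n) y : ℂ) *
          coef e ψ (Fin.cons a I) y * star (wirtD a (coef e η I) y) := by
    intro i
    rw [← (Fin.insertNthEquiv (fun _ => Fin n ⊕ Fin n) i).sum_comp, Fintype.sum_prod_type,
      Finset.sum_eq_single a]
    · refine Finset.sum_congr rfl fun I _ => ?_
      have hc : coef e ψ (i.insertNth a I) y = (-1) ^ (i : ℕ) * coef e ψ (Fin.cons a I) y :=
        formCoeff_insertNth _ i a I
      have hsq : ((-1 : ℂ) ^ (i : ℕ)) * (-1) ^ (i : ℕ) = 1 := by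
        rw [← mul_pow]
        simp
      have hE : Fin.insertNthEquiv (fun _ => Fin n ⊕ Fin n) i (a, I) = i.insertNth a I := rfl
      simp only [hE, Fin.insertNth_apply_same, if_true,
        Fin.removeNth_insertNth, hc, h.weight_insertNth, star_mul', star_pow, star_neg, star_one]
      linear_combination (h.weight e (Fin.cons a I : Fin (k + 1) → Fin n ⊕ Fin n) y : ℂ) *
          coef e ψ (Fin.cons a I) y * star (wirtD a (coef e η I) y) * hsq
    · intro b _ hb
      simp [hb]
    · simp
  rw [chartInner]
  simp only [coef_partialDL he a η _ hy, star_sum]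
  rw [Finset.sum_congr rfl fun J _ => Finset.mul_sum _ _ _, Finset.sum_comm, Finset.sum_congr rfl fun i _ => h1 i]
  simp only [Finset.sum_const, Finset.card_univ, Fintype.card_fin, nsmul_eq_mul]
  rw [Nat.factorial_succ]
  have hk : ((k : ℂ) + 1) ≠ 0 := by exact_mod_cast Nat.succ_ne_zero k
  push_cast
  field_simp

theorem HermitianMetric.IsSplit.wirtD_metricCoeff {h : HermitianMetric n X} (hs : h.IsSplit)
    {e : OpenPartialHomeomorph X (Cn n)} (he : e ∈ atlas (Cn n) X) {j : Fin n} {a : Fin n ⊕ Fin n}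
    (ha : coordIndex a ≠ j) {y : Cn n} (hy : y ∈ e.target) :
    wirtD a (fun z => (h.metricCoeff e j z : ℂ)) y = 0 := by
  obtain ⟨g, hg⟩ := (hs e he y hy).2 j
  refine wirtD_eq_zero_of_eventually_eq (j := j) (g := fun w => (g w : ℂ)) ?_ ?_ ?_ ?_
  · exact (Complex.ofRealCLM.contDiff.comp_contDiffOn (h.contDiffOn_metricCoeff he j) |>.contDiffAt
      (e.open_target.mem_nhds hy)).differentiableAt (by simp)
  · filter_upwards [hg] with z hz
    rw [hz]
  · rintro rfl
    exact ha rfl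
  · rintro rfl
    exact ha rfl

theorem wirtD_prod_eq_zero {ι : Type*} (a : Fin n ⊕ Fin n) (s : Finset ι) {F : ι → Cn n → ℂ}
    {y : Cn n} (hF : ∀ i ∈ s, DifferentiableAt ℝ (F i) y) (h0 : ∀ i ∈ s, wirtD a (F i) y = 0) :
    DifferentiableAt ℝ (fun z => ∏ i ∈ s, F i z) y ∧ wirtD a (fun z => ∏ i ∈ s, F i z) y = 0 := by
  classical
  induction s using Finset.induction_on with
  | empty => exact ⟨by simp, by simpa using wirtD_const a (1 : ℂ) y⟩
  | insert i s hi ih =>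
    obtain ⟨h1, h2⟩ := ih (fun j hj => hF j (Finset.mem_insert_of_mem hj))
      fun j hj => h0 j (Finset.mem_insert_of_mem hj)
    simp only [Finset.prod_insert hi]
    refine ⟨(hF i (Finset.mem_insert_self _ _)).fun_mul h1, ?_⟩
    rw [wirtD_mul a (hF i (Finset.mem_insert_self _ _)) h1, h2,
      h0 i (Finset.mem_insert_self _ _)]
    simp

theorem coordIndex_swap (a : Fin n ⊕ Fin n) : coordIndex a.swap = coordIndex a := by
  rcases a with j | j <;> rfl

theorem eq_or_eq_swap_of_coordIndex_eq {a b : Fin n ⊕ Fin n} (h : coordIndex a = coordIndex b) :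
    a = b ∨ a = b.swap := by
  rcases a with i | i <;> rcases b with j | j <;> simp_all [coordIndex]

/-- The factor `H_j` of the volume density cancels the factor `1/H_j` belonging to `dζ_a`. As `a`
does not recur in `I`, the only dependence on `z_j` left is `(2/H_j)^m`, where `m` is the number of
entries `ā` in `I`. This is the origin of the zeroth-order term of `D_a^*`. -/
theorem HermitianMetric.IsSplit.wirtD_density_mul_weight {h : HermitianMetric n X} (hs : h.IsSplit)
    {e : OpenPartialHomeomorph X (Cn n)} (he : e ∈ atlas (Cn n) X) (a : Fin n ⊕ Fin n)
    {I : Fin k → Fin n ⊕ Fin n}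
    (hI : Function.Injective (Fin.cons a I : Fin (k + 1) → Fin n ⊕ Fin n))
    {y : Cn n} (hy : y ∈ e.target) :
    wirtD a.swap (fun z => (h.density e z : ℂ) *
      (h.weight e (Fin.cons a I : Fin (k + 1) → Fin n ⊕ Fin n) z : ℂ)) y =
    2 * h.density e y * h.weight e I y * indexCount I a.swap *
      wirtD a.swap (fun z => (((h.metricCoeff e (coordIndex a) z)⁻¹ : ℝ) : ℂ)) y := by
  classical
  set b := a.swap with hb
  set j := coordIndex a with hj
  set G : Fin n → Cn n → ℂ := fun j z => (((h.metricCoeff e j z)⁻¹ : ℝ) : ℂ) with hG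
  set H : Fin n → Cn n → ℂ := fun j z => (h.metricCoeff e j z : ℂ) with hH
  have hIa : ∀ l, I l ≠ a := fun l hl => by
    have := @hI l.succ 0 (by simpa using hl)
    exact Fin.succ_ne_zero l this
  have hI' : Function.Injective I := fun l m hlm => by
    have := @hI l.succ m.succ (by simpa using hlm)
    exact Fin.succ_injective _ this
  have hGd : ∀ i, DifferentiableAt ℝ (G i) y := fun i =>
    ((h.contDiffOn_inv_metricCoeff he i).contDiffAt
      (e.open_target.mem_nhds hy)).differentiableAt (by simp)
  have hHd : ∀ i, DifferentiableAt ℝ (H i) y := fun i =>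
    (Complex.ofRealCLM.contDiff.comp_contDiffOn (h.contDiffOn_metricCoeff he i) |>.contDiffAt
      (e.open_target.mem_nhds hy)).differentiableAt (by simp)
  -- `A` and `B` are the parts of the density and of the weight that come from the other variables,
  -- so `∂_ā` annihilates both.
  obtain ⟨hA, hA0⟩ := wirtD_prod_eq_zero b (Finset.univ.erase j) (F := H) (y := y)
    (fun i _ => hHd i) fun i hi => hs.wirtD_metricCoeff he
      (by rw [hb, coordIndex_swap]; exact (Finset.ne_of_mem_erase hi).symm) hy
  obtain ⟨hB, hB0⟩ := wirtD_prod_eq_zero b (Finset.univ.filter fun l => I l ≠ b)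
    (F := fun l z => 2 * G (coordIndex (I l)) z) (y := y) (fun l _ => (hGd _).const_mul 2)
    fun l hl => by
      have hne : coordIndex (I l) ≠ j := fun h0 => by
        rcases eq_or_eq_swap_of_coordIndex_eq h0 with h1 | h1
        · exact hIa l h1
        · exact (Finset.mem_filter.1 hl).2 h1
      rw [wirtD_const_mul b 2 (hGd _), hs.wirtD_inv_metricCoeff he ?_ ?_ hy, mul_zero]
      · rintro h0
        apply hne
        rw [hj, ← coordIndex_swap a, ← hb, h0]
        rfl
      · rintro h0
        apply hne
        rw [hj, ← coordIndex_swap a, ← hb, h0]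
        rfl
  set A : Cn n → ℂ := fun z => ∏ i ∈ Finset.univ.erase j, H i z with hAdef
  set B : Cn n → ℂ := fun z => ∏ l with I l ≠ b, 2 * G (coordIndex (I l)) z with hBdef
  set m := indexCount I b with hm
  have hdens : ∀ z, (h.density e z : ℂ) = H j z * A z := fun z => by
    rw [hAdef, density, Complex.ofReal_prod]
    exact (Finset.mul_prod_erase _ _ (Finset.mem_univ j)).symm
  have hwt : ∀ z, (h.weight e I z : ℂ) = (2 * G j z) ^ m * B z := fun z => by
    rw [weight, Complex.ofReal_prod, ← Finset.prod_filter_mul_prod_filter_not _ fun l => I l = b]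
    congr 1
    · rw [hm, indexCount, ← Finset.card_filter, ← Finset.prod_const]
      refine Finset.prod_congr rfl fun l hl => ?_
      rw [(Finset.mem_filter.1 hl).2, hb, coordIndex_swap, hG]
      push_cast
      rfl
    · refine Finset.prod_congr rfl fun l hl => ?_
      rw [hG]
      push_cast
      rfl
  have hHG : ∀ z ∈ e.target, H j z * G j z = 1 := fun z hz => by
    rw [hH, hG, ← Complex.ofReal_mul, mul_inv_cancel₀ (h.metricCoeff_pos he j hz).ne',
      Complex.ofReal_one]
  have hev : (fun z => (h.density e z : ℂ) *
      (h.weight e (Fin.cons a I : Fin (k + 1) → Fin n ⊕ Fin n) z : ℂ)) =ᶠ[𝓝 y]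
      fun z => (2 * (A z * B z)) * (2 * G j z) ^ m := by
    filter_upwards [e.open_target.mem_nhds hy] with z hz
    rw [h.weight_cons, Complex.ofReal_mul, hwt, hdens]
    have : ((2 * (h.metricCoeff e (coordIndex a) z)⁻¹ : ℝ) : ℂ) = 2 * G j z := by
      rw [hG]
      push_cast
      rfl
    rw [this]
    linear_combination 2 * A z * (2 * G j z) ^ m * B z * hHG z hz
  have hR : DifferentiableAt ℝ (fun z => 2 * (A z * B z)) y := (hA.fun_mul hB).const_mul 2
  have hR0 : wirtD b (fun z => 2 * (A z * B z)) y = 0 := by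
    rw [wirtD_const_mul b 2 (hA.fun_mul hB), wirtD_mul b hA hB, hA0, hB0]
    simp
  rw [wirtD_congr b hev, hdens, hwt]
  -- Injectivity leaves only these two powers: a constant in `z_j`, or `2/H_j` itself.
  have hm1 : m = 0 ∨ m = 1 := by
    have := indexCount_le_one hI' b
    omega
  rcases hm1 with h0 | h0
  · simp [h0, hR0]
  · simp only [h0, pow_one, Nat.cast_one]
    rw [wirtD_mul b hR ((hGd j).const_mul 2), hR0, wirtD_const_mul b 2 (hGd j)]
    linear_combination (- 4 * A y * B y * wirtD b (G j) y) * hHG y hy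

/-- The two terms of `coef_partialAdj` are the two terms of the product rule on the right: one
derivative falls on `ψ`, the other on density times weight. If the index `a I` has a repetition,
`ψ_{a I}` vanishes identically. -/
theorem HermitianMetric.IsSplit.density_mul_partialAdj {h : HermitianMetric n X} (hs : h.IsSplit)
    {e : OpenPartialHomeomorph X (Cn n)} (he : e ∈ atlas (Cn n) X) (a : Fin n ⊕ Fin n)
    (ψ : smoothForms n X (k + 1)) (I : Fin k → Fin n ⊕ Fin n) {y : Cn n} (hy : y ∈ e.target) :
    (h.density e y : ℂ) * h.weight e I y * coef e (partialAdj hs a k ψ) I y =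
      -wirtD a.swap (fun z => (h.density e z : ℂ) *
        (h.weight e (Fin.cons a I : Fin (k + 1) → Fin n ⊕ Fin n) z : ℂ) *
        coef e ψ (Fin.cons a I) z) y := by
  rw [coef_partialAdj hs a ψ he I hy]
  by_cases hI : Function.Injective (Fin.cons a I : Fin (k + 1) → Fin n ⊕ Fin n)
  · have hW := ((h.contDiffOn_ofReal_density he).mul (h.contDiffOn_weight he
      (Fin.cons a I : Fin (k + 1) → Fin n ⊕ Fin n))).contDiffAt (e.open_target.mem_nhds hy)
    rw [wirtD_mul _ (hW.differentiableAt (by simp)) (differentiableAt_coef he ψ _ hy),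
      hs.wirtD_density_mul_weight he a hI hy, h.weight_cons]
    push_cast
    ring
  · have h1 : coef e ψ (Fin.cons a I) = fun _ => 0 :=
      funext fun z => formCoeff_eq_zero_of_not_injective _ hI
    simp [h1, wirtD_const]

/-- The function whose `∂_ā`-derivative is the difference of the two sides of the adjunction. -/
noncomputable def HermitianMetric.boundaryTerm (h : HermitianMetric n X)
    (e : OpenPartialHomeomorph X (Cn n)) (a : Fin n ⊕ Fin n)
    (ψ : smoothForms n X (k + 1)) (η : smoothForms n X k) (y : Cn n) : ℂ :=
  ((k.factorial : ℂ)⁻¹) * ∑ I : Fin k → Fin n ⊕ Fin n, ((h.density e y : ℂ) *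
    (h.weight e (Fin.cons a I : Fin (k + 1) → Fin n ⊕ Fin n) y : ℂ) *
    coef e ψ (Fin.cons a I) y) * star (coef e η I y)

theorem HermitianMetric.contDiffOn_boundaryTerm (h : HermitianMetric n X)
    {e : OpenPartialHomeomorph X (Cn n)} (he : e ∈ atlas (Cn n) X) (a : Fin n ⊕ Fin n)
    (ψ : smoothForms n X (k + 1)) (η : smoothForms n X k) :
    ContDiffOn ℝ ∞ (h.boundaryTerm e a ψ η) e.target :=
  contDiffOn_const.mul (ContDiffOn.sum fun I _ => (((h.contDiffOn_ofReal_density he).mul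
    (h.contDiffOn_weight he _)).mul (contDiffOn_coef he ψ _)).mul (contDiffOn_star_coef he η I))

/-- By the product rule `∂_ā` of the boundary term has two parts. The derivative of the weighted
coefficients of `ψ` gives `-D_a^* ψ`, and since `∂_ā` of a conjugate is the conjugate of `∂_a`, the
other part pairs `ψ` with `D_a η`. -/
theorem HermitianMetric.IsSplit.chartInner_adjunction {h : HermitianMetric n X} (hs : h.IsSplit)
    {e : OpenPartialHomeomorph X (Cn n)} (he : e ∈ atlas (Cn n) X) (a : Fin n ⊕ Fin n)
    (ψ : smoothForms n X (k + 1)) (η : smoothForms n X k) {y : Cn n} (hy : y ∈ e.target) :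
    (h.density e y : ℂ) * (h.chartInner e (partialAdj hs a k ψ) η y -
      h.chartInner e ψ (partialDL a k η) y) = -wirtD a.swap (h.boundaryTerm e a ψ η) y := by
  have hN := e.open_target.mem_nhds hy
  have hF : ∀ I : Fin k → Fin n ⊕ Fin n, DifferentiableAt ℝ (fun z => (h.density e z : ℂ) *
      (h.weight e (Fin.cons a I : Fin (k + 1) → Fin n ⊕ Fin n) z : ℂ) *
      coef e ψ (Fin.cons a I) z) y := fun I =>
    ((((h.contDiffOn_ofReal_density he).mul (h.contDiffOn_weight he _)).mul
      (contDiffOn_coef he ψ _)).contDiffAt hN).differentiableAt (by simp)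
  have hS : ∀ I : Fin k → Fin n ⊕ Fin n, DifferentiableAt ℝ (fun z => star (coef e η I z)) y :=
    fun I => ((contDiffOn_star_coef he η I).contDiffAt hN).differentiableAt (by simp)
  have hFS := fun I => (hF I).fun_mul (hS I)
  unfold boundaryTerm
  rw [wirtD_const_mul _ _ (DifferentiableAt.fun_sum fun I _ => hFS I),
    wirtD_sum _ _ fun I _ => hFS I, h.chartInner_partialDL he a ψ η hy, chartInner, ← mul_sub,
    ← Finset.sum_sub_distrib, mul_left_comm, ← mul_neg, ← Finset.sum_neg_distrib, Finset.mul_sum]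
  congr 1
  refine Finset.sum_congr rfl fun I _ => ?_
  rw [wirtD_mul _ (hF I) (hS I), wirtD_star _ (differentiableAt_coef he η I hy), Sum.swap_swap]
  linear_combination star (coef e η I y) * hs.density_mul_partialAdj he a ψ I hy

end ChartAdjunction

/-! ### Multiplication by functions, and supports -/

section ScalarMultiples
variable {n : ℕ} {X : Type*} [TopologicalSpace X] [ChartedSpace (Cn n) X] {k : ℕ}

theorem coef_eq_zero_of_apply_eq_zero {e : OpenPartialHomeomorph X (Cn n)} {ψ : smoothForms n X k}
    {y : Cn n} (h : ψ.1 (e.symm y) = 0) (I : Fin k → Fin n ⊕ Fin n) : coef e ψ I y = 0 := by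
  have : chartExpr e ψ.1 y = 0 := by
    rw [chartExpr, h]
    rfl
  rw [coef, this, formCoeff_zero]

variable [HasGroupoid X (rigidGroupoid n)]

theorem apply_eq_zero_of_coef {e : OpenPartialHomeomorph X (Cn n)} (he : e ∈ atlas (Cn n) X)
    {ψ : smoothForms n X k} {y : Cn n} (hy : y ∈ e.target) (h : ∀ I, coef e ψ I y = 0) :
    ψ.1 (e.symm y) = 0 := by
  refine (chartExpr_eq_iff ψ.1 (0 : smoothForms n X k).1 he hy).1 (formCoeff_ext fun I => ?_)
  exact (h I).trans (coef_zero e I y).symm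

/-- The product of a smooth real function and a form. -/
noncomputable def mulForm (f : X → ℝ) (hf : ContMDiff 𝓘(ℝ, Cn n) 𝓘(ℝ, ℝ) ∞ f)
    (ψ : smoothForms n X k) : smoothForms n X k :=
  ⟨fun x => (f x : ℂ) • ψ.1 x, fun e he => by
    have : IsManifold 𝓘(ℝ, Cn n) ∞ X := isManifold_of_rigid
    have h1 : chartExpr e (fun x => (f x : ℂ) • ψ.1 x) =
        fun y => ((f (e.symm y) : ℝ) : ℂ) • chartExpr e ψ.1 y := by
      ext y v
      rfl
    have h2 : ContDiffOn ℝ ∞ (f ∘ e.symm) e.target :=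
      contMDiffOn_iff_contDiffOn.1 (hf.comp_contMDiffOn
        (contMDiffOn_symm_of_mem_maximalAtlas (IsManifold.subset_maximalAtlas he)))
    rw [h1]
    exact (Complex.ofRealCLM.contDiff.comp_contDiffOn h2).smul (ψ.2 e he)⟩

theorem coef_mulForm {f : X → ℝ} (hf : ContMDiff 𝓘(ℝ, Cn n) 𝓘(ℝ, ℝ) ∞ f) (ψ : smoothForms n X k)
    (e : OpenPartialHomeomorph X (Cn n)) (I : Fin k → Fin n ⊕ Fin n) (y : Cn n) :
    coef e (mulForm f hf ψ) I y = f (e.symm y) * coef e ψ I y := by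
  rw [coef, coef, ← formCoeff_smul]
  rfl

theorem mulForm_apply_eq_zero {f : X → ℝ} (hf : ContMDiff 𝓘(ℝ, Cn n) 𝓘(ℝ, ℝ) ∞ f)
    {ψ : smoothForms n X k} {x : X} (hx : f x = 0 ∨ ψ.1 x = 0) : (mulForm f hf ψ).1 x = 0 := by
  have hxs := mem_chart_source (Cn n) x
  have hy := (chartAt (Cn n) x).map_source hxs
  rw [← (chartAt (Cn n) x).left_inv hxs] at hx ⊢
  refine apply_eq_zero_of_coef (chart_mem_atlas _ _) hy fun I => ?_
  rw [coef_mulForm]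
  rcases hx with hx | hx
  · rw [hx, Complex.ofReal_zero, zero_mul]
  · rw [coef_eq_zero_of_apply_eq_zero hx, mul_zero]

theorem partialDL_eq_zero_of_notMem {K : Set X} (hK : IsClosed K) (a : Fin n ⊕ Fin n)
    {η : smoothForms n X k} (h0 : ∀ x ∉ K, η.1 x = 0) {x : X} (hx : x ∉ K) :
    (partialDL a k η).1 x = 0 := by
  set e := chartAt (Cn n) x with he'
  have he : e ∈ atlas (Cn n) X := chart_mem_atlas _ _
  have hxs : x ∈ e.source := mem_chart_source _ _
  have hy := e.map_source hxs
  have h1 : (partialDL a k η).1 (e.symm (e x)) = 0 := by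
    refine apply_eq_zero_of_coef he hy fun J => ?_
    rw [coef_partialDL he a η J hy]
    refine Finset.sum_eq_zero fun i _ => ?_
    rw [wirtD_eq_zero_of_eventuallyEq_zero a, mul_zero, ite_self]
    have h2 : e.symm ⁻¹' Kᶜ ∈ 𝓝 (e x) :=
      (e.continuousAt_symm hy).preimage_mem_nhds (by
        rw [e.left_inv hxs]
        exact hK.isOpen_compl.mem_nhds hx)
    filter_upwards [h2] with z hz
    exact coef_eq_zero_of_apply_eq_zero (h0 _ hz) _
  rwa [e.left_inv hxs] at h1

end ScalarMultiples

/-! ### Existence and uniqueness of the adjoints -/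

section Adjoint
open MeasureTheory
variable {n : ℕ} {X : Type*} [TopologicalSpace X] [ChartedSpace (Cn n) X] {k : ℕ}
  [HasGroupoid X (rigidGroupoid n)]

theorem HermitianMetric.IsSplit.formInner_add_right {h : HermitianMetric n X} (hs : h.IsSplit)
    (ψ η η' : smoothForms n X k) (x : X) : h.formInner ψ.1 (η + η').1 x =
      h.formInner ψ.1 η.1 x + h.formInner ψ.1 η'.1 x := by
  rw [hs.formInner_eq_chartAt, hs.formInner_eq_chartAt, hs.formInner_eq_chartAt, chartInner,
    chartInner, chartInner, ← mul_add, ← Finset.sum_add_distrib]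
  congr 1
  refine Finset.sum_congr rfl fun I _ => ?_
  rw [coef_add, star_add, mul_add]

theorem HermitianMetric.IsSplit.formInner_eq_zero_right {h : HermitianMetric n X} (hs : h.IsSplit)
    (ψ : smoothForms n X k) {η : smoothForms n X k} {x : X} (hx : η.1 x = 0) :
    h.formInner ψ.1 η.1 x = 0 := by
  rw [hs.formInner_eq_chartAt, chartInner, Finset.sum_eq_zero, mul_zero]
  intro I _
  rw [coef_eq_zero_of_apply_eq_zero (ψ := η), star_zero, mul_zero]
  rwa [(chartAt (Cn n) x).left_inv (mem_chart_source _ _)]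

theorem HermitianMetric.IsSplit.continuousOn_formInner {h : HermitianMetric n X} (hs : h.IsSplit)
    (ψ η : smoothForms n X k) {e : OpenPartialHomeomorph X (Cn n)} (he : e ∈ atlas (Cn n) X) :
    ContinuousOn (h.formInner ψ.1 η.1) e.source := by
  refine (((h.contDiffOn_chartInner he ψ η).continuousOn.comp e.continuousOn
    fun x hx => e.map_source hx)).congr fun x hx => ?_
  rw [Function.comp_apply, ← hs.formInner_eq ψ η he (e.map_source hx), e.left_inv hx]

theorem HermitianMetric.IsSplit.formInner_sum_left {h : HermitianMetric n X} (hs : h.IsSplit)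
    {ι : Type*} (s : Finset ι) (ψ : ι → smoothForms n X k) (η : smoothForms n X k) (x : X) :
    h.formInner (∑ i ∈ s, ψ i).1 η.1 x = ∑ i ∈ s, h.formInner (ψ i).1 η.1 x := by
  simp only [hs.formInner_eq_chartAt, chartInner, coef_sum, Finset.mul_sum, Finset.sum_mul]
  exact Finset.sum_comm

theorem HermitianMetric.IsSplit.formInner_sum_right {h : HermitianMetric n X} (hs : h.IsSplit)
    {ι : Type*} (s : Finset ι) (ψ : smoothForms n X k) (η : ι → smoothForms n X k) (x : X) :
    h.formInner ψ.1 (∑ i ∈ s, η i).1 x = ∑ i ∈ s, h.formInner ψ.1 (η i).1 x := by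
  simp only [hs.formInner_eq_chartAt, chartInner, coef_sum, star_sum, Finset.mul_sum]
  exact Finset.sum_comm

theorem HermitianMetric.chartInner_self (h : HermitianMetric n X)
    (e : OpenPartialHomeomorph X (Cn n)) (φ : smoothForms n X k) (y : Cn n) :
    h.chartInner e φ φ y = (((k.factorial : ℝ)⁻¹ * ∑ I : Fin k → Fin n ⊕ Fin n,
      h.weight e I y * Complex.normSq (coef e φ I y) : ℝ) : ℂ) := by
  rw [chartInner]
  push_cast
  congr 1
  refine Finset.sum_congr rfl fun I _ => ?_
  rw [mul_assoc]
  congr 1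
  exact Complex.mul_conj _

theorem HermitianMetric.weight_pos (h : HermitianMetric n X)
    {e : OpenPartialHomeomorph X (Cn n)} (he : e ∈ atlas (Cn n) X) (I : Fin k → Fin n ⊕ Fin n)
    {y : Cn n} (hy : y ∈ e.target) : 0 < h.weight e I y :=
  Finset.prod_pos fun l _ => mul_pos two_pos (inv_pos.2 (h.metricCoeff_pos he _ hy))

variable [MeasurableSpace X] [BorelSpace X]

theorem HermitianMetric.IsSplit.integrable_formInner {h : HermitianMetric n X} (hs : h.IsSplit)
    (ψ η : smoothForms n X k) {e : OpenPartialHomeomorph X (Cn n)} (he : e ∈ atlas (Cn n) X)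
    {K : Set X} (hK : IsCompact K) (hKe : K ⊆ e.source) (h0 : ∀ x ∉ K, η.1 x = 0) :
    Integrable (h.formInner ψ.1 η.1) h.volume :=
  hs.integrable he (hs.continuousOn_formInner ψ η he) hK hKe fun x hx =>
    hs.formInner_eq_zero_right ψ (h0 x hx)

/-- The two degrees are independent: different ones occur in the adjunction, where the difference is
a derivative, and equal ones in the proof of nondegeneracy. -/
theorem HermitianMetric.IsSplit.l2Inner_sub_l2Inner {h : HermitianMetric n X} (hs : h.IsSplit)
    {l : ℕ} (ψ η : smoothForms n X k) (ψ' η' : smoothForms n X l)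
    {e : OpenPartialHomeomorph X (Cn n)} (he : e ∈ atlas (Cn n) X)
    {K : Set X} (hK : IsCompact K) (hKe : K ⊆ e.source) (h0 : ∀ x ∉ K, η.1 x = 0)
    (h0' : ∀ x ∉ K, η'.1 x = 0) : h.l2Inner ψ η - h.l2Inner ψ' η' =
      ∫ y in e.target, (h.density e y : ℂ) * (h.chartInner e ψ η y - h.chartInner e ψ' η' y) := by
  rw [l2Inner, l2Inner, ← integral_sub (hs.integrable_formInner _ η he hK hKe h0)
    (hs.integrable_formInner _ η' he hK hKe h0'), hs.integral_eq he (f := fun x =>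
      h.formInner ψ.1 η.1 x - h.formInner ψ'.1 η'.1 x)
    ((hs.continuousOn_formInner _ _ he).sub (hs.continuousOn_formInner _ _ he))]
  · refine setIntegral_congr_fun e.open_target.measurableSet fun y hy => ?_
    rw [hs.formInner_eq _ _ he hy, hs.formInner_eq _ _ he hy]
  · intro x hx
    have hx' : x ∉ K := fun h' => hx (hKe h')
    rw [hs.formInner_eq_zero_right _ (h0 x hx'), hs.formInner_eq_zero_right _ (h0' x hx'), sub_zero]

/-- The difference of the two sides is the integral over the chart of a `∂_ā`-derivative, of a
function that vanishes outside the compact image of `K`. -/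
theorem HermitianMetric.IsSplit.l2Inner_partialAdj_of_chart [T2Space X] {h : HermitianMetric n X}
    (hs : h.IsSplit) (a : Fin n ⊕ Fin n) (ψ : smoothForms n X (k + 1)) (η : smoothForms n X k)
    {e : OpenPartialHomeomorph X (Cn n)} (he : e ∈ atlas (Cn n) X)
    {K : Set X} (hK : IsCompact K) (hKe : K ⊆ e.source) (h0 : ∀ x ∉ K, η.1 x = 0) :
    h.l2Inner (partialAdj hs a k ψ) η = h.l2Inner ψ (partialDL a k η) := by
  have hD0 : ∀ x ∉ K, (partialDL a k η).1 x = 0 := fun x hx =>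
    partialDL_eq_zero_of_notMem hK.isClosed a h0 hx
  rw [← sub_eq_zero, hs.l2Inner_sub_l2Inner _ _ _ _ he hK hKe h0 hD0,
    setIntegral_congr_fun e.open_target.measurableSet fun y hy =>
      hs.chartInner_adjunction he a ψ η hy, integral_neg,
    setIntegral_wirtD_eq_zero a.swap e.open_target
      (hK.image_of_continuousOn (e.continuousOn.mono hKe)) ?_ (h.contDiffOn_boundaryTerm he a ψ η) ?_,
      neg_zero]
  · rintro _ ⟨x, hx, rfl⟩
    exact e.map_source (hKe hx)
  · intro y hy hyK
    rw [boundaryTerm, Finset.sum_eq_zero, mul_zero]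
    intro I _
    rw [coef_eq_zero_of_apply_eq_zero (ψ := η) (h0 _ fun hyK' => hyK ⟨_, hyK', e.right_inv hy⟩),
      star_zero, mul_zero]

variable [T2Space X]

/-- A form with compact support is a sum of forms with compact supports in charts. -/
theorem exists_sum_eq_of_hasCompactSupportForm [SecondCountableTopology X] {η : smoothForms n X k}
    (hη : HasCompactSupportForm η) : ∃ (s : Finset X) (f : X → smoothForms n X k),
      η = ∑ i ∈ s, f i ∧ ∀ i, ∃ K, IsCompact K ∧ K ⊆ (chartAt (Cn n) i).source ∧
        ∀ x ∉ K, (f i).1 x = 0 := by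
  classical
  have : IsManifold 𝓘(ℝ, Cn n) ∞ X := isManifold_of_rigid
  have : LocallyCompactSpace X := ChartedSpace.locallyCompactSpace (Cn n) X
  obtain ⟨K, hK, h0⟩ := hη
  obtain ⟨ρ, hρ⟩ := SmoothPartitionOfUnity.exists_isSubordinate_chartAt_source 𝓘(ℝ, Cn n) X
  have hfin := ρ.locallyFinite.finite_nonempty_inter_compact hK
  refine ⟨hfin.toFinset, fun i => mulForm (ρ i) (ρ i).contMDiff η, ?_, fun i =>
    ⟨K ∩ tsupport (ρ i), hK.inter_right (isClosed_tsupport _), fun x hx => hρ i hx.2,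
      fun x hx => ?_⟩⟩
  · refine smoothForms_ext fun e he y hy I => ?_
    rw [coef_sum]
    simp only [coef_mulForm]
    rw [← Finset.sum_mul]
    by_cases hyK : e.symm y ∈ K
    · have h1 : ∑ i ∈ hfin.toFinset, ρ i (e.symm y) = 1 := by
        rw [← ρ.sum_eq_one (mem_univ (e.symm y))]
        refine (finsum_eq_sum_of_support_subset _ fun i hi => ?_).symm
        simp only [Finite.coe_toFinset, mem_ofPred_eq]
        exact ⟨_, hi, hyK⟩
      rw [← Complex.ofReal_sum, h1, Complex.ofReal_one, one_mul]
    · rw [coef_eq_zero_of_apply_eq_zero (h0 _ hyK), mul_zero]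
  · refine mulForm_apply_eq_zero _ ?_
    by_cases hxK : x ∈ K
    · exact .inl (image_eq_zero_of_notMem_tsupport fun h' => hx ⟨hxK, h'⟩)
    · exact .inr (h0 x hxK)

/-- Integrability is carried along since the integral is additive only for integrable functions. It
is needed when adding the pieces of `η`, and again when summing over `a` to obtain the adjoint of
`d`. -/
theorem HermitianMetric.IsSplit.l2Inner_partialAdj [SecondCountableTopology X]
    {h : HermitianMetric n X} (hs : h.IsSplit) (a : Fin n ⊕ Fin n) (ψ : smoothForms n X (k + 1))
    {η : smoothForms n X k} (hη : HasCompactSupportForm η) :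
    h.l2Inner (partialAdj hs a k ψ) η = h.l2Inner ψ (partialDL a k η) ∧
      Integrable (h.formInner (partialAdj hs a k ψ).1 η.1) h.volume ∧
      Integrable (h.formInner ψ.1 (partialDL a k η).1) h.volume := by
  obtain ⟨s, f, rfl, hf⟩ := exists_sum_eq_of_hasCompactSupportForm hη
  refine Finset.sum_induction f (fun η => h.l2Inner (partialAdj hs a k ψ) η =
      h.l2Inner ψ (partialDL a k η) ∧
      Integrable (h.formInner (partialAdj hs a k ψ).1 η.1) h.volume ∧
      Integrable (h.formInner ψ.1 (partialDL a k η).1) h.volume) ?_ ?_ ?_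
  · rintro η η' ⟨h1, h2, h3⟩ ⟨h1', h2', h3'⟩
    have e1 : h.formInner (partialAdj hs a k ψ).1 (η + η').1 = fun x =>
        h.formInner (partialAdj hs a k ψ).1 η.1 x + h.formInner (partialAdj hs a k ψ).1 η'.1 x :=
      funext fun x => hs.formInner_add_right _ _ _ x
    have e2 : h.formInner ψ.1 (partialDL a k (η + η')).1 = fun x =>
        h.formInner ψ.1 (partialDL a k η).1 x + h.formInner ψ.1 (partialDL a k η').1 x :=
      funext fun x => by rw [map_add]; exact hs.formInner_add_right _ _ _ x
    simp only [l2Inner] at h1 h1' ⊢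
    rw [e1, e2, integral_add h2 h2', integral_add h3 h3', h1, h1']
    exact ⟨rfl, h2.add h2', h3.add h3'⟩
  · have e1 : ∀ {l : ℕ} (φ : smoothForms n X l),
        h.formInner φ.1 (0 : smoothForms n X l).1 = fun _ => 0 := fun φ =>
      funext fun x => hs.formInner_eq_zero_right φ rfl
    rw [map_zero]
    simp only [l2Inner, e1]
    exact ⟨by simp, integrable_zero _ _ _, integrable_zero _ _ _⟩
  · intro i _
    obtain ⟨K, hK, hKe, h0⟩ := hf i
    exact ⟨hs.l2Inner_partialAdj_of_chart a ψ (f i) (chart_mem_atlas _ _) hK hKe h0,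
      hs.integrable_formInner _ _ (chart_mem_atlas _ _) hK hKe h0,
      hs.integrable_formInner _ _ (chart_mem_atlas _ _) hK hKe fun x hx =>
        partialDL_eq_zero_of_notMem hK.isClosed a h0 hx⟩

theorem HermitianMetric.IsSplit.isFormalAdjoint_xi [SecondCountableTopology X]
    {h : HermitianMetric n X} (hs : h.IsSplit) (j : Fin n) :
    IsFormalAdjoint h (xi j) fun k ψ => partialAdj hs (.inl j) k ψ :=
  fun _ ψ _ hη => (hs.l2Inner_partialAdj (.inl j) ψ hη).1

theorem HermitianMetric.IsSplit.isFormalAdjoint_extD [SecondCountableTopology X]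
    {h : HermitianMetric n X} (hs : h.IsSplit) :
    IsFormalAdjoint h extD fun k ψ => ∑ b, partialAdj hs b k ψ := by
  intro k ψ η hη
  rw [extD_eq_sum, l2Inner, l2Inner, funext fun x => hs.formInner_sum_left _ _ η x,
    funext fun x => hs.formInner_sum_right _ ψ _ x, integral_finsetSum _ fun b _ =>
      (hs.l2Inner_partialAdj b ψ hη).2.1, integral_finsetSum _ fun b _ =>
      (hs.l2Inner_partialAdj b ψ hη).2.2]
  exact Finset.sum_congr rfl fun b _ => (hs.l2Inner_partialAdj b ψ hη).1

/-- The product of forms is nondegenerate on forms supported in charts. -/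
theorem HermitianMetric.IsSplit.eq_of_l2Inner_eq {h : HermitianMetric n X} (hs : h.IsSplit)
    {ψ ψ' : smoothForms n X k} (hψ : ∀ η : smoothForms n X k, HasCompactSupportForm η →
      h.l2Inner ψ η = h.l2Inner ψ' η) : ψ = ψ' := by
  have : IsManifold 𝓘(ℝ, Cn n) ∞ X := isManifold_of_rigid
  ext1
  funext x
  set e := chartAt (Cn n) x with he'
  have he : e ∈ atlas (Cn n) X := chart_mem_atlas _ _
  have hxs : x ∈ e.source := mem_chart_source _ _
  have hxt := e.map_source hxs
  set φ : smoothForms n X k := ψ + (-1 : ℂ) • ψ' with hφ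
  have hcφ : ∀ I y, coef e φ I y = coef e ψ I y - coef e ψ' I y := fun I y => by
    rw [hφ, coef_add, coef_smul]
    ring
  obtain ⟨ρ⟩ : Nonempty (SmoothBumpFunction 𝓘(ℝ, Cn n) x) := inferInstance
  -- Testing with a bump function times the difference `φ = ψ - ψ'` makes the integrand `ρ |φ|²`
  -- times the density, which is nonnegative.
  set η := mulForm ρ ρ.contMDiff φ with hη
  have hK : IsCompact (tsupport ρ) := ρ.hasCompactSupport
  have hKe : tsupport ρ ⊆ e.source := ρ.tsupport_subset_chartAt_source
  have h0 : ∀ z ∉ tsupport ρ, η.1 z = 0 := fun z hz =>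
    mulForm_apply_eq_zero _ (.inl (image_eq_zero_of_notMem_tsupport hz))
  set g : Cn n → ℝ := fun y => (k.factorial : ℝ)⁻¹ * ∑ I : Fin k → Fin n ⊕ Fin n,
      h.weight e I y * Complex.normSq (coef e φ I y) with hg
  set F : Cn n → ℝ := fun y => h.density e y * (ρ (e.symm y) * g y) with hF
  have hterm : ∀ y ∈ e.target, ∀ I : Fin k → Fin n ⊕ Fin n,
      0 ≤ h.weight e I y * Complex.normSq (coef e φ I y) := fun y hy I =>
    mul_nonneg (h.weight_pos he I hy).le (Complex.normSq_nonneg _)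
  have hF0 : ∀ y ∈ e.target, 0 ≤ F y := fun y hy =>
    mul_nonneg (h.density_pos he hy).le (mul_nonneg ρ.nonneg (mul_nonneg (by positivity)
      (Finset.sum_nonneg fun I _ => hterm y hy I)))
  have hgc : ContinuousOn g e.target := by
    have h1 := Complex.continuous_re.comp_continuousOn (h.contDiffOn_chartInner he φ φ).continuousOn
    refine h1.congr fun y _ => ?_
    rw [Function.comp_apply, h.chartInner_self, Complex.ofReal_re]
  have hFc : ContinuousOn F e.target :=
    (h.contDiffOn_density he).continuousOn.mul
      ((ρ.continuous.comp_continuousOn e.continuousOn_symm).mul hgc)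
  have hKt : e '' tsupport ρ ⊆ e.target := by
    rintro _ ⟨z, hz, rfl⟩
    exact e.map_source (hKe hz)
  have hFi : IntegrableOn F e.target := by
    refine IntegrableOn.of_forall_sdiff_eq_zero (s := e '' tsupport ρ)
      ((hFc.mono hKt).integrableOn_compact (hK.image_of_continuousOn (e.continuousOn.mono hKe)))
      e.open_target.measurableSet fun y hy => ?_
    have : e.symm y ∉ tsupport ρ := fun hyK => hy.2 ⟨_, hyK, e.right_inv hy.1⟩
    simp [hF, image_eq_zero_of_notMem_tsupport this]
  have hint : ∫ y in e.target, F y = 0 := by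
    have h1 := sub_eq_zero.2 (hψ η ⟨_, hK, h0⟩)
    have h2 : ∫ y in e.target, (h.density e y : ℂ) *
        (h.chartInner e ψ η y - h.chartInner e ψ' η y) = ∫ y in e.target, (F y : ℂ) := by
      refine setIntegral_congr_fun e.open_target.measurableSet fun y hy => ?_
      have h3 : ((g y : ℝ) : ℂ) = h.chartInner e φ φ y := (h.chartInner_self e φ y).symm
      simp only [hF, Complex.ofReal_mul, h3]
      rw [chartInner, chartInner, chartInner, ← mul_sub, ← Finset.sum_sub_distrib,
        mul_left_comm (ρ (e.symm y) : ℂ), Finset.mul_sum (a := (ρ (e.symm y) : ℂ))]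
      congr 2
      refine Finset.sum_congr rfl fun I _ => ?_
      have h4 : star ((ρ (e.symm y) : ℝ) : ℂ) = ρ (e.symm y) := Complex.conj_ofReal _
      rw [coef_mulForm, star_mul', hcφ, h4]
      ring
    rw [hs.l2Inner_sub_l2Inner _ _ _ _ he hK hKe h0 h0, h2, integral_complex_ofReal] at h1
    exact_mod_cast h1
  have hae : F =ᵐ[MeasureTheory.volume.restrict e.target] fun _ => 0 :=
    (setIntegral_eq_zero_iff_of_nonneg_ae (by
      filter_upwards [ae_restrict_mem e.open_target.measurableSet] with y hy using hF0 y hy)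
      hFi).1 hint
  -- A continuous function that vanishes almost everywhere on an open set vanishes on it. At `x` the
  -- bump function is `1`, and positivity of the weights then forces every coefficient of `φ` to
  -- vanish there.
  have hFx : F (e x) = 0 :=
    Measure.eqOn_open_of_ae_eq hae e.open_target hFc continuousOn_const hxt
  have hgx : g (e x) = 0 := by
    have h1 : ρ (e.symm (e x)) = 1 := by
      rw [e.left_inv hxs]
      exact ρ.eq_one
    rw [hF] at hFx
    simpa [h1, (h.density_pos he hxt).ne'] using hFx
  have hsum := (mul_eq_zero.1 hgx).resolve_left (by positivity)
  have hz := (Finset.sum_eq_zero_iff_of_nonneg fun I _ => hterm _ hxt I).1 hsum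
  have h1 : ψ.1 (e.symm (e x)) = ψ'.1 (e.symm (e x)) := by
    refine (chartExpr_eq_iff ψ.1 ψ'.1 he hxt).1 (formCoeff_ext fun I => ?_)
    have h2 := (mul_eq_zero.1 (hz I (Finset.mem_univ I))).resolve_left (h.weight_pos he I hxt).ne'
    rw [Complex.normSq_eq_zero, hcφ] at h2
    exact sub_eq_zero.1 h2
  rwa [e.left_inv hxs] at h1

theorem HermitianMetric.IsSplit.existsUnique_formalAdjoint {h : HermitianMetric n X}
    (hs : h.IsSplit) {P : ∀ k, smoothForms n X k → smoothForms n X (k + 1)}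
    {Q : ∀ k, smoothForms n X (k + 1) → smoothForms n X k} (hQ : IsFormalAdjoint h P Q) :
    ∃! Q, IsFormalAdjoint h P Q :=
  ⟨Q, hQ, fun Q' hQ' => funext fun k => funext fun ψ => hs.eq_of_l2Inner_eq fun η hη =>
    (hQ' k ψ η hη).trans (hQ k ψ η hη).symm⟩

/-- `formalAdjoint` selects an unspecified adjoint; uniqueness identifies it with the explicit one.
-/
theorem HermitianMetric.IsSplit.formalAdjoint_eq {h : HermitianMetric n X}
    (hs : h.IsSplit) {P : ∀ k, smoothForms n X k → smoothForms n X (k + 1)}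
    {Q : ∀ k, smoothForms n X (k + 1) → smoothForms n X k} (hQ : IsFormalAdjoint h P Q) :
    formalAdjoint h P = Q :=
  (hs.existsUnique_formalAdjoint hQ).unique (Classical.epsilon_spec ⟨Q, hQ⟩) hQ

end Adjoint

/-! ### The theorem -/

theorem mainTheorem8 {n : ℕ} {X : Type*} [TopologicalSpace X] [T2Space X]
    [SecondCountableTopology X] [MeasurableSpace X] [BorelSpace X] [ChartedSpace (Cn n) X]
    [HasGroupoid X (rigidGroupoid n)] (h : HermitianMetric n X) (hd : h.IsDistinctiveKahler) :
    (∃! Q, IsFormalAdjoint h (extD (n := n) (X := X)) Q) ∧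
    (∀ j : Fin n, ∃! Q, IsFormalAdjoint h (xi (X := X) j) Q) ∧
    (∀ (k : ℕ) (ψ : smoothForms n X k),
      laplacian h extD k ψ = (2 : ℂ) • ∑ j : Fin n, laplacian h (xi j) k ψ) ∧
    (∀ (α β : Fin n → Fin 2) (k : ℕ) (ψ : smoothForms n X k), IsOfType α β ψ →
      IsOfType α β (laplacian h extD k ψ)) := by
  have hs := hd.isSplit
  have hlap : ∀ (k : ℕ) (ψ : smoothForms n X k), laplacian h extD k ψ =
      (2 : ℂ) • ∑ j : Fin n, partialLaplacian hs (.inl j) (.inl j) k ψ := fun k ψ => by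
    rw [laplacian_extD hs (hs.formalAdjoint_eq hs.isFormalAdjoint_extD), sum_partialLaplacian]
  refine ⟨hs.existsUnique_formalAdjoint hs.isFormalAdjoint_extD,
    fun j => hs.existsUnique_formalAdjoint (hs.isFormalAdjoint_xi j), fun k ψ => ?_,
    fun α β k ψ hψ => ?_⟩
  · rw [hlap]
    congr 1
    exact Finset.sum_congr rfl fun j _ =>
      (laplacian_xi hs j (hs.formalAdjoint_eq (hs.isFormalAdjoint_xi j)) k ψ).symm
  · rw [isOfType_iff] at hψ ⊢
    rw [hlap]
    exact (HasMultidegree.sum _ fun j => hψ.partialLaplacian hs k (.inl j)).smul 2
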